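/- Let $0<\lambda\le\infty$, let $(N_q,g_{N_q})$, $q=1,\dots,p$, be compact smooth Riemannian manifolds without boundary, $\dim N_q=m_q$, let $N=\prod_{q=1}^p N_q$ and $m=\sum_{q=1}^p m_q$, and let $s_q:[0,\lambda)\to[0,\infty)$ be continuous functions such that $$A(r):=\prod_{q=1}^p s_q(r)^{m_q}>0\qquad\text{for } 0<r<\lambda .$$ Equip $M=[0,\lambda)\times N$ (with the product topology) with the multiply warped product metric $$g=dr^2+\sum_{q=1}^p s_q(r)^2g_{N_q},$$ which may degenerate at $r=0$. Volumes in $M$ and areas of hypersurfaces (with area element $dS$) are the $(m+1)$- and $m$-dimensional Hausdorff measures of the Riemannian distance of $g$ (points at distance zero being identified), normalized to agree with Lebesgue measure on Euclidean spaces. Boundaries are topological boundaries in $M$. For $0\le r<\lambda$ put $B_r=\{(t,\theta)\in M: t<r\}$ and $V(r)=|B_r|$ (volume). Let $\Omega\subset M$ be a non-empty open set with compact closure in $M$ whose boundary $\partial\Omega$ is Lipschitz at each of its points with $r>0$ (near such a point, in a product chart and after a linear change of coordinates, $\Omega$ is the region above the graph of a Lipschitz function). Let $\Omega^\#=B_R$,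 $0\le R<\lambda$, be the region with $|B_R|=|\Omega|$. Assume: 1. the classical isoperimetric inequality $|\partial\Omega|\ge|\partial\Omega^\#|$ holds for $\Omega$ (for instance, because it holds for all such sets in $(M,g)$); 2. $a:[0,\lambda)\to[0,\infty)$ is continuous and, with $b(r):=a(r)-a(0)$, the function $r\mapsto b(r)A(r)$ is non-decreasing on $[0,\lambda)$; 3. the function $u\mapsto b(V^{-1}(u))\,A(V^{-1}(u))$ is convex on $V([0,\lambda))$. Then $$\int_{\partial\Omega}a(r)\,dS\ \ge\ \int_{\partial\Omega^\#}a(r)\,dS ,$$ where the left-hand side may be $+\infty$. Suppose moreover that $b(r)A(r)>0$ for $0<r<\lambda$, that every $N_q$ is connected, and that $\Omega$ does not omit only points of $\{r=0\}$ near that slice, i.e. if $\Omega\supseteq(0,\varepsilon)\times N$ for some $\varepsilon>0$, then $\Omega\supseteq\{0\}\times N$. Then equality holds if and only if $\partial\Omega$ is a coordinate slice, that is, $\partial\Omega=\{r=c\}$ for some $c\in[0,\lambda)$. -/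

import Mathlib

open Set MeasureTheory
open scoped Manifold ContDiff ENNReal NNReal

noncomputable section

/-- The half-open interval `[0, lam)`, where `lam ≤ ∞`. -/
abbrev radii (lam : EReal) : Set ℝ := {r | 0 ≤ r ∧ (r : EReal) < lam}

/-- The product manifold `[0, lam) × ∏ q, N q`, with its product topology.
The radial coordinate of `x` is `x.1` and its component in `N q` is `x.2 q`. -/
abbrev WarpedProduct (lam : EReal) {p : ℕ} (N : Fin p → Type*) : Type _ :=
  radii lam × ∀ q, N q

/-- Smooth Riemannian metrics on an `n`-dimensional manifold. -/
abbrev SmoothMetric (n : ℕ) (N : Type*) [TopologicalSpace N]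
    [ChartedSpace (EuclideanSpace ℝ (Fin n)) N] [IsManifold (𝓡 n) ∞ N] : Type _ :=
  Bundle.ContMDiffRiemannianMetric (𝓡 n) ∞ (EuclideanSpace ℝ (Fin n))
    (fun x : N => TangentSpace (𝓡 n) x)

/-- The function `A(r) = ∏ q, s_q(r) ^ m_q`. -/
def areaFactor {p : ℕ} (m : Fin p → ℕ) (s : Fin p → ℝ → ℝ) (r : ℝ) : ℝ :=
  ∏ q, s q r ^ m q

section Geometry

variable {lam : EReal} {p : ℕ} {m : Fin p → ℕ} {N : Fin p → Type*}
  [∀ q, TopologicalSpace (N q)] [∀ q, ChartedSpace (EuclideanSpace ℝ (Fin (m q))) (N q)]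

variable (lam m N) in
/-- A `C¹` curve `[0, 1] → [0, lam) × ∏ q, N q`, given by its components
(whose values outside `[0, 1]` are irrelevant). -/
structure C1Curve where
  rad : ℝ → ℝ
  base : ∀ q, ℝ → N q
  rad_mem : ∀ t ∈ Icc (0 : ℝ) 1, rad t ∈ radii lam
  contDiffOn_rad : ContDiffOn ℝ 1 rad (Icc 0 1)
  contMDiffOn_base : ∀ q, ContMDiffOn 𝓘(ℝ, ℝ) (𝓡 (m q)) 1 (base q) (Icc 0 1)

namespace C1Curve

/-- The initial point of the curve. -/
def source (c : C1Curve lam m N) : WarpedProduct lam N :=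
  (⟨c.rad 0, c.rad_mem 0 (by simp)⟩, fun q => c.base q 0)

/-- The end point of the curve. -/
def target (c : C1Curve lam m N) : WarpedProduct lam N :=
  (⟨c.rad 1, c.rad_mem 1 (by simp)⟩, fun q => c.base q 1)

/-- The velocity of the component of the curve in `N q`. -/
def velocity (c : C1Curve lam m N) (q : Fin p) (t : ℝ) :
    TangentSpace (𝓡 (m q)) (c.base q t) :=
  mfderivWithin 𝓘(ℝ, ℝ) (𝓡 (m q)) (c.base q) (Icc 0 1) t (1 : ℝ)

variable [∀ q, IsManifold (𝓡 (m q)) ∞ (N q)]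

/-- The length of the curve for the metric `dr² + ∑ q, s_q(r)² g_q`. -/
def length (g : ∀ q, SmoothMetric (m q) (N q)) (s : Fin p → ℝ → ℝ)
    (c : C1Curve lam m N) : ℝ≥0∞ :=
  ∫⁻ t in Icc (0 : ℝ) 1, ENNReal.ofReal (Real.sqrt
    (derivWithin c.rad (Icc 0 1) t ^ 2 + ∑ q, s q (c.rad t) ^ 2 *
      (g q).inner (c.base q t) (c.velocity q t) (c.velocity q t)))

end C1Curve

variable [∀ q, IsManifold (𝓡 (m q)) ∞ (N q)]

/-- `JoinedByLength g s x y ℓ`: the points `x` and `y` are joined by a piecewise `C¹` curve of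
length `ℓ` for the metric `dr² + ∑ q, s_q(r)² g_q` (each `C¹` piece may be traversed in either
direction). -/
inductive JoinedByLength (g : ∀ q, SmoothMetric (m q) (N q)) (s : Fin p → ℝ → ℝ)
    (x : WarpedProduct lam N) : WarpedProduct lam N → ℝ≥0∞ → Prop
  | refl : JoinedByLength g s x x 0
  | forward {ℓ : ℝ≥0∞} (c : C1Curve lam m N) :
      JoinedByLength g s x c.source ℓ → JoinedByLength g s x c.target (ℓ + c.length g s)
  | backward {ℓ : ℝ≥0∞} (c : C1Curve lam m N) :
      JoinedByLength g s x c.target ℓ → JoinedByLength g s x c.source (ℓ + c.length g s)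

namespace JoinedByLength

variable {g : ∀ q, SmoothMetric (m q) (N q)} {s : Fin p → ℝ → ℝ}

theorem trans {x y z : WarpedProduct lam N} {ℓ ℓ' : ℝ≥0∞} (h : JoinedByLength g s x y ℓ)
    (h' : JoinedByLength g s y z ℓ') : JoinedByLength g s x z (ℓ + ℓ') := by
  induction h' with
  | refl => simpa using h
  | forward c _ ih => rw [← add_assoc]; exact forward c ih
  | backward c _ ih => rw [← add_assoc]; exact backward c ih

theorem symm {x y : WarpedProduct lam N} {ℓ : ℝ≥0∞} (h : JoinedByLength g s x y ℓ) :
    JoinedByLength g s y x ℓ := by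
  induction h with
  | refl => exact refl
  | forward c _ ih =>
    have h1 := (backward c (refl (g := g) (s := s) (x := c.target))).trans ih
    rwa [zero_add, add_comm] at h1
  | backward c _ ih =>
    have h1 := (forward c (refl (g := g) (s := s) (x := c.source))).trans ih
    rwa [zero_add, add_comm] at h1

end JoinedByLength

/-- The Riemannian (pseudo-)distance of the metric `dr² + ∑ q, s_q(r)² g_q`: the infimum of the
lengths of the piecewise `C¹` curves joining two points. -/
def warpedDist (g : ∀ q, SmoothMetric (m q) (N q)) (s : Fin p → ℝ → ℝ)
    (x y : WarpedProduct lam N) : ℝ≥0∞ :=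
  ⨅ (ℓ : ℝ≥0∞) (_ : JoinedByLength g s x y ℓ), ℓ

/-- The set `[0, lam) × ∏ q, N q`, seen as a pseudo-metric space for the Riemannian distance.
Distinct points can have distance zero only if they lie in the slice `{r = 0}` and the metric
degenerates there. -/
def WarpedPseudoSpace (lam : EReal) (_g : ∀ q, SmoothMetric (m q) (N q))
    (_s : Fin p → ℝ → ℝ) : Type _ :=
  WarpedProduct lam N

instance (g : ∀ q, SmoothMetric (m q) (N q)) (s : Fin p → ℝ → ℝ) :
    PseudoEMetricSpace (WarpedPseudoSpace lam g s) where
  edist x y := warpedDist (lam := lam) g s x y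
  edist_self x := le_antisymm (iInf₂_le 0 .refl) (zero_le)
  edist_comm x y := by
    have key : ∀ x y : WarpedProduct lam N, warpedDist g s x y ≤ warpedDist g s y x :=
      fun x y => le_iInf₂ fun ℓ h => iInf₂_le ℓ h.symm
    exact le_antisymm (key x y) (key y x)
  edist_triangle x y z := by
    simp only [warpedDist, ENNReal.iInf_add, ENNReal.add_iInf]
    exact le_iInf₂ fun ℓ' h' => le_iInf₂ fun ℓ h => iInf₂_le (ℓ + ℓ') (h.trans h')

/-- The metric space of the Riemannian distance of `dr² + ∑ q, s_q(r)² g_q`, obtained by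
identifying points at distance zero. -/
abbrev WarpedMetricSpace (lam : EReal) (g : ∀ q, SmoothMetric (m q) (N q))
    (s : Fin p → ℝ → ℝ) : Type _ :=
  SeparationQuotient (WarpedPseudoSpace lam g s)

instance (g : ∀ q, SmoothMetric (m q) (N q)) (s : Fin p → ℝ → ℝ) :
    MeasurableSpace (WarpedMetricSpace lam g s) := borel _

instance (g : ∀ q, SmoothMetric (m q) (N q)) (s : Fin p → ℝ → ℝ) :
    BorelSpace (WarpedMetricSpace lam g s) := ⟨rfl⟩

/-- The canonical map to the metric space of the Riemannian distance. -/
def toMetric (g : ∀ q, SmoothMetric (m q) (N q)) (s : Fin p → ℝ → ℝ)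
    (x : WarpedProduct lam N) : WarpedMetricSpace lam g s :=
  SeparationQuotient.mk (X := WarpedPseudoSpace lam g s) x

theorem C1Curve.edist_rad_le_length (g : ∀ q, SmoothMetric (m q) (N q)) (s : Fin p → ℝ → ℝ)
    (c : C1Curve lam m N) : edist (c.rad 0) (c.rad 1) ≤ c.length g s := by
  rw [edist_comm, edist_eq_enorm_sub]
  refine (enorm_sub_le_lintegral_derivWithin_Icc_of_contDiffOn_Icc c.contDiffOn_rad
    zero_le_one).trans ?_
  refine lintegral_mono fun t => ?_
  rw [← ofReal_norm]
  refine ENNReal.ofReal_le_ofReal ?_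
  rw [Real.norm_eq_abs]
  refine Real.abs_le_sqrt (le_add_of_nonneg_right (Finset.sum_nonneg fun q _ => ?_))
  refine mul_nonneg (sq_nonneg _) ?_
  by_cases h : c.velocity q t = 0
  · rw [h, map_zero]
  · exact ((g q).pos _ _ h).le

theorem edist_rad_le_warpedDist (g : ∀ q, SmoothMetric (m q) (N q)) (s : Fin p → ℝ → ℝ)
    (x y : WarpedProduct lam N) : edist (x.1 : ℝ) (y.1 : ℝ) ≤ warpedDist g s x y := by
  refine le_iInf₂ fun ℓ h => ?_
  induction h with
  | refl => simp
  | forward c _ ih =>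
    exact (edist_triangle _ _ _).trans (add_le_add ih (c.edist_rad_le_length g s))
  | backward c _ ih =>
    refine (edist_triangle _ _ _).trans (add_le_add ih ?_)
    rw [edist_comm]
    exact c.edist_rad_le_length g s

/-- The radial coordinate on the metric space of the Riemannian distance. -/
def radius (g : ∀ q, SmoothMetric (m q) (N q)) (s : Fin p → ℝ → ℝ) :
    WarpedMetricSpace lam g s → ℝ :=
  SeparationQuotient.lift (fun x : WarpedPseudoSpace lam g s => (x.1 : ℝ)) fun x y h => by
    have h0 : warpedDist (lam := lam) g s x y = 0 := EMetric.inseparable_iff.1 h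
    have h1 := edist_rad_le_warpedDist (lam := lam) g s x y
    rw [h0] at h1
    exact edist_le_zero.1 h1

@[simp] theorem radius_toMetric (g : ∀ q, SmoothMetric (m q) (N q)) (s : Fin p → ℝ → ℝ)
    (x : WarpedProduct lam N) : radius g s (toMetric g s x) = x.1 := rfl

/-- The Riemannian volume of a subset: its `(∑ q, m q + 1)`-dimensional Hausdorff measure for the
Riemannian distance, normalized so as to agree with Lebesgue measure on Euclidean spaces. -/
def riemVolume (g : ∀ q, SmoothMetric (m q) (N q)) (s : Fin p → ℝ → ℝ)
    (S : Set (WarpedProduct lam N)) : ℝ≥0∞ :=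
  (μHE[(∑ q, m q) + 1] : Measure (WarpedMetricSpace lam g s)) (toMetric g s '' S)

/-- The area of a hypersurface: its `(∑ q, m q)`-dimensional normalized Hausdorff measure for the
Riemannian distance. -/
def riemArea (g : ∀ q, SmoothMetric (m q) (N q)) (s : Fin p → ℝ → ℝ)
    (S : Set (WarpedProduct lam N)) : ℝ≥0∞ :=
  (μHE[∑ q, m q] : Measure (WarpedMetricSpace lam g s)) (toMetric g s '' S)

/-- The integral `∫_S a(r) dS` of a non-negative radial function `a` over a hypersurface `S`. -/
def areaIntegral (g : ∀ q, SmoothMetric (m q) (N q)) (s : Fin p → ℝ → ℝ) (a : ℝ → ℝ)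
    (S : Set (WarpedProduct lam N)) : ℝ≥0∞ :=
  ∫⁻ z in toMetric g s '' S, ENNReal.ofReal (a (radius g s z))
    ∂(μHE[∑ q, m q] : Measure (WarpedMetricSpace lam g s))

variable (lam N) in
/-- The region `B_R = {r < R}`. -/
def radialBall (R : ℝ) : Set (WarpedProduct lam N) := {x | (x.1 : ℝ) < R}

variable (lam N) in
/-- The coordinate slice `{r = R}`. -/
def slice (R : ℝ) : Set (WarpedProduct lam N) := {x | (x.1 : ℝ) = R}

variable (lam) in
/-- The function `V(r) = |B_r|`. -/
def ballVolume (g : ∀ q, SmoothMetric (m q) (N q)) (s : Fin p → ℝ → ℝ) (r : ℝ) : ℝ :=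
  (riemVolume g s (radialBall lam N r)).toReal

variable (lam) in
/-- The inverse `V⁻¹` of `V` on `[0, lam)`. -/
def ballVolumeInv (g : ∀ q, SmoothMetric (m q) (N q)) (s : Fin p → ℝ → ℝ) (u : ℝ) : ℝ :=
  Function.invFunOn (ballVolume lam g s) (radii lam) u

end Geometry

section Lipschitz

variable {lam : EReal} {p : ℕ} {N : Fin p → Type*} [∀ q, TopologicalSpace (N q)]

/-- The boundary of `Ω` is Lipschitz at `x₀`: in the product chart at `x₀`, and up to a linear
change of coordinates, `Ω` is near `x₀` the open region above the graph of a Lipschitz function of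
`∑ q, m q` variables. -/
def LipschitzBoundaryAt (m : Fin p → ℕ) [∀ q, ChartedSpace (EuclideanSpace ℝ (Fin (m q))) (N q)]
    (Ω : Set (WarpedProduct lam N)) (x₀ : WarpedProduct lam N) : Prop :=
  ∃ (T : (ℝ × ∀ q, EuclideanSpace ℝ (Fin (m q))) ≃L[ℝ]
        (EuclideanSpace ℝ (Fin (∑ q, m q)) × ℝ))
    (f : EuclideanSpace ℝ (Fin (∑ q, m q)) → ℝ) (K : ℝ≥0) (W : Set (WarpedProduct lam N)),
    LipschitzWith K f ∧ IsOpen W ∧ x₀ ∈ W ∧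
    ∀ x ∈ W,
      (∀ q, x.2 q ∈ (chartAt (EuclideanSpace ℝ (Fin (m q))) (x₀.2 q)).source) ∧
      (x ∈ Ω ↔
        f (T (x.1, fun q => chartAt (EuclideanSpace ℝ (Fin (m q))) (x₀.2 q) (x.2 q))).1 <
          (T (x.1, fun q => chartAt (EuclideanSpace ℝ (Fin (m q))) (x₀.2 q) (x.2 q))).2)

end Lipschitz

end

/-!
Write `A = areaFactor m s` and `b r = a r - a 0`. As `b A` is non-decreasing and vanishes at `0`,
the weight `b` is non-negative. The weighted area for `a` is `a 0` times the area plus the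
weighted area for `b` (`areaIntegral_eq_add`); the classical isoperimetric inequality takes care
of the first term, so that it remains to compare the weighted areas for `b`. This needs no
isoperimetric inequality.

For a point `θ` of the base let `ρ(θ) = radialSup Ω θ` be the outer radius of `Ω` above `θ`. If
`ρ(θ) > 0`, the point `(ρ(θ), θ)` is a boundary point, and the projection to the base along the
radial direction decreases areas, up to the factor `A`. Hence the area of the boundary is at least
`A(ρ(θ)) dθ`, carried by the graph of `ρ` (`graphMeasure_le`). On the other hand, as a function of
the volume of balls, `b A` is convex and non-decreasing, so that it has a supporting line of
non-negative slope at the volume of `Ω`; since the region under the graph of `ρ` contains `Ω`,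
integration over the base gives `∫ b(ρ) A(ρ) dθ ≥ b(R) A(R) |N|`, which is Jensen's inequality
(`le_lintegral_radialSup`).

All this takes place in the interior `{r > 0}`, where the metric does not degenerate: in a product
chart adapted to the metric at a point, the Riemannian distance is Euclidean up to factors
arbitrarily close to one (`exists_nhds_warpChart_almost_isometry`). Comparing measures locally
with such factors (`measure_le_of_locally`) identifies the volume with `A(r) dr dθ`
(`polarMeasure_eq_prod`) and the area in a slice with `A(r) dθ`
(`comap_polarMeasure_eq_smul_baseMeasure`). The slice `{r = 0}` has no volume, and the weight `b`
does not see its area.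

In the case of equality, with `b A > 0`, the area of the boundary in the interior is exactly the
measure `A(ρ(θ)) dθ` on the graph of `ρ` (`graphMeasure_eq_of_areaIntegral_le`). Near an interior
boundary point the boundary is a Lipschitz graph, which therefore has locally the same area as its
radial projection. A linear contraction that shortens some tangent vector strictly decreases
areas, so that almost every tangent plane is orthogonal to the radial direction
(`ae_hasFDerivAt_zero_of_forall_exists_frame`): the radius is locally constant on the boundary. As
the base is connected, the boundary contains the slice through each of its interior points; two
slices are impossible because each of them would carry the whole area of the graph
(`exists_frontier_subset_slice`). A connectedness argument then shows that `Ω` is a ball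
(`eq_radialBall_of_frontier_subset_slice`). The same argument shows that a set bounded by a slice
is a ball, whose radius is determined by its volume.
-/

section

open Filter Topology

/-! ### Comparison of lengths and measures -/

/-- If the displacement of a path is bounded by the integral of `v` over every short interval to the
right of a given time, then it is so over the whole interval, by continuous induction. -/
theorem edist_le_lintegral_of_locally {E : Type*} [PseudoEMetricSpace E] {f : ℝ → E}
    {v : ℝ → ℝ≥0∞} (hf : ContinuousOn f (Icc 0 1))
    (hloc : ∀ t ∈ Ico (0 : ℝ) 1, ∃ t' > t, ∀ u ∈ Icc t t', u ≤ 1 →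
      edist (f t) (f u) ≤ ∫⁻ x in Icc t u, v x) :
    edist (f 0) (f 1) ≤ ∫⁻ x in Icc (0 : ℝ) 1, v x := by
  by_cases htop : ∫⁻ x in Icc (0 : ℝ) 1, v x = ⊤
  · simp [htop]
  have hadd : ∀ {t u : ℝ}, 0 ≤ t → t ≤ u →
      (∫⁻ x in Icc 0 t, v x) + ∫⁻ x in Icc t u, v x = ∫⁻ x in Icc 0 u, v x := by
    intro t u h0 h1
    rw [setLIntegral_congr (Ioc_ae_eq_Icc (a := t) (b := u)).symm,
      ← lintegral_union measurableSet_Ioc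
        (Set.disjoint_left.2 fun x hx hx' => absurd hx.2 (not_le.2 hx'.1)),
      Icc_union_Ioc_eq_Icc h0 h1]
  let s : Set ℝ := {t | edist (f 0) (f t) ≤ ∫⁻ x in Icc 0 t, v x}
  have hs : IsClosed (s ∩ Icc 0 1) := by
    refine isClosed_of_closure_subset fun t ht => ?_
    have htI : t ∈ Icc (0 : ℝ) 1 :=
      closure_minimal inter_subset_right isClosed_Icc ht
    refine ⟨?_, htI⟩
    have : (𝓝[s ∩ Icc 0 1] t).NeBot := mem_closure_iff_nhdsWithin_neBot.1 ht
    have h1 : Tendsto (fun u => edist (f u) (f t)) (𝓝[s ∩ Icc 0 1] t) (𝓝 0) := by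
      have := (hf t htI).mono_left (nhdsWithin_mono t (inter_subset_right (s := s)))
      exact tendsto_iff_edist_tendsto_0.1 this
    have h2 : Tendsto (fun u => ∫⁻ x in Icc t u, v x ∂(volume.restrict (Icc (0 : ℝ) 1)))
        (𝓝[s ∩ Icc 0 1] t) (𝓝 0) := by
      refine tendsto_setLIntegral_zero htop ?_
      have h3 : Tendsto (fun u => ENNReal.ofReal (u - t)) (𝓝[s ∩ Icc 0 1] t) (𝓝 0) := by
        have : Tendsto (fun u : ℝ => ENNReal.ofReal (u - t)) (𝓝 t) (𝓝 (ENNReal.ofReal (t - t))) :=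
          (ENNReal.continuous_ofReal.comp (continuous_id.sub continuous_const)).tendsto t
        simp only [sub_self, ENNReal.ofReal_zero] at this
        exact this.mono_left nhdsWithin_le_nhds
      refine tendsto_of_tendsto_of_tendsto_of_le_of_le tendsto_const_nhds h3
        (fun _ => zero_le) fun u => ?_
      exact (Measure.restrict_apply_le _ _).trans (by rw [Real.volume_Icc])
    have h4 : Tendsto (fun u => (∫⁻ x in Icc 0 t, v x) +
        (∫⁻ x in Icc t u, v x ∂(volume.restrict (Icc (0 : ℝ) 1))) + edist (f u) (f t))
        (𝓝[s ∩ Icc 0 1] t) (𝓝 ((∫⁻ x in Icc 0 t, v x) + 0 + 0)) :=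
      (tendsto_const_nhds.add h2).add h1
    simp only [add_zero] at h4
    refine ge_of_tendsto h4 ?_
    filter_upwards [self_mem_nhdsWithin] with u hu
    refine (edist_triangle (f 0) (f u) (f t)).trans (add_le_add ?_ le_rfl)
    refine (show edist (f 0) (f u) ≤ ∫⁻ x in Icc 0 u, v x from hu.1).trans ?_
    rcases le_total t u with h | h
    · rw [← hadd htI.1 h, Measure.restrict_restrict measurableSet_Icc,
        inter_eq_self_of_subset_left (Icc_subset_Icc htI.1 hu.2.2)]
    · exact (lintegral_mono_set (Icc_subset_Icc_right h)).trans le_self_add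
  have h0 : (0 : ℝ) ∈ s := by simp [s]
  have key := hs.Icc_subset_of_forall_exists_gt h0 ?_
  · exact key (right_mem_Icc.2 zero_le_one)
  rintro t ⟨hts, htI⟩ y hy
  obtain ⟨t', ht', h⟩ := hloc t htI
  have hlt : t < min (min t' y) 1 := lt_min (lt_min ht' hy) htI.2
  refine ⟨min (min t' y) 1, ?_, hlt, (min_le_left _ _).trans (min_le_right _ _)⟩
  change edist _ _ ≤ _
  rw [← hadd htI.1 hlt.le]
  exact (edist_triangle _ (f t) _).trans (add_le_add hts
    (h _ ⟨hlt.le, (min_le_left _ _).trans (min_le_left _ _)⟩ (min_le_right _ _)))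

/-- Comparison of distances gives comparison of the Hausdorff measures of parametrized sets. -/
theorem euclideanHausdorffMeasure_image_le {α X Y : Type*} [EMetricSpace X] [MeasurableSpace X]
    [BorelSpace X] [EMetricSpace Y] [MeasurableSpace Y] [BorelSpace Y] (d : ℕ) {f : α → X}
    {h : α → Y} {S : Set α} (K : ℝ≥0)
    (hfh : ∀ x ∈ S, ∀ y ∈ S, edist (h x) (h y) ≤ K * edist (f x) (f y)) :
    (μHE[d] : Measure Y) (h '' S) ≤ (K : ℝ≥0∞) ^ d * (μHE[d] : Measure X) (f '' S) := by
  classical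
  rcases S.eq_empty_or_nonempty with rfl | ⟨x₀, hx₀⟩
  · simp
  have : Nonempty α := ⟨x₀⟩
  let k : X → Y := fun z => h (Function.invFunOn f S z)
  have hk : LipschitzOnWith K k (f '' S) := by
    intro z hz w hw
    have hz' := Function.invFunOn_mem hz
    have hw' := Function.invFunOn_mem hw
    have hz2 := Function.invFunOn_eq hz
    have hw2 := Function.invFunOn_eq hw
    have := hfh _ hz' _ hw'
    rwa [hz2, hw2] at this
  have himg : k '' (f '' S) = h '' S := by
    rw [image_image]
    refine image_congr fun x hx => ?_
    have hz : f x ∈ f '' S := mem_image_of_mem f hx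
    have := hfh _ (Function.invFunOn_mem hz) _ hx
    rw [Function.invFunOn_eq hz, edist_self, mul_zero] at this
    exact edist_le_zero.1 this
  have h1 := hk.hausdorffMeasure_image_le (d := d) (Nat.cast_nonneg d)
  rw [himg, ENNReal.rpow_natCast] at h1
  simp only [Measure.euclideanHausdorffMeasure_def, Measure.smul_apply]
  simp only [ENNReal.smul_def, smul_eq_mul]
  rw [mul_left_comm]
  gcongr

/-- A local comparison of two Borel measures is a global one. -/
theorem measure_le_smul_of_locally {X : Type*} [TopologicalSpace X] [SecondCountableTopology X]
    [MeasurableSpace X] [OpensMeasurableSpace X] {μ ν : Measure X} {O : Set X} (hO : μ Oᶜ = 0)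
    (κ : ℝ≥0∞)
    (h : ∀ x ∈ O, ∃ U ∈ 𝓝 x, ∀ S ⊆ U, MeasurableSet S → μ S ≤ κ * ν S) : μ ≤ κ • ν := by
  choose! U hU hUS using h
  obtain ⟨t, htO, htc, ht⟩ := TopologicalSpace.countable_cover_nhdsWithin
    (f := fun x => interior (U x)) (s := O)
    fun x hx => mem_nhdsWithin_of_mem_nhds (interior_mem_nhds.2 (hU x hx))
  rcases t.eq_empty_or_nonempty with rfl | hne
  · have : O = ∅ := by simpa using ht
    subst this
    simp only [compl_empty] at hO
    rw [Measure.measure_univ_eq_zero.1 hO]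
    exact Measure.zero_le _
  obtain ⟨e, rfl⟩ := htc.exists_eq_range hne
  refine Measure.le_iff.2 fun S hS => ?_
  let V : ℕ → Set X := disjointed fun n => interior (U (e n))
  have hVm : ∀ n, MeasurableSet (V n) :=
    fun n => MeasurableSet.disjointed (fun n => isOpen_interior.measurableSet) n
  have hVsub : ∀ n, V n ⊆ U (e n) := fun n => (disjointed_subset _ n).trans interior_subset
  have hcov : O ⊆ ⋃ n, V n := by
    rw [iUnion_disjointed]
    simpa using ht
  calc μ S ≤ μ ((⋃ n, S ∩ V n) ∪ Oᶜ) := by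
        refine measure_mono fun x hx => ?_
        by_cases hxO : x ∈ O
        · left
          rw [← inter_iUnion]
          exact ⟨hx, hcov hxO⟩
        · exact Or.inr hxO
    _ ≤ μ (⋃ n, S ∩ V n) + μ Oᶜ := measure_union_le _ _
    _ ≤ ∑' n, μ (S ∩ V n) := by rw [hO, add_zero]; exact measure_iUnion_le _
    _ ≤ ∑' n, κ * ν (S ∩ V n) := ENNReal.tsum_le_tsum fun n =>
        hUS _ (htO (mem_range_self n)) _ (inter_subset_right.trans (hVsub n)) (hS.inter (hVm n))
    _ = κ * ν (⋃ n, S ∩ V n) := by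
        rw [ENNReal.tsum_mul_left, measure_iUnion _ fun n => hS.inter (hVm n)]
        exact fun i j hij => (disjoint_disjointed _ hij).mono inter_subset_right inter_subset_right
    _ ≤ κ * ν S := by
        gcongr
        exact iUnion_subset fun n => inter_subset_left

/-- Two Borel measures can be compared locally, up to factors arbitrarily close to one. -/
theorem measure_le_of_locally {X : Type*} [TopologicalSpace X] [SecondCountableTopology X]
    [MeasurableSpace X] [OpensMeasurableSpace X] {μ ν : Measure X} {O : Set X} (hO : μ Oᶜ = 0)
    (h : ∀ κ : ℝ≥0, 1 < κ → ∀ x ∈ O, ∃ U ∈ 𝓝 x, ∀ S ⊆ U, MeasurableSet S → μ S ≤ κ * ν S) :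
    μ ≤ ν := by
  refine Measure.le_iff.2 fun S hS => ?_
  have h1 : ∀ κ : ℝ≥0, 1 < κ → μ S ≤ κ * ν S := fun κ hκ =>
    (measure_le_smul_of_locally hO κ (h κ hκ)) S
  by_cases htop : ν S = ⊤
  · simp [htop]
  have h2 : Tendsto (fun κ : ℝ≥0 => (κ : ℝ≥0∞) * ν S) (𝓝[>] 1) (𝓝 (((1 : ℝ≥0) : ℝ≥0∞) * ν S)) := by
    refine ENNReal.Tendsto.mul_const ?_ (Or.inr htop)
    exact (ENNReal.continuous_coe.tendsto 1).mono_left nhdsWithin_le_nhds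
  simp only [ENNReal.coe_one, one_mul] at h2
  refine ge_of_tendsto h2 ?_
  filter_upwards [self_mem_nhdsWithin] with κ hκ using h1 κ hκ

/-! ### Supporting lines, contractions, Lipschitz functions and comparable measures -/

/-- A convex function has a supporting line at every interior point of its domain. -/
theorem ConvexOn.exists_supporting_line {S : Set ℝ} {h : ℝ → ℝ} (hh : ConvexOn ℝ S h) {x : ℝ}
    (hx : x ∈ interior S) : ∃ k, ∀ y ∈ S, h x + k * (y - x) ≤ h y := by
  refine ⟨derivWithin h (Ioi x) x, fun y hy => ?_⟩
  rcases lt_trichotomy x y with hxy | rfl | hxy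
  · have := hh.rightDeriv_le_slope_of_mem_interior hx hy hxy
    rw [slope_def_field, le_div_iff₀ (sub_pos.2 hxy)] at this
    linarith
  · simp
  · have := (hh.slope_le_leftDeriv_of_mem_interior hy hx hxy).trans
      (hh.leftDeriv_le_rightDeriv_of_mem_interior hx)
    rw [slope_def_field, div_le_iff₀ (sub_pos.2 hxy)] at this
    linarith

/-- A linear contraction of a Euclidean space that shortens some vector has determinant of absolute
value less than one: otherwise it would map the closed unit ball onto itself. -/
theorem abs_det_lt_one_of_contraction {E : Type*} [NormedAddCommGroup E] [InnerProductSpace ℝ E]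
    [FiniteDimensional ℝ E] (C : E →L[ℝ] E) (hC : ∀ x, ‖C x‖ ≤ ‖x‖) {v : E} (hv : ‖C v‖ < ‖v‖) :
    |C.det| < 1 := by
  borelize E
  by_contra! hdet
  have hne : C.det ≠ 0 := fun h => by rw [h] at hdet; norm_num at hdet
  let e : E ≃L[ℝ] E := C.toContinuousLinearEquivOfDetNeZero hne
  have hcoe : ∀ x, e x = C x := fun x => by simp [e]
  have hsub : e '' Metric.closedBall 0 1 ⊆ Metric.closedBall 0 1 := by
    rintro _ ⟨x, hx, rfl⟩
    rw [mem_closedBall_zero_iff] at hx ⊢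
    rw [hcoe]
    exact (hC x).trans hx
  have hclosed : IsClosed (e '' Metric.closedBall 0 1) :=
    e.toHomeomorph.isClosed_image.2 Metric.isClosed_closedBall
  have hvol : volume (Metric.closedBall (0 : E) 1) ≤ volume (e '' Metric.closedBall 0 1) := by
    have : e '' Metric.closedBall 0 1 = C '' Metric.closedBall 0 1 :=
      image_congr fun x _ => hcoe x
    rw [this, Measure.addHaar_image_continuousLinearMap]
    exact le_mul_of_one_le_left zero_le (by rw [← ENNReal.ofReal_one]; gcongr)
  have hdiff : volume (Metric.ball (0 : E) 1 \ e '' Metric.closedBall 0 1) = 0 := by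
    have h1 : volume (Metric.closedBall (0 : E) 1 \ e '' Metric.closedBall 0 1) = 0 := by
      rw [measure_sdiff hsub hclosed.measurableSet.nullMeasurableSet
        (measure_mono hsub |>.trans_lt measure_closedBall_lt_top).ne, tsub_eq_zero_iff_le]
      exact hvol
    exact measure_mono_null (sdiff_subset_sdiff_left Metric.ball_subset_closedBall) h1
  have hempty : Metric.ball (0 : E) 1 ⊆ e '' Metric.closedBall 0 1 := by
    rw [← sdiff_eq_empty]
    exact (Metric.isOpen_ball.sdiff hclosed).measure_eq_zero_iff volume |>.1 hdiff
  obtain ⟨c, hc1, hc2⟩ := exists_between hv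
  have hc0 : 0 < c := (norm_nonneg _).trans_lt hc1
  have hmem : e (c⁻¹ • v) ∈ Metric.ball (0 : E) 1 := by
    rw [mem_ball_zero_iff, map_smul, hcoe, norm_smul, norm_inv, Real.norm_of_nonneg hc0.le,
      inv_mul_lt_iff₀ hc0, mul_one]
    exact hc1
  obtain ⟨w, hw, hwe⟩ := hempty hmem
  rw [e.injective hwe, mem_closedBall_zero_iff, norm_smul, norm_inv, Real.norm_of_nonneg hc0.le,
    inv_mul_le_iff₀ hc0, mul_one] at hw
  exact absurd hw (not_le.2 hc2)

/-- A Lipschitz function whose derivative vanishes almost everywhere in a ball is constant there. -/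
theorem LipschitzWith.eq_of_ae_hasFDerivAt_zero {E : Type*} [NormedAddCommGroup E]
    [NormedSpace ℝ E] [FiniteDimensional ℝ E] [MeasurableSpace E] [BorelSpace E]
    (μ : Measure E) [μ.IsAddHaarMeasure] {u : E → ℝ} {K : ℝ≥0} (hu : LipschitzWith K u) {x : E}
    {δ : ℝ} (hd : ∀ᵐ y ∂μ, y ∈ Metric.ball x δ → HasFDerivAt u (0 : E →L[ℝ] ℝ) y) :
    ∀ y ∈ Metric.ball x δ, u y = u x := by
  intro z hz
  set v := z - x with hv
  -- Along almost every segment of direction `v` the derivative vanishes almost everywhere.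
  have hN : ∀ᵐ y ∂μ, ∀ᵐ t : ℝ, y + t • v ∈ Metric.ball x δ →
      HasFDerivAt u (0 : E →L[ℝ] ℝ) (y + t • v) := by
    obtain ⟨N, hNsub, hNm, hN0⟩ := exists_measurable_superset_of_null (ae_iff.1 hd)
    have hmeas : MeasurableSet {q : E × ℝ | q.1 + q.2 • v ∈ N} :=
      (by fun_prop : Measurable fun q : E × ℝ => q.1 + q.2 • v) hNm
    have h1 : (μ.prod (volume : Measure ℝ)) {q : E × ℝ | q.1 + q.2 • v ∈ N} = 0 := by
      rw [Measure.prod_apply_symm hmeas, lintegral_eq_zero_of_ae_eq_zero]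
      refine Eventually.of_forall fun t => ?_
      have : (fun y : E => (y, t)) ⁻¹' {q : E × ℝ | q.1 + q.2 • v ∈ N} =
        (fun y => y + t • v) ⁻¹' N := rfl
      simp only [this, measure_preimage_add_right, hN0, Pi.zero_apply]
    filter_upwards [Measure.ae_ae_of_ae_prod (measure_eq_zero_iff_ae_notMem.1 h1)] with y hy
    filter_upwards [hy] with t ht hmem
    by_contra hcon
    exact ht (hNsub fun h => hcon (h hmem))
  have hconst : ∀ᵐ y ∂μ, y ∈ Metric.ball x δ → y + v ∈ Metric.ball x δ → u (y + v) = u y := by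
    filter_upwards [hN] with y hy h0 h1
    have hLip : LipschitzWith (K * ‖v‖₊) fun t : ℝ => u (y + t • v) := by
      refine hu.comp (LipschitzWith.of_dist_le_mul fun s t => ?_)
      rw [dist_add_left, dist_eq_norm (s • v), ← sub_smul, norm_smul, mul_comm, dist_eq_norm s]
      rfl
    have hAC := (hLip.lipschitzOnWith (s := uIcc 0 1)).absolutelyContinuousOnInterval
    obtain ⟨c, hc⟩ := hAC.const_of_ae_hasDerivAt_zero (by
      filter_upwards [hy] with t ht htI
      rw [uIcc_of_le zero_le_one] at htI
      have hmem : y + t • v ∈ Metric.ball x δ := by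
        have := (convex_ball x δ).add_smul_sub_mem h0 h1 htI
        simpa using this
      have hd1 : HasDerivAt (fun t : ℝ => y + t • v) v t := by
        simpa using ((hasDerivAt_id t).smul_const v).const_add y
      have h2 := (ht hmem).comp_hasDerivAt t hd1
      rwa [zero_apply] at h2)
    have e0 := hc 0 (by simp)
    have e1 := hc 1 (by simp)
    simp only [zero_smul, add_zero, one_smul] at e0 e1
    rw [e0, e1]
  have hopen : IsOpen (Metric.ball x δ ∩ (fun y => y + v) ⁻¹' Metric.ball x δ ∩
      {y | u (y + v) ≠ u y}) := by
    refine (Metric.isOpen_ball.inter (Metric.isOpen_ball.preimage (by fun_prop))).inter ?_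
    have := hu.continuous
    exact isOpen_ne_fun (by fun_prop) (by fun_prop)
  have hnull : μ (Metric.ball x δ ∩ (fun y => y + v) ⁻¹' Metric.ball x δ ∩
      {y | u (y + v) ≠ u y}) = 0 := by
    refine measure_mono_null (fun y hy => ?_) (ae_iff.1 hconst)
    exact fun h => hy.2 (h hy.1.1 hy.1.2)
  have hempty := (hopen.measure_eq_zero_iff μ).1 hnull
  by_contra hne
  have hδ : 0 < δ := Metric.pos_of_mem_ball hz
  have hmem : x ∈ Metric.ball x δ ∩ (fun y => y + v) ⁻¹' Metric.ball x δ ∩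
      {y | u (y + v) ≠ u y} := by
    have : x + v = z := by simp [hv]
    exact ⟨⟨Metric.mem_ball_self hδ, show x + v ∈ _ by rwa [this]⟩, by simpa [this] using hne⟩
  rw [hempty] at hmem
  exact hmem

/-- Two comparable measures giving the same finite integral to a positive function agree. -/
theorem measure_eq_of_le_of_lintegral_eq {X : Type*} [MeasurableSpace X] {τ η : Measure X}
    (hle : τ ≤ η) {f : X → ℝ≥0∞} (hf : Measurable f) (hpos : ∀ᵐ x ∂η, f x ≠ 0)
    (htop : ∀ x, f x ≠ ⊤) (hfin : ∫⁻ x, f x ∂η ≠ ⊤) (heq : ∫⁻ x, f x ∂η ≤ ∫⁻ x, f x ∂τ) :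
    τ = η := by
  have hdens : τ.withDensity f = η.withDensity f := by
    ext S hS
    rw [withDensity_apply _ hS, withDensity_apply _ hS]
    refine le_antisymm (lintegral_mono' (Measure.restrict_mono_measure hle S) le_rfl) ?_
    have h1 : ∫⁻ x in Sᶜ, f x ∂τ ≤ ∫⁻ x in Sᶜ, f x ∂η :=
      lintegral_mono' (Measure.restrict_mono_measure hle _) le_rfl
    rw [← lintegral_add_compl f hS, ← lintegral_add_compl f hS (μ := τ)] at heq
    have h2 : ∫⁻ x in Sᶜ, f x ∂η ≠ ⊤ :=
      ((setLIntegral_le_lintegral _ _).trans_lt hfin.lt_top).ne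
    exact (ENNReal.add_le_add_iff_right h2).1 (heq.trans (by gcongr))
  have hposτ : ∀ᵐ x ∂τ, f x ≠ 0 := hle.absolutelyContinuous.ae_le hpos
  rw [← withDensity_inv_same hf hposτ (Eventually.of_forall htop), hdens,
    withDensity_inv_same hf hpos (Eventually.of_forall htop)]

/-! ### Isometric frames of Riemannian metrics -/

open scoped Bundle in
/-- Near `θ₁` the metric is, up to factors arbitrarily close to one, the Euclidean one in the
chart at `θ₁` followed by a fixed linear map. The chart is expressed through the coordinate
changes of the tangent bundle. -/
theorem SmoothMetric.exists_chart_frame_self {n : ℕ} {N : Type*} [TopologicalSpace N]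
    [ChartedSpace (EuclideanSpace ℝ (Fin n)) N] [IsManifold (𝓡 n) ∞ N] (g : SmoothMetric n N)
    (θ₁ : N) :
    ∃ J : EuclideanSpace ℝ (Fin n) ≃L[ℝ] EuclideanSpace ℝ (Fin n), ∀ κ : ℝ, 1 < κ →
      ∀ᶠ θ in 𝓝 θ₁, ∀ v : TangentSpace (𝓡 n) θ,
        ‖J (tangentCoordChange (𝓡 n) θ θ₁ θ v)‖ ≤ κ * Real.sqrt (g.inner θ v v) ∧
        Real.sqrt (g.inner θ v v) ≤ κ * ‖J (tangentCoordChange (𝓡 n) θ θ₁ θ v)‖ := by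
  let E := EuclideanSpace ℝ (Fin n)
  let : Bundle.RiemannianBundle (fun x : N => TangentSpace (𝓡 n) x) := ⟨g.toRiemannianMetric⟩
  have : IsContinuousRiemannianBundle E (fun x : N => TangentSpace (𝓡 n) x) :=
    ⟨⟨g.inner, g.contMDiff.continuous, fun _ _ _ => rfl⟩⟩
  have hnorm : ∀ (θ : N) (v : TangentSpace (𝓡 n) θ), ‖v‖ = Real.sqrt (g.inner θ v v) :=
    fun θ v => norm_eq_sqrt_real_inner v
  have : FiniteDimensional ℝ (TangentSpace (𝓡 n) θ₁) :=
    inferInstanceAs (FiniteDimensional ℝ E)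
  have hrank : Module.finrank ℝ (TangentSpace (𝓡 n) θ₁) = n :=
    (show Module.finrank ℝ E = n by simp [E])
  let iso : TangentSpace (𝓡 n) θ₁ ≃ₗᵢ[ℝ] E :=
    ((stdOrthonormalBasis ℝ (TangentSpace (𝓡 n) θ₁)).reindex (finCongr hrank)).repr
  let e := trivializationAt E (fun x : N => TangentSpace (𝓡 n) x) θ₁
  have hmem : θ₁ ∈ e.baseSet := FiberBundle.mem_baseSet_trivializationAt' θ₁
  let G := e.continuousLinearEquivAt ℝ θ₁ hmem
  refine ⟨G.symm.trans iso.toContinuousLinearEquiv, fun κ hκ => ?_⟩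
  filter_upwards [eventually_norm_symmL_trivializationAt_self_comp_lt E
    (fun x : N => TangentSpace (𝓡 n) x) θ₁ hκ, eventually_norm_symmL_trivializationAt_comp_self_lt E
    (fun x : N => TangentSpace (𝓡 n) x) θ₁ hκ, chart_source_mem_nhds E θ₁] with θ h1 h2 hθ v
  have hθ' : θ ∈ e.baseSet := by simpa [e] using hθ
  have hv : tangentCoordChange (𝓡 n) θ θ₁ θ v = e.continuousLinearMapAt ℝ θ v := by
    rw [TangentBundle.continuousLinearMapAt_trivializationAt_eq_core hθ]
    rfl
  have hJ : ‖(G.symm.trans iso.toContinuousLinearEquiv) (tangentCoordChange (𝓡 n) θ θ₁ θ v)‖ =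
      ‖e.symmL ℝ θ₁ (e.continuousLinearMapAt ℝ θ v)‖ := by
    rw [hv]
    have hG : ∀ w, G.symm w = e.symmL ℝ θ₁ w := fun w => by
      apply G.injective
      rw [G.apply_symm_apply]
      change w = e.continuousLinearEquivAt ℝ θ₁ hmem _
      rw [e.coe_continuousLinearEquivAt_eq hmem, e.continuousLinearMapAt_symmL hmem]
    rw [← hG]
    exact iso.norm_map _
  rw [hJ, ← hnorm]
  refine ⟨(ContinuousLinearMap.le_of_opNorm_le _ h1.le v), ?_⟩
  have h3 := ContinuousLinearMap.le_of_opNorm_le _ h2.le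
    (e.symmL ℝ θ₁ (e.continuousLinearMapAt ℝ θ v))
  have h4 : ((e.symmL ℝ θ) ∘L (e.continuousLinearMapAt ℝ θ₁))
      (e.symmL ℝ θ₁ (e.continuousLinearMapAt ℝ θ v)) = v := by
    rw [ContinuousLinearMap.comp_apply, e.continuousLinearMapAt_symmL hmem,
      e.symmL_continuousLinearMapAt hθ']
  rwa [h4] at h3

/-- The linear map `J` is an isometric frame at `θ₁` for the metric `g`, read in the chart at `θ₀`:
near `θ₁` it is an isometry up to factors arbitrarily close to one. -/
def IsChartFrame {n : ℕ} {N : Type*} [TopologicalSpace N]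
    [ChartedSpace (EuclideanSpace ℝ (Fin n)) N] [IsManifold (𝓡 n) ∞ N] (g : SmoothMetric n N)
    (θ₀ θ₁ : N) (J : EuclideanSpace ℝ (Fin n) ≃L[ℝ] EuclideanSpace ℝ (Fin n)) : Prop :=
  ∀ κ : ℝ, 1 < κ → ∀ᶠ θ in 𝓝 θ₁, ∀ v : TangentSpace (𝓡 n) θ,
    ‖J (mfderiv (𝓡 n) 𝓘(ℝ, EuclideanSpace ℝ (Fin n))
      (chartAt (EuclideanSpace ℝ (Fin n)) θ₀) θ v)‖ ≤ κ * Real.sqrt (g.inner θ v v) ∧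
    Real.sqrt (g.inner θ v v) ≤ κ * ‖J (mfderiv (𝓡 n) 𝓘(ℝ, EuclideanSpace ℝ (Fin n))
      (chartAt (EuclideanSpace ℝ (Fin n)) θ₀) θ v)‖

/-- Every point of a chart domain admits an isometric frame: Gram–Schmidt for the metric at that
point. -/
theorem SmoothMetric.exists_chart_frame {n : ℕ} {N : Type*} [TopologicalSpace N]
    [ChartedSpace (EuclideanSpace ℝ (Fin n)) N] [IsManifold (𝓡 n) ∞ N] (g : SmoothMetric n N)
    (θ₀ θ₁ : N) (h : θ₁ ∈ (chartAt (EuclideanSpace ℝ (Fin n)) θ₀).source) :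
    ∃ J : EuclideanSpace ℝ (Fin n) ≃L[ℝ] EuclideanSpace ℝ (Fin n), IsChartFrame g θ₀ θ₁ J := by
  let E := EuclideanSpace ℝ (Fin n)
  obtain ⟨J₁, hJ₁⟩ := g.exists_chart_frame_self θ₁
  let B : N → E →L[ℝ] E := tangentCoordChange (𝓡 n) θ₀ θ₁
  let B' : E →L[ℝ] E := tangentCoordChange (𝓡 n) θ₁ θ₀ θ₁
  have hs₀ : (extChartAt (𝓡 n) θ₀).source = (chartAt E θ₀).source := extChartAt_source _ _
  have hs₁ : (extChartAt (𝓡 n) θ₁).source = (chartAt E θ₁).source := extChartAt_source _ _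
  have h1 : θ₁ ∈ (chartAt E θ₁).source := mem_chart_source E θ₁
  have hBB' : ∀ v, B θ₁ (B' v) = v := fun v => by
    rw [tangentCoordChange_comp (by rw [hs₀, hs₁]; exact ⟨⟨h1, h⟩, h1⟩),
      tangentCoordChange_self (by rwa [hs₁])]
  have hB'B : ∀ v, B' (B θ₁ v) = v := fun v => by
    rw [tangentCoordChange_comp (by rw [hs₀, hs₁]; exact ⟨⟨h, h1⟩, h⟩),
      tangentCoordChange_self (by rwa [hs₀])]
  let Beq : E ≃L[ℝ] E := ContinuousLinearEquiv.equivOfInverse (B θ₁) B' hB'B hBB'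
  let J : E ≃L[ℝ] E := Beq.trans J₁
  have hBcont : ContinuousAt B θ₁ := by
    refine (continuousOn_tangentCoordChange (I := 𝓡 n) θ₀ θ₁).continuousAt ?_
    rw [hs₀, hs₁]
    exact ((chartAt E θ₀).open_source.inter (chartAt E θ₁).open_source).mem_nhds ⟨h, h1⟩
  -- `A θ` compares the two frames at `θ`; it tends to the identity.
  let A : N → E →L[ℝ] E := fun θ => (J₁ : E →L[ℝ] E) ∘L B θ ∘L (J.symm : E →L[ℝ] E)
  have hAcont : ContinuousAt A θ₁ := by
    have : ContinuousAt (fun θ => B θ ∘L (J.symm : E →L[ℝ] E)) θ₁ :=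
      hBcont.clm_comp continuousAt_const
    exact continuousAt_const.clm_comp this
  have hA1 : A θ₁ = ContinuousLinearMap.id ℝ E := by
    ext1 v
    exact J.apply_symm_apply v
  refine ⟨J, fun κ hκ => ?_⟩
  obtain ⟨κ₁, hκ₁, hκκ⟩ : ∃ κ₁ : ℝ, 1 < κ₁ ∧ κ₁ * κ₁ = κ :=
    ⟨Real.sqrt κ, by rw [Real.lt_sqrt zero_le_one]; simpa using hκ,
      Real.mul_self_sqrt (by linarith)⟩
  have hε : 0 < 1 - κ₁⁻¹ := sub_pos.2 (inv_lt_one_of_one_lt₀ hκ₁)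
  filter_upwards [hJ₁ κ₁ hκ₁, hAcont (Metric.ball_mem_nhds _ hε),
    (chartAt E θ₀).open_source.mem_nhds h, (chartAt E θ₁).open_source.mem_nhds h1]
    with θ hθ hAθ hθ₀ hθ₁ v
  have hD : mfderiv (𝓡 n) 𝓘(ℝ, E) (chartAt E θ₀) θ v = tangentCoordChange (𝓡 n) θ θ₀ θ v := by
    have h2 := TangentBundle.continuousLinearMapAt_trivializationAt (I := 𝓡 n) hθ₀
    rw [TangentBundle.continuousLinearMapAt_trivializationAt_eq_core hθ₀] at h2
    have h3 : (extChartAt (𝓡 n) θ₀ : N → E) = chartAt E θ₀ := by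
      ext1 x
      simp [extChartAt]
    rw [h3] at h2
    exact (congrArg (fun L : E →L[ℝ] E => L v) h2).symm
  have hcomp : B θ (tangentCoordChange (𝓡 n) θ θ₀ θ v) = tangentCoordChange (𝓡 n) θ θ₁ θ v :=
    tangentCoordChange_comp (by
      rw [hs₀, hs₁, extChartAt_source]; exact ⟨⟨mem_chart_source E θ, hθ₀⟩, hθ₁⟩)
  rw [hD]
  set w : E := tangentCoordChange (𝓡 n) θ θ₀ θ v with hw
  obtain ⟨hl, hu⟩ := hθ v
  rw [← hcomp] at hl hu
  have hAw : A θ (J w) = J₁ (B θ w) := by simp [A]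
  have hdist : ‖J₁ (B θ w) - J w‖ ≤ (1 - κ₁⁻¹) * ‖J w‖ := by
    rw [← hAw]
    have : A θ (J w) - J w = (A θ - A θ₁) (J w) := by rw [hA1]; rfl
    rw [this]
    exact ContinuousLinearMap.le_of_opNorm_le _ (mem_ball_iff_norm.1 hAθ).le _
  have hκ0 : 0 < κ₁ := by linarith
  have t1 : ‖J w‖ - ‖J₁ (B θ w)‖ ≤ (1 - κ₁⁻¹) * ‖J w‖ :=
    (norm_sub_norm_le _ _).trans (by rw [norm_sub_rev]; exact hdist)
  have t2 : ‖J₁ (B θ w)‖ - ‖J w‖ ≤ (1 - κ₁⁻¹) * ‖J w‖ := (norm_sub_norm_le _ _).trans hdist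
  have t3 : ‖J w‖ ≤ κ₁ * ‖J₁ (B θ w)‖ := by
    have : κ₁⁻¹ * ‖J w‖ ≤ ‖J₁ (B θ w)‖ := by linarith
    rwa [inv_mul_le_iff₀ hκ0] at this
  have t4 : ‖J₁ (B θ w)‖ ≤ κ₁ * ‖J w‖ := by
    have h5 : 2 - κ₁⁻¹ ≤ κ₁ := by
      have : κ₁ * κ₁⁻¹ = 1 := mul_inv_cancel₀ hκ0.ne'
      nlinarith [sq_nonneg (κ₁ - 1), inv_pos.2 hκ0]
    nlinarith [norm_nonneg (J w)]
  constructor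
  · calc ‖J w‖ ≤ κ₁ * ‖J₁ (B θ w)‖ := t3
      _ ≤ κ₁ * (κ₁ * Real.sqrt (g.inner θ v v)) := by gcongr
      _ = κ * Real.sqrt (g.inner θ v v) := by rw [← hκκ]; ring
  · calc Real.sqrt (g.inner θ v v) ≤ κ₁ * ‖J₁ (B θ w)‖ := hu
      _ ≤ κ₁ * (κ₁ * ‖J w‖) := by gcongr
      _ = κ * ‖J w‖ := by rw [← hκκ]; ring

/-! ### Product charts -/

/-- The Euclidean model `ℝ^{m_1} × ⋯ × ℝ^{m_p}` of the base. -/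
abbrev ModelBase {p : ℕ} (m : Fin p → ℕ) : Type :=
  PiLp 2 fun q => EuclideanSpace ℝ (Fin (m q))

/-- The Euclidean model `ℝ × ℝ^{m_1} × ⋯ × ℝ^{m_p}` of the warped product. -/
abbrev ModelSpace {p : ℕ} (m : Fin p → ℕ) : Type :=
  WithLp 2 (ℝ × ModelBase m)

section

variable {lam : EReal} {p : ℕ} {m : Fin p → ℕ} {N : Fin p → Type*}
  [∀ q, TopologicalSpace (N q)] [∀ q, ChartedSpace (EuclideanSpace ℝ (Fin (m q))) (N q)]

/-- The product of the charts at the components of `θ₀`, each followed by a linear map. -/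
noncomputable def baseChart (θ₀ : ∀ q, N q)
    (J : ∀ q, EuclideanSpace ℝ (Fin (m q)) ≃L[ℝ] EuclideanSpace ℝ (Fin (m q)))
    (θ : ∀ q, N q) : ModelBase m :=
  WithLp.toLp 2 fun q => J q (chartAt (EuclideanSpace ℝ (Fin (m q))) (θ₀ q) (θ q))

/-- The common domain of the charts at the components of `θ₀`. -/
def chartDomain (m : Fin p → ℕ) [∀ q, ChartedSpace (EuclideanSpace ℝ (Fin (m q))) (N q)]
    (θ₀ : ∀ q, N q) : Set (∀ q, N q) :=
  {θ | ∀ q, θ q ∈ (chartAt (EuclideanSpace ℝ (Fin (m q))) (θ₀ q)).source}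

/-- The product chart of the warped product, with the `q`-th factor of the base scaled by `c q`. -/
noncomputable def warpChart (θ₀ : ∀ q, N q)
    (J : ∀ q, EuclideanSpace ℝ (Fin (m q)) ≃L[ℝ] EuclideanSpace ℝ (Fin (m q)))
    (c : Fin p → ℝ) (x : WarpedProduct lam N) : ModelSpace m :=
  WithLp.toLp 2 ((x.1 : ℝ), WithLp.toLp 2 fun q => c q • baseChart θ₀ J x.2 q)

@[simp] theorem warpChart_fst (θ₀ : ∀ q, N q)
    (J : ∀ q, EuclideanSpace ℝ (Fin (m q)) ≃L[ℝ] EuclideanSpace ℝ (Fin (m q)))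
    (c : Fin p → ℝ) (x : WarpedProduct lam N) : (warpChart θ₀ J c x).fst = x.1 := rfl

theorem warpChart_snd (θ₀ : ∀ q, N q)
    (J : ∀ q, EuclideanSpace ℝ (Fin (m q)) ≃L[ℝ] EuclideanSpace ℝ (Fin (m q)))
    (c : Fin p → ℝ) (x : WarpedProduct lam N) (q : Fin p) :
    (warpChart θ₀ J c x).snd q =
      c q • J q (chartAt (EuclideanSpace ℝ (Fin (m q))) (θ₀ q) (x.2 q)) := rfl

theorem isOpen_chartDomain (θ₀ : ∀ q, N q) : IsOpen (chartDomain m θ₀) := by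
  have : chartDomain m θ₀ =
      Set.pi univ fun q => (chartAt (EuclideanSpace ℝ (Fin (m q))) (θ₀ q)).source := by
    ext; simp [chartDomain]
  rw [this]
  exact isOpen_set_pi finite_univ fun q _ => (chartAt _ _).open_source

theorem continuousOn_baseChart (θ₀ : ∀ q, N q)
    (J : ∀ q, EuclideanSpace ℝ (Fin (m q)) ≃L[ℝ] EuclideanSpace ℝ (Fin (m q))) :
    ContinuousOn (baseChart θ₀ J) (chartDomain m θ₀) := by
  refine (PiLp.continuous_toLp 2 _).comp_continuousOn (continuousOn_pi.2 fun q => ?_)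
  refine (J q).continuous.comp_continuousOn ?_
  exact (chartAt _ (θ₀ q)).continuousOn.comp (continuous_apply q).continuousOn fun θ hθ => hθ q

theorem continuousOn_warpChart (θ₀ : ∀ q, N q)
    (J : ∀ q, EuclideanSpace ℝ (Fin (m q)) ≃L[ℝ] EuclideanSpace ℝ (Fin (m q))) (c : Fin p → ℝ) :
    ContinuousOn (warpChart (lam := lam) θ₀ J c) {x | x.2 ∈ chartDomain m θ₀} := by
  refine (WithLp.prod_continuous_toLp 2 _ _).comp_continuousOn (ContinuousOn.prodMk ?_ ?_)
  · exact (continuous_subtype_val.comp continuous_fst).continuousOn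
  · refine (PiLp.continuous_toLp 2 _).comp_continuousOn (continuousOn_pi.2 fun q => ?_)
    refine ContinuousOn.const_smul ?_ (c q)
    have h1 : ContinuousOn (fun x : WarpedProduct lam N => baseChart θ₀ J x.2)
        {x | x.2 ∈ chartDomain m θ₀} :=
      (continuousOn_baseChart θ₀ J).comp continuous_snd.continuousOn fun x hx => hx
    exact (PiLp.proj (𝕜 := ℝ) 2 (fun q => EuclideanSpace ℝ (Fin (m q)))
      q).continuous.comp_continuousOn h1

theorem isOpen_setOf_mem_chartDomain (θ₀ : ∀ q, N q) :
    IsOpen {x : WarpedProduct lam N | x.2 ∈ chartDomain m θ₀} :=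
  (isOpen_chartDomain θ₀).preimage continuous_snd

/-- The product chart controls the topology of its domain. -/
theorem exists_dist_warpChart_lt_imp_mem {θ₀ : ∀ q, N q}
    (J : ∀ q, EuclideanSpace ℝ (Fin (m q)) ≃L[ℝ] EuclideanSpace ℝ (Fin (m q)))
    {c : Fin p → ℝ} (hc : ∀ q, c q ≠ 0) {x₀ : WarpedProduct lam N}
    (hx₀ : x₀.2 ∈ chartDomain m θ₀) {V : Set (WarpedProduct lam N)} (hV : V ∈ 𝓝 x₀) :
    ∃ ε > 0, ∀ z : WarpedProduct lam N, z.2 ∈ chartDomain m θ₀ →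
      dist (warpChart θ₀ J c z) (warpChart θ₀ J c x₀) < ε → z ∈ V := by
  set l : Filter (WarpedProduct lam N) :=
    comap (warpChart θ₀ J c) (𝓝 (warpChart θ₀ J c x₀)) ⊓ 𝓟 {z | z.2 ∈ chartDomain m θ₀} with hl
  have hΨ : Tendsto (warpChart θ₀ J c) l (𝓝 (warpChart θ₀ J c x₀)) :=
    tendsto_comap.mono_left inf_le_left
  have hlim : Tendsto (fun z => z) l (𝓝 x₀) := by
    refine (Prod.tendsto_iff _ _).2 ⟨?_, ?_⟩
    · rw [tendsto_subtype_rng]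
      have h1 : Continuous fun w : ModelSpace m => w.fst := WithLp.continuous_fst 2 _ _
      exact (h1.tendsto _).comp hΨ
    · rw [tendsto_pi_nhds]
      intro q
      let k : ModelSpace m → N q := fun w =>
        (chartAt (EuclideanSpace ℝ (Fin (m q))) (θ₀ q)).symm ((J q).symm ((c q)⁻¹ • w.snd q))
      have hk : ∀ z ∈ {z : WarpedProduct lam N | z.2 ∈ chartDomain m θ₀},
          k (warpChart θ₀ J c z) = z.2 q := fun z hz => by
        simp only [k, warpChart_snd]
        rw [inv_smul_smul₀ (hc q), ContinuousLinearEquiv.symm_apply_apply]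
        exact (chartAt _ (θ₀ q)).left_inv (hz q)
      have hkc : ContinuousAt k (warpChart θ₀ J c x₀) := by
        have h2 : Continuous fun w : ModelSpace m => (J q).symm ((c q)⁻¹ • w.snd q) :=
          (J q).symm.continuous.comp
            (((PiLp.proj (𝕜 := ℝ) 2 (fun q => EuclideanSpace ℝ (Fin (m q))) q).continuous.comp
              (WithLp.continuous_snd 2 ℝ (ModelBase m))).const_smul (c q)⁻¹)
        refine ContinuousAt.comp (f := fun w : ModelSpace m => (J q).symm ((c q)⁻¹ • w.snd q)) ?_
          h2.continuousAt
        have h3 : (J q).symm ((c q)⁻¹ • (warpChart θ₀ J c x₀).snd q) =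
            chartAt (EuclideanSpace ℝ (Fin (m q))) (θ₀ q) (x₀.2 q) := by
          rw [warpChart_snd, inv_smul_smul₀ (hc q), ContinuousLinearEquiv.symm_apply_apply]
        rw [h3]
        exact (chartAt _ (θ₀ q)).continuousAt_symm ((chartAt _ (θ₀ q)).map_source (hx₀ q))
      have h4 : Tendsto (fun z => k (warpChart θ₀ J c z)) l (𝓝 (k (warpChart θ₀ J c x₀))) :=
        hkc.tendsto.comp hΨ
      rw [hk x₀ hx₀] at h4
      refine h4.congr' ?_
      filter_upwards [mem_inf_of_right (mem_principal_self _)] with z hz using hk z hz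
  have hVl : V ∈ l := hlim hV
  rw [hl, mem_inf_principal, mem_comap] at hVl
  obtain ⟨t, ht, hts⟩ := hVl
  obtain ⟨ε, hε, hεt⟩ := Metric.mem_nhds_iff.1 ht
  exact ⟨ε, hε, fun z hz hd => hts (hεt hd) hz⟩

end

/-! ### Curves and lower bounds for the Riemannian distance -/

section

variable {lam : EReal} {p : ℕ} {m : Fin p → ℕ} {N : Fin p → Type*}
  [∀ q, TopologicalSpace (N q)] [∀ q, ChartedSpace (EuclideanSpace ℝ (Fin (m q))) (N q)]

namespace C1Curve

/-- The points of a curve, as a function on the whole line. -/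
noncomputable def point (c : C1Curve lam m N) (t : ℝ) : WarpedProduct lam N :=
  (⟨c.rad (projIcc 0 1 zero_le_one t), c.rad_mem _ (projIcc 0 1 zero_le_one t).2⟩,
    fun q => c.base q (projIcc 0 1 zero_le_one t))

theorem point_fst (c : C1Curve lam m N) {t : ℝ} (ht : t ∈ Icc (0 : ℝ) 1) :
    ((c.point t).1 : ℝ) = c.rad t := by
  simp [point, projIcc_of_mem zero_le_one ht]

theorem point_snd (c : C1Curve lam m N) {t : ℝ} (ht : t ∈ Icc (0 : ℝ) 1) (q : Fin p) :
    (c.point t).2 q = c.base q t := by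
  simp [point, projIcc_of_mem zero_le_one ht]

theorem continuous_point (c : C1Curve lam m N) : Continuous c.point := by
  have h1 : ∀ t, ((projIcc (0 : ℝ) 1 zero_le_one t : Icc (0 : ℝ) 1) : ℝ) ∈ Icc (0 : ℝ) 1 :=
    fun t => (projIcc 0 1 zero_le_one t).2
  have h2 : Continuous fun t => ((projIcc (0 : ℝ) 1 zero_le_one t : Icc (0 : ℝ) 1) : ℝ) :=
    continuous_subtype_val.comp continuous_projIcc
  refine Continuous.prodMk (Continuous.subtype_mk ?_ _) (continuous_pi fun q => ?_)
  · exact c.contDiffOn_rad.continuousOn.comp_continuous h2 h1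
  · exact (c.contMDiffOn_base q).continuousOn.comp_continuous h2 h1

theorem point_zero (c : C1Curve lam m N) : c.point 0 = c.source := by
  simp [point, source]

theorem point_one (c : C1Curve lam m N) : c.point 1 = c.target := by
  simp [point, target]

variable [∀ q, IsManifold (𝓡 (m q)) ∞ (N q)]

theorem hasDerivWithinAt_chart (c : C1Curve lam m N) (q : Fin p) (θ₀ : N q) {t : ℝ}
    (ht : t ∈ Icc (0 : ℝ) 1)
    (hc : c.base q t ∈ (chartAt (EuclideanSpace ℝ (Fin (m q))) θ₀).source) :
    HasDerivWithinAt (fun u => chartAt (EuclideanSpace ℝ (Fin (m q))) θ₀ (c.base q u))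
      (mfderiv (𝓡 (m q)) 𝓘(ℝ, EuclideanSpace ℝ (Fin (m q)))
        (chartAt (EuclideanSpace ℝ (Fin (m q))) θ₀) (c.base q t) (c.velocity q t))
      (Icc 0 1) t := by
  have h1 : HasMFDerivWithinAt 𝓘(ℝ, ℝ) (𝓡 (m q)) (c.base q) (Icc 0 1) t
      (mfderivWithin 𝓘(ℝ, ℝ) (𝓡 (m q)) (c.base q) (Icc 0 1) t) :=
    ((c.contMDiffOn_base q).mdifferentiableOn one_ne_zero t ht).hasMFDerivWithinAt
  have h2 : HasMFDerivAt (𝓡 (m q)) 𝓘(ℝ, EuclideanSpace ℝ (Fin (m q)))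
      (chartAt (EuclideanSpace ℝ (Fin (m q))) θ₀) (c.base q t)
      (mfderiv (𝓡 (m q)) 𝓘(ℝ, EuclideanSpace ℝ (Fin (m q)))
        (chartAt (EuclideanSpace ℝ (Fin (m q))) θ₀) (c.base q t)) := by
    have : MDifferentiableAt (𝓡 (m q)) (𝓡 (m q))
      (chartAt (EuclideanSpace ℝ (Fin (m q))) θ₀) (c.base q t) :=
      mdifferentiableAt_atlas (chart_mem_atlas _ θ₀) hc
    exact this.hasMFDerivAt
  have h3 := (h2.comp_hasMFDerivWithinAt t h1).hasFDerivWithinAt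
  let D : ℝ →L[ℝ] EuclideanSpace ℝ (Fin (m q)) :=
    (mfderiv (𝓡 (m q)) 𝓘(ℝ, EuclideanSpace ℝ (Fin (m q)))
      (chartAt (EuclideanSpace ℝ (Fin (m q))) θ₀) (c.base q t)).comp
      (mfderivWithin 𝓘(ℝ, ℝ) (𝓡 (m q)) (c.base q) (Icc 0 1) t)
  have h4 : HasFDerivWithinAt (fun u => chartAt (EuclideanSpace ℝ (Fin (m q))) θ₀ (c.base q u))
      D (Icc 0 1) t := h3
  exact h4.hasDerivWithinAt

theorem contDiffOn_chart (c : C1Curve lam m N) (q : Fin p) (θ₀ : N q) {t t' : ℝ} (ht : 0 ≤ t)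
    (ht' : t' ≤ 1)
    (hc : ∀ u ∈ Icc t t', c.base q u ∈ (chartAt (EuclideanSpace ℝ (Fin (m q))) θ₀).source) :
    ContDiffOn ℝ 1 (fun u => chartAt (EuclideanSpace ℝ (Fin (m q))) θ₀ (c.base q u))
      (Icc t t') := by
  rw [← contMDiffOn_iff_contDiffOn]
  have h1 : ContMDiffOn (𝓡 (m q)) (𝓡 (m q)) 1 (chartAt (EuclideanSpace ℝ (Fin (m q))) θ₀)
      (chartAt (EuclideanSpace ℝ (Fin (m q))) θ₀).source :=
    (contMDiffOn_chart (I := 𝓡 (m q)) (n := ∞) (x := θ₀)).of_le (by simp)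
  exact h1.comp ((c.contMDiffOn_base q).mono (Icc_subset_Icc ht ht')) hc

end C1Curve

variable [∀ q, IsManifold (𝓡 (m q)) ∞ (N q)]

/-- The speed of a curve for the metric `dr² + ∑ q, s_q(r)² g_q`. -/
noncomputable def C1Curve.speed (g : ∀ q, SmoothMetric (m q) (N q)) (s : Fin p → ℝ → ℝ)
    (c : C1Curve lam m N) (t : ℝ) : ℝ :=
  Real.sqrt (derivWithin c.rad (Icc 0 1) t ^ 2 + ∑ q, s q (c.rad t) ^ 2 *
    (g q).inner (c.base q t) (c.velocity q t) (c.velocity q t))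

theorem SmoothMetric.inner_self_nonneg {n : ℕ} {N : Type*} [TopologicalSpace N]
    [ChartedSpace (EuclideanSpace ℝ (Fin n)) N] [IsManifold (𝓡 n) ∞ N] (g : SmoothMetric n N)
    (θ : N) (v : TangentSpace (𝓡 n) θ) : 0 ≤ g.inner θ v v := by
  by_cases h : v = 0
  · rw [h, map_zero]
  · exact (g.pos _ _ h).le

variable {g : ∀ q, SmoothMetric (m q) (N q)} {s : Fin p → ℝ → ℝ}

theorem ModelSpace.norm_sq (w : ModelSpace m) :
    ‖w‖ ^ 2 = w.fst ^ 2 + ∑ q, ‖w.snd q‖ ^ 2 := by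
  rw [WithLp.prod_norm_sq_eq_of_L2, PiLp.norm_sq_eq_of_L2, Real.norm_eq_abs, sq_abs]

/-- As long as the chart, with factors `k q`, shortens tangent vectors, it does not increase the
lengths of curves. -/
theorem C1Curve.edist_warpChart_le (c : C1Curve lam m N) {θ₀ : ∀ q, N q}
    {J : ∀ q, EuclideanSpace ℝ (Fin (m q)) ≃L[ℝ] EuclideanSpace ℝ (Fin (m q))}
    {k : Fin p → ℝ} (hk : ∀ q, 0 ≤ k q) {t t' : ℝ} (ht : 0 ≤ t) (htt' : t ≤ t') (ht' : t' ≤ 1)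
    (hgood : ∀ u ∈ Icc t t', ∀ q,
      c.base q u ∈ (chartAt (EuclideanSpace ℝ (Fin (m q))) (θ₀ q)).source ∧
      ∀ v : TangentSpace (𝓡 (m q)) (c.base q u),
        k q * ‖J q (mfderiv (𝓡 (m q)) 𝓘(ℝ, EuclideanSpace ℝ (Fin (m q)))
          (chartAt (EuclideanSpace ℝ (Fin (m q))) (θ₀ q)) (c.base q u) v)‖ ≤
        s q (c.rad u) * Real.sqrt ((g q).inner (c.base q u) v v)) :
    edist (warpChart θ₀ J k (c.point t)) (warpChart θ₀ J k (c.point t')) ≤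
      ∫⁻ u in Icc t t', ENNReal.ofReal (c.speed g s u) := by
  rcases htt'.eq_or_lt with rfl | hlt
  · simp
  have hsub : Icc t t' ⊆ Icc 0 1 := Icc_subset_Icc ht ht'
  let γ : ℝ → ModelSpace m := fun u => WithLp.toLp 2 (c.rad u, WithLp.toLp 2 fun q =>
    k q • J q (chartAt (EuclideanSpace ℝ (Fin (m q))) (θ₀ q) (c.base q u)))
  let L : (ℝ × ∀ q, EuclideanSpace ℝ (Fin (m q))) →L[ℝ] ModelSpace m :=
    ((WithLp.prodContinuousLinearEquiv 2 ℝ ℝ (ModelBase m)).symm :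
      (ℝ × ModelBase m) →L[ℝ] ModelSpace m) ∘L
      ((ContinuousLinearMap.id ℝ ℝ).prodMap
        ((PiLp.continuousLinearEquiv 2 ℝ fun q => EuclideanSpace ℝ (Fin (m q))).symm :
          (∀ q, EuclideanSpace ℝ (Fin (m q))) →L[ℝ] ModelBase m))
  have hγL : γ = fun u => L (c.rad u, fun q =>
    k q • J q (chartAt (EuclideanSpace ℝ (Fin (m q))) (θ₀ q) (c.base q u))) := rfl
  have hγpt : ∀ u ∈ Icc t t', warpChart θ₀ J k (c.point u) = γ u := fun u hu => by
    simp only [warpChart, baseChart, γ, c.point_fst (hsub hu), c.point_snd (hsub hu)]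
  have hcd : ContDiffOn ℝ 1 γ (Icc t t') := by
    rw [hγL]
    refine L.contDiff.comp_contDiffOn ((c.contDiffOn_rad.mono hsub).prodMk
      (contDiffOn_pi.2 fun q => ?_))
    exact ((J q).contDiff.comp_contDiffOn
      (c.contDiffOn_chart q (θ₀ q) ht ht' fun u hu => (hgood u hu q).1)).const_smul (k q)
  rw [hγpt t (left_mem_Icc.2 htt'), hγpt t' (right_mem_Icc.2 htt'), edist_comm,
    edist_eq_enorm_sub]
  refine (enorm_sub_le_lintegral_derivWithin_Icc_of_contDiffOn_Icc hcd htt').trans ?_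
  refine setLIntegral_mono' measurableSet_Icc fun u hu => ?_
  have hd : HasDerivWithinAt γ (L (derivWithin c.rad (Icc 0 1) u, fun q => k q • J q
      (mfderiv (𝓡 (m q)) 𝓘(ℝ, EuclideanSpace ℝ (Fin (m q)))
        (chartAt (EuclideanSpace ℝ (Fin (m q))) (θ₀ q)) (c.base q u) (c.velocity q u))))
      (Icc 0 1) u := by
    rw [hγL]
    refine L.hasFDerivAt.comp_hasDerivWithinAt u (HasDerivWithinAt.prodMk ?_
      (hasDerivWithinAt_pi.2 fun q => ?_))
    · exact ((c.contDiffOn_rad.differentiableOn one_ne_zero) u (hsub hu)).hasDerivWithinAt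
    · exact ((J q).hasFDerivAt.comp_hasDerivWithinAt u
        (c.hasDerivWithinAt_chart q (θ₀ q) (hsub hu) (hgood u hu q).1)).const_smul (k q)
  rw [(hd.mono hsub).derivWithin (uniqueDiffOn_Icc hlt u hu), ← ofReal_norm]
  refine ENNReal.ofReal_le_ofReal (Real.le_sqrt_of_sq_le ?_)
  rw [ModelSpace.norm_sq]
  refine add_le_add le_rfl (Finset.sum_le_sum fun q _ => ?_)
  have h1 := (hgood u hu q).2 (c.velocity q u)
  change ‖k q • J q _‖ ^ 2 ≤ _
  rw [norm_smul, Real.norm_of_nonneg (hk q)]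
  refine (pow_le_pow_left₀ (mul_nonneg (hk q) (norm_nonneg _)) h1 2).trans_eq ?_
  rw [mul_pow, Real.sq_sqrt ((g q).inner_self_nonneg _ _)]

/-- Near a point of the interior, the chart with factors smaller than those of the metric
does not increase distances; moreover short distances are realized close to the point. -/
theorem exists_nhds_edist_warpChart_le_warpedDist [∀ q, T2Space (N q)] [∀ q, CompactSpace (N q)]
    {θ₀ : ∀ q, N q} {x₀ : WarpedProduct lam N} (hx₀ : x₀.2 ∈ chartDomain m θ₀)
    {J : ∀ q, EuclideanSpace ℝ (Fin (m q)) ≃L[ℝ] EuclideanSpace ℝ (Fin (m q))}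
    (hJ : ∀ q, IsChartFrame (g q) (θ₀ q) (x₀.2 q) (J q))
    (hs : ∀ q, ContinuousOn (s q) (radii lam))
    {k : Fin p → ℝ} (hk : ∀ q, 0 < k q ∧ (m q = 0 ∨ k q < s q x₀.1))
    {V : Set (WarpedProduct lam N)} (hV : V ∈ 𝓝 x₀) :
    ∃ δ : ℝ≥0∞, 0 < δ ∧ ∃ U ∈ 𝓝 x₀, ∀ x ∈ U, x.2 ∈ chartDomain m θ₀ ∧
      ∀ y : WarpedProduct lam N, warpedDist g s x y < δ → y ∈ V ∧ y.2 ∈ chartDomain m θ₀ ∧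
        edist (warpChart θ₀ J k x) (warpChart θ₀ J k y) ≤ warpedDist g s x y := by
  -- the set where the chart shortens tangent vectors
  have hgood : ∀ᶠ z in 𝓝 x₀, ∀ q, z.2 q ∈
      (chartAt (EuclideanSpace ℝ (Fin (m q))) (θ₀ q)).source ∧
      ∀ v : TangentSpace (𝓡 (m q)) (z.2 q),
        k q * ‖J q (mfderiv (𝓡 (m q)) 𝓘(ℝ, EuclideanSpace ℝ (Fin (m q)))
          (chartAt (EuclideanSpace ℝ (Fin (m q))) (θ₀ q)) (z.2 q) v)‖ ≤
        s q z.1 * Real.sqrt ((g q).inner (z.2 q) v v) := by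
    refine eventually_all.2 fun q => ?_
    have hz : Tendsto (fun z : WarpedProduct lam N => z.2 q) (𝓝 x₀) (𝓝 (x₀.2 q)) :=
      ((continuous_apply q).comp continuous_snd).tendsto x₀
    have h1 := hz ((chartAt (EuclideanSpace ℝ (Fin (m q))) (θ₀ q)).open_source.mem_nhds (hx₀ q))
    obtain ⟨hk0, hmq | hks⟩ := hk q
    · filter_upwards [h1] with z hz1
      refine ⟨hz1, fun v => ?_⟩
      have hsub : Subsingleton (EuclideanSpace ℝ (Fin (m q))) := by rw [hmq]; infer_instance
      have hv : v = 0 := @Subsingleton.elim (EuclideanSpace ℝ (Fin (m q))) hsub v 0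
      subst hv
      have h0 : k q * ‖J q (0 : EuclideanSpace ℝ (Fin (m q)))‖ ≤ 0 := by simp
      simp only [map_zero, Real.sqrt_zero, mul_zero]
      exact h0
    · obtain ⟨κ, hκ, hκs⟩ : ∃ κ : ℝ, 1 < κ ∧ κ * k q < s q x₀.1 := by
        have : (1 : ℝ) < s q x₀.1 / k q := by rwa [one_lt_div hk0]
        obtain ⟨κ, h2, h3⟩ := exists_between this
        exact ⟨κ, h2, by rwa [lt_div_iff₀ hk0] at h3⟩
      have h2 : Tendsto (fun z : WarpedProduct lam N => s q z.1) (𝓝 x₀) (𝓝 (s q x₀.1)) :=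
        ((continuousOn_iff_continuous_domRestrict.1 (hs q)).comp continuous_fst).tendsto x₀
      filter_upwards [h1, hz.eventually (hJ q κ hκ), h2.eventually (lt_mem_nhds hκs)]
        with z hz1 hz2 hz3
      refine ⟨hz1, fun v => ?_⟩
      calc _ ≤ k q * (κ * Real.sqrt ((g q).inner (z.2 q) v v)) := by
            gcongr
            exact (hz2 v).1
        _ = (κ * k q) * Real.sqrt ((g q).inner (z.2 q) v v) := by ring
        _ ≤ _ := by gcongr
  obtain ⟨G, hGsub, hGo, hxG⟩ := eventually_nhds_iff.1 hgood
  obtain ⟨K, ⟨hKn, hKc⟩, hKsub⟩ :=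
    (closed_nhds_basis x₀).mem_iff.1 (inter_mem hV (hGo.mem_nhds hxG))
  obtain ⟨ε, hε, hεK⟩ := exists_dist_warpChart_lt_imp_mem J (fun q => (hk q).1.ne') hx₀ hKn
  let δ : ℝ := ε / 3
  have hδ : 0 < δ := by positivity
  set Ψ : WarpedProduct lam N → ModelSpace m := warpChart θ₀ J k with hΨ
  have hU : {x : WarpedProduct lam N | x.2 ∈ chartDomain m θ₀ ∧ dist (Ψ x) (Ψ x₀) < δ} ∈ 𝓝 x₀ := by
    have h1 := (isOpen_setOf_mem_chartDomain (lam := lam) (m := m) θ₀).mem_nhds hx₀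
    have h2 := (continuousOn_warpChart (lam := lam) θ₀ J k).continuousAt h1
    exact inter_mem h1 (h2 (Metric.ball_mem_nhds _ hδ))
  refine ⟨ENNReal.ofReal (2 * δ), by positivity, _, hU, ?_⟩
  rintro x ⟨hxD, hxδ⟩
  refine ⟨hxD, ?_⟩
  classical
  -- a truncation of the Euclidean distance to `x`
  let F : WarpedProduct lam N → ℝ := fun z =>
    if z ∈ G then min (dist (Ψ x) (Ψ z)) (2 * δ) else 2 * δ
  have hFG : ∀ z ∈ G, F z = min (dist (Ψ x) (Ψ z)) (2 * δ) := fun z hz => if_pos hz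
  have hFK : ∀ z ∉ K, F z = 2 * δ := by
    intro z hz
    by_cases hzG : z ∈ G
    · rw [hFG z hzG]
      refine min_eq_right ?_
      have h1 : ε ≤ dist (Ψ z) (Ψ x₀) := by
        by_contra! h
        exact hz (hεK z (fun q => (hGsub z hzG q).1) h)
      have h2 := dist_triangle_left (Ψ z) (Ψ x₀) (Ψ x)
      have h3 : ε = 3 * δ := by simp only [δ]; ring
      linarith
    · exact if_neg hzG
  have hGD : ∀ z ∈ G, z.2 ∈ chartDomain m θ₀ := fun z hz q => (hGsub z hz q).1
  have hFc : Continuous F := by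
    rw [continuous_iff_continuousAt]
    intro z
    by_cases hz : z ∈ G
    · have h1 : ContinuousAt (fun z => min (dist (Ψ x) (Ψ z)) (2 * δ)) z := by
        have h2 : ContinuousAt Ψ z := (continuousOn_warpChart θ₀ J k).continuousAt
          ((isOpen_setOf_mem_chartDomain θ₀).mem_nhds (hGD z hz))
        exact (continuousAt_const.dist h2).min continuousAt_const
      refine h1.congr ?_
      filter_upwards [hGo.mem_nhds hz] with w hw using (hFG w hw).symm
    · have hzK : z ∉ K := fun h => hz (hKsub h).2
      refine (continuousAt_const (y := 2 * δ)).congr ?_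
      filter_upwards [hKc.isOpen_compl.mem_nhds hzK] with w hw using (hFK w hw).symm
  -- the truncation is 1-Lipschitz along curves
  have hcurve : ∀ c : C1Curve lam m N, edist (F c.source) (F c.target) ≤ c.length g s := by
    intro c
    have h1 := edist_le_lintegral_of_locally (f := fun t => F (c.point t))
      (v := fun t => ENNReal.ofReal (c.speed g s t)) (hFc.comp c.continuous_point).continuousOn ?_
    · simp only [c.point_zero, c.point_one] at h1
      exact h1
    intro t ht
    by_cases hz : c.point t ∈ G
    · have h2 : ∀ᶠ u in 𝓝 t, c.point u ∈ G :=
        c.continuous_point.continuousAt (hGo.mem_nhds hz)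
      obtain ⟨η, hη, hball⟩ := Metric.eventually_nhds_iff.1 h2
      refine ⟨t + η / 2, by linarith, fun u hu hu1 => ?_⟩
      have hin : ∀ w ∈ Icc t u, c.point w ∈ G := fun w hw => hball (by
        rw [Real.dist_eq, abs_of_nonneg (sub_nonneg.2 hw.1)]
        linarith [hw.2, hu.2])
      have h01 : ∀ w ∈ Icc t u, w ∈ Icc (0 : ℝ) 1 := fun w hw =>
        ⟨ht.1.trans hw.1, hw.2.trans hu1⟩
      have h3 := c.edist_warpChart_le (g := g) (s := s) (J := J) (θ₀ := θ₀)
        (fun q => (hk q).1.le) ht.1 hu.1 hu1 fun w hw q => by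
          have h4 := hGsub _ (hin w hw) q
          rwa [c.point_snd (h01 w hw), c.point_fst (h01 w hw)] at h4
      refine le_trans ?_ h3
      simp only [hFG _ hz, hFG _ (hin u (right_mem_Icc.2 hu.1))]
      rw [edist_dist, edist_dist]
      refine ENNReal.ofReal_le_ofReal ?_
      rw [Real.dist_eq]
      refine (abs_min_sub_min_le_max _ _ _ _).trans (max_le ?_ (by simp))
      rw [abs_sub_le_iff]
      constructor
      · have := dist_triangle_right (Ψ x) (Ψ (c.point t)) (Ψ (c.point u)); linarith
      · have := dist_triangle (Ψ x) (Ψ (c.point t)) (Ψ (c.point u)); linarith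
    · have hzK : c.point t ∉ K := fun h => hz (hKsub h).2
      have h2 : ∀ᶠ u in 𝓝 t, c.point u ∉ K :=
        c.continuous_point.continuousAt (hKc.isOpen_compl.mem_nhds hzK)
      obtain ⟨η, hη, hball⟩ := Metric.eventually_nhds_iff.1 h2
      refine ⟨t + η / 2, by linarith, fun u hu hu1 => ?_⟩
      have hu' : c.point u ∉ K := hball (by
        rw [Real.dist_eq, abs_of_nonneg (sub_nonneg.2 hu.1)]
        linarith [hu.2])
      simp [hFK _ hzK, hFK _ hu']
  have hLip : ∀ y, edist (F x) (F y) ≤ warpedDist g s x y := by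
    intro y
    refine le_iInf₂ fun ℓ h => ?_
    induction h with
    | refl => simp
    | forward c _ ih => exact (edist_triangle _ _ _).trans (add_le_add ih (hcurve c))
    | backward c _ ih =>
      exact (edist_triangle _ _ _).trans (add_le_add ih (by rw [edist_comm]; exact hcurve c))
  intro y hy
  replace hLip := hLip y
  have hxG : x ∈ G := (hKsub (hεK x hxD (hxδ.trans (by simp only [δ]; linarith)))).2
  have hFx : F x = 0 := by rw [hFG x hxG, dist_self]; exact min_eq_left (by positivity)
  have hFy0 : 0 ≤ F y := by
    simp only [F]
    split_ifs <;> positivity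
  rw [hFx, edist_dist, Real.dist_eq, zero_sub, abs_neg, abs_of_nonneg hFy0] at hLip
  have hFy : F y < 2 * δ := by
    have := hLip.trans_lt hy
    exact (ENNReal.ofReal_lt_ofReal_iff (by positivity)).1 this
  have hyK : y ∈ K := by
    by_contra h
    exact absurd (hFK y h) hFy.ne
  have hyG := (hKsub hyK).2
  refine ⟨(hKsub hyK).1, hGD y hyG, ?_⟩
  rw [hFG y hyG] at hFy hLip
  rw [edist_dist]
  rwa [min_eq_left_of_lt (by
    rcases min_lt_iff.1 hFy with h | h
    · exact h
    · exact absurd h (lt_irrefl _))] at hLip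

end

/-! ### Upper bounds for the Riemannian distance -/

section

variable {lam : EReal} {p : ℕ} {m : Fin p → ℕ} {N : Fin p → Type*}
  [∀ q, TopologicalSpace (N q)] [∀ q, ChartedSpace (EuclideanSpace ℝ (Fin (m q))) (N q)]

theorem ordConnected_radii (lam : EReal) : (radii lam).OrdConnected :=
  ⟨fun _ hx _ hy _ hz => ⟨hx.1.trans hz.1, (EReal.coe_le_coe_iff.2 hz.2).trans_lt hy.2⟩⟩

theorem convex_radii (lam : EReal) : Convex ℝ (radii lam) := (ordConnected_radii lam).convex

theorem edist_warpChart (θ₀ : ∀ q, N q)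
    (J : ∀ q, EuclideanSpace ℝ (Fin (m q)) ≃L[ℝ] EuclideanSpace ℝ (Fin (m q)))
    (k : Fin p → ℝ) (x y : WarpedProduct lam N) :
    edist (warpChart θ₀ J k x) (warpChart θ₀ J k y) =
      ENNReal.ofReal (Real.sqrt (((y.1 : ℝ) - x.1) ^ 2 + ∑ q, ‖k q • J q
        (chartAt (EuclideanSpace ℝ (Fin (m q))) (θ₀ q) (y.2 q) -
          chartAt (EuclideanSpace ℝ (Fin (m q))) (θ₀ q) (x.2 q))‖ ^ 2)) := by
  rw [edist_comm, edist_eq_enorm_sub, ← ofReal_norm, ← Real.sqrt_sq (norm_nonneg _),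
    ModelSpace.norm_sq]
  congr 3
  refine Finset.sum_congr rfl fun q _ => ?_
  rw [map_sub, smul_sub]
  rfl

variable [∀ q, IsManifold (𝓡 (m q)) ∞ (N q)]
  {g : ∀ q, SmoothMetric (m q) (N q)} {s : Fin p → ℝ → ℝ}

/-- Near any point, the chart with factors larger than those of the metric does not decrease
distances: straight segments of the chart are short enough. -/
theorem exists_nhds_warpedDist_le_edist_warpChart
    {θ₀ : ∀ q, N q} {x₀ : WarpedProduct lam N} (hx₀ : x₀.2 ∈ chartDomain m θ₀)
    {J : ∀ q, EuclideanSpace ℝ (Fin (m q)) ≃L[ℝ] EuclideanSpace ℝ (Fin (m q))}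
    (hJ : ∀ q, IsChartFrame (g q) (θ₀ q) (x₀.2 q) (J q))
    (hs : ∀ q, ContinuousOn (s q) (radii lam)) (hs0 : ∀ q, ∀ r ∈ radii lam, 0 ≤ s q r)
    {k : Fin p → ℝ} (hk : ∀ q, 0 < k q ∧ (m q = 0 ∨ s q x₀.1 < k q)) :
    ∃ U ∈ 𝓝 x₀, ∀ x ∈ U, x.2 ∈ chartDomain m θ₀ ∧
      ∀ y ∈ U, warpedDist g s x y ≤ edist (warpChart θ₀ J k x) (warpChart θ₀ J k y) := by
  -- the set where the chart lengthens tangent vectors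
  have hgood : ∀ᶠ z in 𝓝 x₀, ∀ q, ∀ v : TangentSpace (𝓡 (m q)) (z.2 q),
      s q z.1 * Real.sqrt ((g q).inner (z.2 q) v v) ≤
        k q * ‖J q (mfderiv (𝓡 (m q)) 𝓘(ℝ, EuclideanSpace ℝ (Fin (m q)))
          (chartAt (EuclideanSpace ℝ (Fin (m q))) (θ₀ q)) (z.2 q) v)‖ := by
    refine eventually_all.2 fun q => ?_
    have hz : Tendsto (fun z : WarpedProduct lam N => z.2 q) (𝓝 x₀) (𝓝 (x₀.2 q)) :=
      ((continuous_apply q).comp continuous_snd).tendsto x₀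
    obtain ⟨hk0, hmq | hks⟩ := hk q
    · refine Eventually.of_forall fun z v => ?_
      have hsub : Subsingleton (EuclideanSpace ℝ (Fin (m q))) := by rw [hmq]; infer_instance
      have hv : v = 0 := @Subsingleton.elim (EuclideanSpace ℝ (Fin (m q))) hsub v 0
      subst hv
      have h0 : 0 ≤ k q * ‖J q (0 : EuclideanSpace ℝ (Fin (m q)))‖ := by simp
      simp only [map_zero, Real.sqrt_zero, mul_zero]
      exact h0
    · have hs₀ := hs0 q x₀.1 x₀.1.2
      obtain ⟨κ, hκ, hκs⟩ : ∃ κ : ℝ, 1 < κ ∧ κ * s q x₀.1 < k q := by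
        rcases hs₀.eq_or_lt with h | h
        · exact ⟨2, one_lt_two, by rw [← h]; simpa using hk0⟩
        · have : (1 : ℝ) < k q / s q x₀.1 := by rwa [one_lt_div h]
          obtain ⟨κ, h2, h3⟩ := exists_between this
          exact ⟨κ, h2, by rwa [lt_div_iff₀ h] at h3⟩
      have h2 : Tendsto (fun z : WarpedProduct lam N => κ * s q z.1) (𝓝 x₀)
          (𝓝 (κ * s q x₀.1)) :=
        (((continuousOn_iff_continuous_domRestrict.1 (hs q)).comp continuous_fst).tendsto
          x₀).const_mul κ
      filter_upwards [hz.eventually (hJ q κ hκ), h2.eventually (gt_mem_nhds hκs)]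
        with z hz2 hz3
      intro v
      have hsz := hs0 q z.1 z.1.2
      refine (mul_le_mul_of_nonneg_left (hz2 v).2 hsz).trans ?_
      rw [← mul_assoc, mul_comm (s q z.1)]
      gcongr
  obtain ⟨G, hGsub, hGo, hxG⟩ := eventually_nhds_iff.1 hgood
  let φ : ∀ q, OpenPartialHomeomorph (N q) (EuclideanSpace ℝ (Fin (m q))) :=
    fun q => chartAt (EuclideanSpace ℝ (Fin (m q))) (θ₀ q)
  let w₀ : ∀ q, EuclideanSpace ℝ (Fin (m q)) := fun q => φ q (x₀.2 q)
  obtain ⟨δ, hδ, hball⟩ : ∃ δ > 0, ∀ (r : ℝ) (w : ∀ q, EuclideanSpace ℝ (Fin (m q))),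
      (r, w) ∈ Metric.ball ((x₀.1 : ℝ), w₀) δ → (∀ q, w q ∈ (φ q).target) ∧
        ∀ hr : r ∈ radii lam, ((⟨r, hr⟩, fun q => (φ q).symm (w q)) : WarpedProduct lam N) ∈ G := by
    have h1 : ∀ᶠ z : radii lam × (∀ q, EuclideanSpace ℝ (Fin (m q))) in 𝓝 (x₀.1, w₀),
        ((z.1, fun q => (φ q).symm (z.2 q)) : WarpedProduct lam N) ∈ G := by
      have h2 : ContinuousAt (fun z : radii lam × (∀ q, EuclideanSpace ℝ (Fin (m q))) =>
          ((z.1, fun q => (φ q).symm (z.2 q)) : WarpedProduct lam N)) (x₀.1, w₀) := by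
        refine continuousAt_fst.prodMk (continuousAt_pi.2 fun q => ?_)
        refine ContinuousAt.comp (f := fun z : radii lam × (∀ q, EuclideanSpace ℝ (Fin (m q))) =>
          z.2 q) ?_ ((continuous_apply q).comp continuous_snd).continuousAt
        exact (φ q).continuousAt_symm ((φ q).map_source (hx₀ q))
      refine h2 (hGo.mem_nhds ?_)
      have h3 : (fun q => (φ q).symm (w₀ q)) = x₀.2 := funext fun q => (φ q).left_inv (hx₀ q)
      simp only [h3]
      exact hxG
    have h4 : ∀ᶠ w : (∀ q, EuclideanSpace ℝ (Fin (m q))) in 𝓝 w₀, ∀ q, w q ∈ (φ q).target :=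
      eventually_all.2 fun q => (continuous_apply q).continuousAt
        ((φ q).open_target.mem_nhds ((φ q).map_source (hx₀ q)))
    obtain ⟨δ₁, hδ₁, hb₁⟩ := Metric.eventually_nhds_iff.1 h1
    obtain ⟨δ₂, hδ₂, hb₂⟩ := Metric.eventually_nhds_iff.1 h4
    refine ⟨min δ₁ δ₂, lt_min hδ₁ hδ₂, fun r w hrw => ⟨?_, fun hr => ?_⟩⟩
    · rw [Metric.mem_ball, Prod.dist_eq, max_lt_iff] at hrw
      exact hb₂ (hrw.2.trans_le (min_le_right _ _))
    · exact hb₁ (y := (⟨r, hr⟩, w)) (lt_of_lt_of_le hrw (min_le_left _ _))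
  have hU : {x : WarpedProduct lam N | x.2 ∈ chartDomain m θ₀ ∧
      ((x.1 : ℝ), fun q => φ q (x.2 q)) ∈ Metric.ball ((x₀.1 : ℝ), w₀) δ} ∈ 𝓝 x₀ := by
    refine inter_mem ((isOpen_setOf_mem_chartDomain (lam := lam) (m := m) θ₀).mem_nhds hx₀) ?_
    have h2 : ContinuousAt
        (fun x : WarpedProduct lam N => ((x.1 : ℝ), fun q => φ q (x.2 q))) x₀ := by
      refine (continuous_subtype_val.comp continuous_fst).continuousAt.prodMk
        (continuousAt_pi.2 fun q => ?_)
      refine ContinuousAt.comp (f := fun x : WarpedProduct lam N => x.2 q) ?_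
        ((continuous_apply q).comp continuous_snd).continuousAt
      exact (φ q).continuousAt (hx₀ q)
    exact h2 (Metric.ball_mem_nhds _ hδ)
  refine ⟨_, hU, ?_⟩
  rintro x ⟨hxD, hxb⟩
  refine ⟨hxD, ?_⟩
  rintro y ⟨hyD, hyb⟩
  let wx : ∀ q, EuclideanSpace ℝ (Fin (m q)) := fun q => φ q (x.2 q)
  let wy : ∀ q, EuclideanSpace ℝ (Fin (m q)) := fun q => φ q (y.2 q)
  let ℓ : ∀ q, ℝ → EuclideanSpace ℝ (Fin (m q)) := fun q t => wx q + t • (wy q - wx q)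
  let ρ : ℝ → ℝ := fun t => x.1 + t * (y.1 - x.1)
  have hmemb : ∀ t ∈ Icc (0 : ℝ) 1, (ρ t, fun q => ℓ q t) ∈ Metric.ball ((x₀.1 : ℝ), w₀) δ := by
    intro t ht
    have := (convex_ball ((x₀.1 : ℝ), w₀) δ).add_smul_sub_mem hxb hyb ht
    exact this
  have hρ : ∀ t ∈ Icc (0 : ℝ) 1, ρ t ∈ radii lam := fun t ht => by
    have := (convex_radii lam).add_smul_sub_mem x.1.2 y.1.2 ht
    exact this
  have hℓt : ∀ t ∈ Icc (0 : ℝ) 1, ∀ q, ℓ q t ∈ (φ q).target := fun t ht q =>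
    (hball _ _ (hmemb t ht)).1 q
  let c : C1Curve lam m N :=
    { rad := ρ
      base := fun q t => (φ q).symm (ℓ q t)
      rad_mem := hρ
      contDiffOn_rad := by
        simp only [ρ]
        fun_prop
      contMDiffOn_base := fun q => by
        have h1 : ContMDiffOn (𝓡 (m q)) (𝓡 (m q)) 1 (φ q).symm (φ q).target :=
          (contMDiffOn_chart_symm (I := 𝓡 (m q)) (n := ∞) (x := θ₀ q)).of_le (by simp)
        refine h1.comp ?_ fun t ht => hℓt t ht q
        have h2 : ContDiff ℝ 1 (ℓ q) := by simp only [ℓ]; fun_prop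
        exact h2.contMDiff.contMDiffOn }
  have hsource : c.source = x := by
    refine Prod.ext (Subtype.ext ?_) (funext fun q => ?_)
    · simp [C1Curve.source, c, ρ]
    · simp only [C1Curve.source, c, ℓ, zero_smul, add_zero]
      exact (φ q).left_inv (hxD q)
  have htarget : c.target = y := by
    refine Prod.ext (Subtype.ext ?_) (funext fun q => ?_)
    · simp [C1Curve.target, c, ρ]
    · simp only [C1Curve.target, c, ℓ, one_smul, add_sub_cancel]
      exact (φ q).left_inv (hyD q)
  have hlen : c.length g s ≤ edist (warpChart θ₀ J k x) (warpChart θ₀ J k y) := by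
    have hspeed : ∀ t ∈ Icc (0 : ℝ) 1, ENNReal.ofReal (c.speed g s t) ≤
        edist (warpChart θ₀ J k x) (warpChart θ₀ J k y) := by
      intro t ht
      rw [edist_warpChart]
      have hu := uniqueDiffOn_Icc (zero_lt_one' ℝ) t ht
      have hr : derivWithin c.rad (Icc 0 1) t = y.1 - x.1 := by
        have : HasDerivAt ρ (y.1 - x.1) t := by
          have h := ((hasDerivAt_id t).mul_const ((y.1 : ℝ) - x.1)).const_add (x.1 : ℝ)
          rw [one_mul] at h
          exact h
        exact this.hasDerivWithinAt.derivWithin hu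
      refine ENNReal.ofReal_le_ofReal (Real.sqrt_le_sqrt ?_)
      rw [hr]
      refine add_le_add le_rfl (Finset.sum_le_sum fun q _ => ?_)
      have hsrc : c.base q t ∈ (φ q).source := (φ q).map_target (hℓt t ht q)
      have hv := c.hasDerivWithinAt_chart q (θ₀ q) ht hsrc
      have hv2 : HasDerivWithinAt (fun u => chartAt (EuclideanSpace ℝ (Fin (m q))) (θ₀ q)
          (c.base q u)) (wy q - wx q) (Icc 0 1) t := by
        have h1 : HasDerivAt (ℓ q) (wy q - wx q) t := by
          have h := ((hasDerivAt_id t).smul_const (wy q - wx q)).const_add (wx q)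
          rw [one_smul] at h
          exact h
        exact h1.hasDerivWithinAt.congr (fun u hu => (φ q).right_inv (hℓt u hu q))
          ((φ q).right_inv (hℓt t ht q))
      have hvel := hu.eq_deriv _ hv hv2
      have hg := hGsub _ ((hball _ _ (hmemb t ht)).2 (hρ t ht)) q (c.velocity q t)
      have hs1 : 0 ≤ s q (c.rad t) := hs0 q _ (hρ t ht)
      calc s q (c.rad t) ^ 2 * (g q).inner (c.base q t) (c.velocity q t) (c.velocity q t)
          = (s q (c.rad t) * Real.sqrt ((g q).inner (c.base q t) (c.velocity q t)
              (c.velocity q t))) ^ 2 := by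
            rw [mul_pow, Real.sq_sqrt ((g q).inner_self_nonneg _ _)]
        _ ≤ (k q * ‖J q (mfderiv (𝓡 (m q)) 𝓘(ℝ, EuclideanSpace ℝ (Fin (m q)))
              (chartAt (EuclideanSpace ℝ (Fin (m q))) (θ₀ q)) (c.base q t)
              (c.velocity q t))‖) ^ 2 :=
            pow_le_pow_left₀ (mul_nonneg hs1 (Real.sqrt_nonneg _)) hg 2
        _ = ‖k q • J q (wy q - wx q)‖ ^ 2 := by
            rw [norm_smul, Real.norm_of_nonneg (hk q).1.le, ← hvel]
    calc c.length g s = ∫⁻ t in Icc (0 : ℝ) 1, ENNReal.ofReal (c.speed g s t) := rfl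
      _ ≤ ∫⁻ t in Icc (0 : ℝ) 1, edist (warpChart θ₀ J k x) (warpChart θ₀ J k y) :=
          setLIntegral_mono' measurableSet_Icc hspeed
      _ = _ := by simp
  have hjoin := JoinedByLength.forward (g := g) (s := s) c
    (JoinedByLength.refl (x := c.source))
  rw [hsource, htarget, zero_add] at hjoin
  exact (iInf₂_le _ hjoin).trans hlen

end

/-! ### The metric near an interior point -/

section

variable {p : ℕ} {m : Fin p → ℕ}

/-- The linear map of the Euclidean model of the base scaling the `q`-th factor by `c q`. -/
noncomputable def stretchBase (c : Fin p → ℝ) : ModelBase m →ₗ[ℝ] ModelBase m where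
  toFun w := WithLp.toLp 2 fun q => c q • w q
  map_add' v w := by
    ext q i
    simp
  map_smul' a w := by
    ext q i
    simp [mul_left_comm]

theorem stretchBase_apply (c : Fin p → ℝ) (w : ModelBase m) (q : Fin p) :
    stretchBase c w q = c q • w q := rfl

theorem det_stretchBase (c : Fin p → ℝ) :
    LinearMap.det (stretchBase c : ModelBase m →ₗ[ℝ] ModelBase m) = ∏ q, c q ^ m q := by
  let b : Module.Basis (Σ q : Fin p, Fin (m q)) ℝ (ModelBase m) :=
    (Pi.basis fun q => (EuclideanSpace.basisFun (Fin (m q)) ℝ).toBasis).map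
      (WithLp.linearEquiv 2 ℝ (∀ q, EuclideanSpace ℝ (Fin (m q)))).symm
  have hb : LinearMap.toMatrix b b (stretchBase c) = Matrix.diagonal fun i => c i.1 := by
    ext i j
    rw [LinearMap.toMatrix_apply]
    have h1 : b.repr (stretchBase c (b j)) i = c i.1 * b.repr (b j) i := by
      simp [b, Pi.basis_repr, stretchBase_apply]
    rw [h1, Module.Basis.repr_self, Matrix.diagonal_apply, Finsupp.single_apply]
    by_cases hij : i = j
    · simp [hij]
    · simp [hij, Ne.symm hij]
  rw [← LinearMap.det_toMatrix b, hb, Matrix.det_diagonal, Fintype.prod_sigma]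
  simp

theorem volume_image_stretchBase (c : Fin p → ℝ) (T : Set (ModelBase m)) :
    volume (stretchBase c '' T) = ENNReal.ofReal |∏ q, c q ^ m q| * volume T := by
  rw [Measure.addHaar_image_linearMap, det_stretchBase]

theorem euclideanHausdorffMeasure_modelBase :
    (μHE[∑ q, m q] : Measure (ModelBase m)) = volume := by
  have h : Module.finrank ℝ (ModelBase m) = ∑ q, m q := by
    rw [(WithLp.linearEquiv 2 ℝ (∀ q, EuclideanSpace ℝ (Fin (m q)))).finrank_eq]
    simp [Module.finrank_pi_fintype]
  rw [← h]
  exact InnerProductSpace.euclideanHausdorffMeasure_eq_volume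

theorem euclideanHausdorffMeasure_modelSpace :
    (μHE[(∑ q, m q) + 1] : Measure (ModelSpace m)) = volume := by
  have h : Module.finrank ℝ (ModelSpace m) = (∑ q, m q) + 1 := by
    rw [(WithLp.linearEquiv 2 ℝ (ℝ × ModelBase m)).finrank_eq, Module.finrank_prod,
      (WithLp.linearEquiv 2 ℝ (∀ q, EuclideanSpace ℝ (Fin (m q)))).finrank_eq]
    simp [Module.finrank_pi_fintype, add_comm]
  rw [← h]
  exact InnerProductSpace.euclideanHausdorffMeasure_eq_volume

/-- The factors by which the metric `dr² + ∑ q, s_q(r)² g_q` scales the base at radius `r`; the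
irrelevant factors of dimension zero are replaced by `1`, so that all factors are positive. -/
noncomputable def warpFactor (m : Fin p → ℕ) (s : Fin p → ℝ → ℝ) (r : ℝ) (q : Fin p) : ℝ :=
  if m q = 0 then 1 else s q r

theorem prod_warpFactor_pow (s : Fin p → ℝ → ℝ) (r : ℝ) :
    ∏ q, warpFactor m s r q ^ m q = areaFactor m s r := by
  refine Finset.prod_congr rfl fun q _ => ?_
  by_cases h : m q = 0 <;> simp [warpFactor, h]

theorem warpFactor_pos {s : Fin p → ℝ → ℝ} {r : ℝ} (hs : ∀ q, 0 ≤ s q r)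
    (hA : 0 < areaFactor m s r) (q : Fin p) : 0 < warpFactor m s r q := by
  by_cases h : m q = 0
  · simp [warpFactor, h]
  · simp only [warpFactor, h, if_false]
    refine (hs q).lt_of_ne' fun h0 => hA.ne' ?_
    exact Finset.prod_eq_zero (Finset.mem_univ q) (by rw [h0, zero_pow h])

end

section

variable {lam : EReal} {p : ℕ} {m : Fin p → ℕ} {N : Fin p → Type*}
  [∀ q, TopologicalSpace (N q)] [∀ q, ChartedSpace (EuclideanSpace ℝ (Fin (m q))) (N q)]

theorem edist_warpChart_le_mul (θ₀ : ∀ q, N q)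
    (J : ∀ q, EuclideanSpace ℝ (Fin (m q)) ≃L[ℝ] EuclideanSpace ℝ (Fin (m q)))
    {k k' : Fin p → ℝ} {κ : ℝ≥0} (hκ : 1 ≤ κ) (hk : ∀ q, |k q| ≤ κ * |k' q|)
    (x y : WarpedProduct lam N) :
    edist (warpChart θ₀ J k x) (warpChart θ₀ J k y) ≤
      κ * edist (warpChart θ₀ J k' x) (warpChart θ₀ J k' y) := by
  rw [edist_warpChart, edist_warpChart, ← ENNReal.ofReal_coe_nnreal,
    ← ENNReal.ofReal_mul κ.coe_nonneg]
  refine ENNReal.ofReal_le_ofReal (Real.sqrt_le_iff.2 ⟨by positivity, ?_⟩)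
  have hκ' : (1 : ℝ) ≤ κ := hκ
  rw [mul_pow, Real.sq_sqrt (by positivity), mul_add, Finset.mul_sum]
  refine add_le_add (le_mul_of_one_le_left (sq_nonneg _) (one_le_pow₀ hκ'))
    (Finset.sum_le_sum fun q _ => ?_)
  rw [norm_smul, norm_smul, ← mul_pow, Real.norm_eq_abs, Real.norm_eq_abs, ← mul_assoc]
  gcongr
  exact hk q

theorem edist_warpChart_snd_le (θ₀ : ∀ q, N q)
    (J : ∀ q, EuclideanSpace ℝ (Fin (m q)) ≃L[ℝ] EuclideanSpace ℝ (Fin (m q)))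
    (k : Fin p → ℝ) (x y : WarpedProduct lam N) :
    edist (warpChart θ₀ J k x).snd (warpChart θ₀ J k y).snd ≤
      edist (warpChart θ₀ J k x) (warpChart θ₀ J k y) := by
  apply WithLp.edist_snd_le

theorem edist_warpChart_eq_snd (θ₀ : ∀ q, N q)
    (J : ∀ q, EuclideanSpace ℝ (Fin (m q)) ≃L[ℝ] EuclideanSpace ℝ (Fin (m q)))
    (k : Fin p → ℝ) {x y : WarpedProduct lam N} (h : x.1 = y.1) :
    edist (warpChart θ₀ J k x) (warpChart θ₀ J k y) =
      edist (warpChart θ₀ J k x).snd (warpChart θ₀ J k y).snd := by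
  rw [edist_dist, edist_dist, WithLp.prod_dist_eq_of_L2, warpChart_fst, warpChart_fst, h, dist_self,
    zero_pow two_ne_zero, zero_add, Real.sqrt_sq dist_nonneg]

theorem mem_chartDomain_self (θ₀ : ∀ q, N q) : θ₀ ∈ chartDomain m θ₀ :=
  fun q => mem_chart_source _ (θ₀ q)

variable [∀ q, IsManifold (𝓡 (m q)) ∞ (N q)]

theorem exists_chartFrames (g : ∀ q, SmoothMetric (m q) (N q)) {θ₀ θ₁ : ∀ q, N q}
    (h : θ₁ ∈ chartDomain m θ₀) :
    ∃ J : ∀ q, EuclideanSpace ℝ (Fin (m q)) ≃L[ℝ] EuclideanSpace ℝ (Fin (m q)),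
      ∀ q, IsChartFrame (g q) (θ₀ q) (θ₁ q) (J q) := by
  choose J hJ using fun q => (g q).exists_chart_frame (θ₀ q) (θ₁ q) (h q)
  exact ⟨J, hJ⟩

variable [∀ q, T2Space (N q)] [∀ q, CompactSpace (N q)]
  {g : ∀ q, SmoothMetric (m q) (N q)} {s : Fin p → ℝ → ℝ}

/-- Near a point of the interior, the product chart with the factors of the metric at that point is
an isometry up to factors arbitrarily close to one. -/
theorem exists_nhds_warpChart_almost_isometry
    {θ₀ : ∀ q, N q} {x₀ : WarpedProduct lam N} (hx₀ : x₀.2 ∈ chartDomain m θ₀)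
    {J : ∀ q, EuclideanSpace ℝ (Fin (m q)) ≃L[ℝ] EuclideanSpace ℝ (Fin (m q))}
    (hJ : ∀ q, IsChartFrame (g q) (θ₀ q) (x₀.2 q) (J q))
    (hs : ∀ q, ContinuousOn (s q) (radii lam)) (hs0 : ∀ q, ∀ r ∈ radii lam, 0 ≤ s q r)
    (hA : 0 < areaFactor m s x₀.1) {κ : ℝ≥0} (hκ : 1 < κ) :
    ∃ U ∈ 𝓝 x₀, ∀ x ∈ U, x.2 ∈ chartDomain m θ₀ ∧ ∀ y ∈ U,
      edist (warpChart θ₀ J (warpFactor m s x₀.1) x) (warpChart θ₀ J (warpFactor m s x₀.1) y) ≤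
        κ * warpedDist g s x y ∧
      warpedDist g s x y ≤ κ * edist (warpChart θ₀ J (warpFactor m s x₀.1) x)
        (warpChart θ₀ J (warpFactor m s x₀.1) y) := by
  set c := warpFactor m s x₀.1 with hc
  have hc0 : ∀ q, 0 < c q := warpFactor_pos (fun q => hs0 q _ x₀.1.2) hA
  have hκ' : (1 : ℝ) < κ := hκ
  have hκ0 : (0 : ℝ) < κ := zero_lt_one.trans hκ'
  have hcs : ∀ q, m q ≠ 0 → c q = s q x₀.1 := fun q hq => by simp [hc, warpFactor, hq]
  let k₁ : Fin p → ℝ := fun q => (κ : ℝ)⁻¹ * c q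
  let k₂ : Fin p → ℝ := fun q => κ * c q
  have hk₁ : ∀ q, 0 < k₁ q ∧ (m q = 0 ∨ k₁ q < s q x₀.1) := fun q => by
    refine ⟨mul_pos (inv_pos.2 hκ0) (hc0 q), or_iff_not_imp_left.2 fun hq => ?_⟩
    rw [← hcs q hq]
    exact mul_lt_of_lt_one_left (hc0 q) (inv_lt_one_of_one_lt₀ hκ')
  have hk₂ : ∀ q, 0 < k₂ q ∧ (m q = 0 ∨ s q x₀.1 < k₂ q) := fun q => by
    refine ⟨mul_pos hκ0 (hc0 q), or_iff_not_imp_left.2 fun hq => ?_⟩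
    rw [← hcs q hq]
    exact lt_mul_of_one_lt_left (hc0 q) hκ'
  obtain ⟨δ, hδ, U₁, hU₁, hL⟩ :=
    exists_nhds_edist_warpChart_le_warpedDist hx₀ hJ hs hk₁ univ_mem
  obtain ⟨U₂, hU₂, hU⟩ := exists_nhds_warpedDist_le_edist_warpChart hx₀ hJ hs hs0 hk₂
  have hcont : ContinuousAt (warpChart (lam := lam) θ₀ J k₁) x₀ :=
    (continuousOn_warpChart θ₀ J k₁).continuousAt ((isOpen_setOf_mem_chartDomain θ₀).mem_nhds hx₀)
  have hU₃ := hcont (Metric.eball_mem_nhds _ (ENNReal.half_pos hδ.ne'))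
  refine ⟨U₁ ∩ U₂ ∩ warpChart θ₀ J k₁ ⁻¹' Metric.eball (warpChart θ₀ J k₁ x₀) (δ / 2),
    inter_mem (inter_mem hU₁ hU₂) hU₃, ?_⟩
  rintro x ⟨⟨hx1, hx2⟩, hx3⟩
  refine ⟨(hU x hx2).1, ?_⟩
  rintro y ⟨⟨hy1, hy2⟩, hy3⟩
  constructor
  · have h1 : edist (warpChart θ₀ J k₁ x) (warpChart θ₀ J k₁ y) ≤ warpedDist g s x y := by
      by_cases hd : warpedDist g s x y < δ
      · exact ((hL x hx1).2 y hd).2.2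
      · refine le_trans ?_ (not_lt.1 hd)
        refine (edist_triangle_right _ _ (warpChart θ₀ J k₁ x₀)).trans ?_
        rw [← ENNReal.add_halves δ]
        exact add_le_add (le_of_lt hx3) (le_of_lt hy3)
    refine (edist_warpChart_le_mul θ₀ J hκ.le (fun q => ?_) x y).trans (mul_le_mul_right h1 _)
    rw [abs_mul, abs_inv, abs_of_pos hκ0, ← mul_assoc, mul_inv_cancel₀ hκ0.ne', one_mul]
  · refine ((hU x hx2).2 y hy2).trans (edist_warpChart_le_mul θ₀ J hκ.le (fun q => ?_) x y)
    rw [abs_mul, abs_of_pos hκ0]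

end

/-! ### Hausdorff measures in the interior and polar coordinates -/

theorem NNReal.exists_one_lt_pow_le {κ : ℝ≥0} (hκ : 1 < κ) (n : ℕ) :
    ∃ κ' : ℝ≥0, 1 < κ' ∧ κ' ^ n ≤ κ := by
  have h : Tendsto (fun x : ℝ≥0 => x ^ n) (𝓝[>] 1) (𝓝 1) := by
    have := (continuous_pow (M := ℝ≥0) n).tendsto 1
    rw [one_pow] at this
    exact this.mono_left nhdsWithin_le_nhds
  have := (h.eventually (gt_mem_nhds hκ)).and self_mem_nhdsWithin
  obtain ⟨κ', h1, h2⟩ := this.exists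
  exact ⟨κ', h2, h1.le⟩

section

variable {lam : EReal} {p : ℕ} {N : Fin p → Type*}

/-- Polar coordinates, as a map to the product of the real line and the base. -/
def polarCoords (x : WarpedProduct lam N) : ℝ × ∀ q, N q := (x.1, x.2)

@[simp] theorem polarCoords_fst (x : WarpedProduct lam N) : (polarCoords x).1 = x.1 := rfl

@[simp] theorem polarCoords_snd (x : WarpedProduct lam N) : (polarCoords x).2 = x.2 := rfl

theorem injective_polarCoords :
    Function.Injective (polarCoords : WarpedProduct lam N → ℝ × ∀ q, N q) := fun _ _ h =>
  Prod.ext (Subtype.ext (Prod.ext_iff.1 h).1) (Prod.ext_iff.1 h).2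

theorem measurableEmbedding_polarCoords [MeasurableSpace (∀ q, N q)] :
    MeasurableEmbedding (polarCoords : WarpedProduct lam N → ℝ × ∀ q, N q) :=
  (MeasurableEmbedding.subtype_coe (ordConnected_radii lam).measurableSet).prodMap
    MeasurableEmbedding.id

theorem measurableSet_setOf_radius_pos [MeasurableSpace (∀ q, N q)] :
    MeasurableSet {x : WarpedProduct lam N | 0 < (x.1 : ℝ)} :=
  measurableSet_lt measurable_const (measurable_subtype_coe.comp measurable_fst)

theorem exists_nhds_prod_subset [∀ q, TopologicalSpace (N q)] {x₀ : WarpedProduct lam N}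
    {U : Set (WarpedProduct lam N)} (hU : U ∈ 𝓝 x₀) :
    ∃ u ∈ 𝓝 (x₀.1 : ℝ), ∃ v ∈ 𝓝 x₀.2, ∀ x : WarpedProduct lam N,
      (x.1 : ℝ) ∈ u → x.2 ∈ v → x ∈ U := by
  obtain ⟨u, hu, v, hv, h⟩ := mem_nhds_prod_iff.1 hU
  rw [nhds_induced, mem_comap] at hu
  obtain ⟨u', hu', hsub⟩ := hu
  exact ⟨u', hu', v, hv, fun x h1 h2 => h ⟨hsub h1, h2⟩⟩

end

section

variable {lam : EReal} {p : ℕ} {m : Fin p → ℕ} {N : Fin p → Type*}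
  [∀ q, TopologicalSpace (N q)] [∀ q, ChartedSpace (EuclideanSpace ℝ (Fin (m q))) (N q)]
  [∀ q, IsManifold (𝓡 (m q)) ∞ (N q)]
  {g : ∀ q, SmoothMetric (m q) (N q)} {s : Fin p → ℝ → ℝ}

theorem edist_toMetric (x y : WarpedProduct lam N) :
    edist (toMetric g s x) (toMetric g s y) = warpedDist g s x y := rfl

theorem surjective_toMetric :
    Function.Surjective (toMetric g s : WarpedProduct lam N → WarpedMetricSpace lam g s) :=
  SeparationQuotient.surjective_mk (X := WarpedPseudoSpace lam g s)

theorem continuous_radius : Continuous (radius g s : WarpedMetricSpace lam g s → ℝ) := by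
  have h : LipschitzWith 1 (radius g s : WarpedMetricSpace lam g s → ℝ) := by
    intro z w
    obtain ⟨x, rfl⟩ := surjective_toMetric z
    obtain ⟨y, rfl⟩ := surjective_toMetric w
    rw [ENNReal.coe_one, one_mul]
    exact edist_rad_le_warpedDist g s x y
  exact h.continuous

theorem continuous_toMetric (hs : ∀ q, ContinuousOn (s q) (radii lam))
    (hs0 : ∀ q, ∀ r ∈ radii lam, 0 ≤ s q r) :
    Continuous (toMetric g s : WarpedProduct lam N → WarpedMetricSpace lam g s) := by
  refine continuous_iff_continuousAt.2 fun x₀ => ?_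
  obtain ⟨J, hJ⟩ := exists_chartFrames g (mem_chartDomain_self x₀.2)
  let k : Fin p → ℝ := fun q => s q x₀.1 + 1
  obtain ⟨U, hU, h⟩ := exists_nhds_warpedDist_le_edist_warpChart (lam := lam)
    (mem_chartDomain_self x₀.2) hJ hs hs0 (k := k)
    fun q => ⟨by have := hs0 q _ x₀.1.2; positivity, Or.inr (lt_add_one _)⟩
  have hcont : ContinuousAt (warpChart (lam := lam) x₀.2 J k) x₀ :=
    (continuousOn_warpChart x₀.2 J k).continuousAt
      ((isOpen_setOf_mem_chartDomain x₀.2).mem_nhds (mem_chartDomain_self x₀.2))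
  refine EMetric.tendsto_nhds.2 fun ε hε => ?_
  filter_upwards [hU, hcont (Metric.eball_mem_nhds _ hε)] with x hx hx'
  exact ((h x hx).2 x₀ (mem_of_mem_nhds hU)).trans_lt hx'

/-- The canonical map from the interior `{r > 0}` to the metric space of the Riemannian distance. -/
noncomputable def interiorMap (lam : EReal) (g : ∀ q, SmoothMetric (m q) (N q))
    (s : Fin p → ℝ → ℝ) (x : {x : WarpedProduct lam N // 0 < (x.1 : ℝ)}) :
    WarpedMetricSpace lam g s :=
  toMetric g s x.1

theorem range_interiorMap :
    range (interiorMap lam g s) = {z : WarpedMetricSpace lam g s | 0 < radius g s z} := by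
  ext z
  obtain ⟨x, rfl⟩ := surjective_toMetric z
  constructor
  · rintro ⟨y, hy⟩
    rw [← hy]
    exact y.2
  · intro h
    exact ⟨⟨x, h⟩, rfl⟩

variable [∀ q, T2Space (N q)] [∀ q, CompactSpace (N q)]

/-- At a point of the interior, the Riemannian distance is not weaker than the product
topology. -/
theorem exists_forall_warpedDist_lt_imp_mem (hs : ∀ q, ContinuousOn (s q) (radii lam))
    (hs0 : ∀ q, ∀ r ∈ radii lam, 0 ≤ s q r) {x₀ : WarpedProduct lam N}
    (hA : 0 < areaFactor m s x₀.1) {V : Set (WarpedProduct lam N)} (hV : V ∈ 𝓝 x₀) :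
    ∃ δ > 0, ∀ y, warpedDist g s x₀ y < δ → y ∈ V := by
  obtain ⟨J, hJ⟩ := exists_chartFrames g (mem_chartDomain_self x₀.2)
  have hc0 : ∀ q, 0 < warpFactor m s x₀.1 q := warpFactor_pos (fun q => hs0 q _ x₀.1.2) hA
  obtain ⟨δ, hδ, U, hU, h⟩ := exists_nhds_edist_warpChart_le_warpedDist (lam := lam)
    (mem_chartDomain_self x₀.2) hJ hs (k := fun q => warpFactor m s x₀.1 q / 2) (V := V)
    (fun q => ⟨half_pos (hc0 q), or_iff_not_imp_left.2 fun hq => by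
      have h1 := half_lt_self (hc0 q)
      simpa only [warpFactor, hq, if_false] using h1⟩) hV
  exact ⟨δ, hδ, fun y hy => ((h x₀ (mem_of_mem_nhds hU)).2 y hy).1⟩

/-- Near a point of the interior, Hausdorff measures are those of the image under the product chart,
up to factors arbitrarily close to one. -/
theorem exists_nhds_hausdorffMeasure_warpChart
    {θ₀ : ∀ q, N q} {x₀ : WarpedProduct lam N} (hx₀ : x₀.2 ∈ chartDomain m θ₀)
    {J : ∀ q, EuclideanSpace ℝ (Fin (m q)) ≃L[ℝ] EuclideanSpace ℝ (Fin (m q))}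
    (hJ : ∀ q, IsChartFrame (g q) (θ₀ q) (x₀.2 q) (J q))
    (hs : ∀ q, ContinuousOn (s q) (radii lam)) (hs0 : ∀ q, ∀ r ∈ radii lam, 0 ≤ s q r)
    (hA : 0 < areaFactor m s x₀.1) (d : ℕ) {κ : ℝ≥0} (hκ : 1 < κ) :
    ∃ U ∈ 𝓝 x₀, (∀ x ∈ U, x.2 ∈ chartDomain m θ₀) ∧ ∀ S ⊆ U,
      (μHE[d] : Measure (WarpedMetricSpace lam g s)) (toMetric g s '' S) ≤
        κ * (μHE[d] : Measure (ModelSpace m)) (warpChart θ₀ J (warpFactor m s x₀.1) '' S) ∧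
      (μHE[d] : Measure (ModelSpace m)) (warpChart θ₀ J (warpFactor m s x₀.1) '' S) ≤
        κ * (μHE[d] : Measure (WarpedMetricSpace lam g s)) (toMetric g s '' S) := by
  obtain ⟨κ', hκ', hle⟩ := NNReal.exists_one_lt_pow_le hκ d
  obtain ⟨U, hU, h⟩ := exists_nhds_warpChart_almost_isometry hx₀ hJ hs hs0 hA hκ'
  have hle' : (κ' : ℝ≥0∞) ^ d ≤ κ := by exact_mod_cast hle
  refine ⟨U, hU, fun x hx => (h x hx).1, fun S hS => ⟨?_, ?_⟩⟩
  · refine (euclideanHausdorffMeasure_image_le d κ' fun x hx y hy => ?_).trans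
      (mul_le_mul_left hle' _)
    exact ((h x (hS hx)).2 y (hS hy)).2
  · refine (euclideanHausdorffMeasure_image_le d κ' fun x hx y hy => ?_).trans
      (mul_le_mul_left hle' _)
    exact ((h x (hS hx)).2 y (hS hy)).1

/-- Near a point of the interior, the projection to the base along the radial direction
decreases the area, up to the factor `A(r)`. -/
theorem exists_nhds_volume_baseChart_le_riemArea
    {θ₀ : ∀ q, N q} {x₀ : WarpedProduct lam N} (hx₀ : x₀.2 ∈ chartDomain m θ₀)
    {J : ∀ q, EuclideanSpace ℝ (Fin (m q)) ≃L[ℝ] EuclideanSpace ℝ (Fin (m q))}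
    (hJ : ∀ q, IsChartFrame (g q) (θ₀ q) (x₀.2 q) (J q))
    (hs : ∀ q, ContinuousOn (s q) (radii lam)) (hs0 : ∀ q, ∀ r ∈ radii lam, 0 ≤ s q r)
    (hA : 0 < areaFactor m s x₀.1) {κ : ℝ≥0} (hκ : 1 < κ) :
    ∃ U ∈ 𝓝 x₀, (∀ x ∈ U, x.2 ∈ chartDomain m θ₀) ∧ ∀ S ⊆ U,
      ENNReal.ofReal (areaFactor m s x₀.1) * volume (baseChart θ₀ J '' (Prod.snd '' S)) ≤
        κ * riemArea g s S := by
  obtain ⟨U, hU, hU1, h⟩ :=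
    exists_nhds_hausdorffMeasure_warpChart hx₀ hJ hs hs0 hA (∑ q, m q) hκ
  refine ⟨U, hU, hU1, fun S hS => le_trans ?_ (h S hS).2⟩
  have h1 := euclideanHausdorffMeasure_image_le (∑ q, m q) 1
    (f := warpChart θ₀ J (warpFactor m s x₀.1))
    (h := fun x => (warpChart θ₀ J (warpFactor m s x₀.1) x).snd) (S := S) fun x _ y _ => by
      rw [ENNReal.coe_one, one_mul]
      exact edist_warpChart_snd_le θ₀ J _ x y
  rw [ENNReal.coe_one, one_pow, one_mul, euclideanHausdorffMeasure_modelBase] at h1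
  refine le_trans (le_of_eq ?_) h1
  have h2 : (fun x => (warpChart θ₀ J (warpFactor m s x₀.1) x).snd) '' S =
      stretchBase (warpFactor m s x₀.1) '' (baseChart θ₀ J '' (Prod.snd '' S)) := by
    rw [image_image, image_image]
    rfl
  rw [h2, volume_image_stretchBase, prod_warpFactor_pow, abs_of_pos hA]

/-- Near a point of the interior, the area in the slice through that point is `A(r)` times the
Lebesgue measure in the product chart, up to factors arbitrarily close to one. -/
theorem exists_nhds_riemArea_le_volume_baseChart
    {θ₀ : ∀ q, N q} {x₀ : WarpedProduct lam N} (hx₀ : x₀.2 ∈ chartDomain m θ₀)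
    {J : ∀ q, EuclideanSpace ℝ (Fin (m q)) ≃L[ℝ] EuclideanSpace ℝ (Fin (m q))}
    (hJ : ∀ q, IsChartFrame (g q) (θ₀ q) (x₀.2 q) (J q))
    (hs : ∀ q, ContinuousOn (s q) (radii lam)) (hs0 : ∀ q, ∀ r ∈ radii lam, 0 ≤ s q r)
    (hA : 0 < areaFactor m s x₀.1) {κ : ℝ≥0} (hκ : 1 < κ) :
    ∃ U ∈ 𝓝 x₀, (∀ x ∈ U, x.2 ∈ chartDomain m θ₀) ∧ ∀ S ⊆ U, S ⊆ slice lam N x₀.1 →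
      riemArea g s S ≤ κ *
        (ENNReal.ofReal (areaFactor m s x₀.1) * volume (baseChart θ₀ J '' (Prod.snd '' S))) := by
  obtain ⟨U, hU, hU1, h⟩ :=
    exists_nhds_hausdorffMeasure_warpChart hx₀ hJ hs hs0 hA (∑ q, m q) hκ
  refine ⟨U, hU, hU1, fun S hS hS' => (h S hS).1.trans (mul_le_mul_right ?_ _)⟩
  have h1 := euclideanHausdorffMeasure_image_le (∑ q, m q) 1
    (h := warpChart θ₀ J (warpFactor m s x₀.1))
    (f := fun x => (warpChart θ₀ J (warpFactor m s x₀.1) x).snd) (S := S) fun x hx y hy => by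
      rw [ENNReal.coe_one, one_mul]
      exact (edist_warpChart_eq_snd θ₀ J _ (Subtype.ext ((hS' hx).trans (hS' hy).symm))).le
  rw [ENNReal.coe_one, one_pow, one_mul, euclideanHausdorffMeasure_modelBase] at h1
  refine h1.trans (le_of_eq ?_)
  have h2 : (fun x => (warpChart θ₀ J (warpFactor m s x₀.1) x).snd) '' S =
      stretchBase (warpFactor m s x₀.1) '' (baseChart θ₀ J '' (Prod.snd '' S)) := by
    rw [image_image, image_image]
    rfl
  rw [h2, volume_image_stretchBase, prod_warpFactor_pow, abs_of_pos hA]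

/-- In the interior the metric does not degenerate, so that the Riemannian distance is a distance
there and induces the product topology. -/
theorem isOpenEmbedding_interiorMap (hs : ∀ q, ContinuousOn (s q) (radii lam))
    (hs0 : ∀ q, ∀ r ∈ radii lam, 0 ≤ s q r)
    (hA : ∀ r ∈ radii lam, 0 < r → 0 < areaFactor m s r) :
    IsOpenEmbedding (interiorMap lam g s) := by
  refine IsOpenEmbedding.of_continuous_injective_isOpenMap
    ((continuous_toMetric hs hs0).comp continuous_subtype_val) ?_ ?_
  · intro x y hxy
    by_contra hne
    have hV : {y.1}ᶜ ∈ 𝓝 x.1 :=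
      isOpen_compl_singleton.mem_nhds fun h => hne (Subtype.ext h)
    obtain ⟨δ, hδ, h⟩ := exists_forall_warpedDist_lt_imp_mem (g := g) hs hs0
      (hA _ x.1.1.2 x.2) hV
    refine h y.1 ?_ rfl
    have h0 : warpedDist g s x.1 y.1 = 0 := by
      rw [← edist_toMetric]
      exact edist_eq_zero.2 hxy
    rwa [h0]
  · refine IsOpenMap.of_nhds_le fun x S hS => ?_
    rw [Filter.mem_map, nhds_induced, mem_comap] at hS
    obtain ⟨V, hV, hVS⟩ := hS
    have hV' : V ∩ {x | 0 < (x.1 : ℝ)} ∈ 𝓝 x.1 := inter_mem hV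
      ((isOpen_lt continuous_const (continuous_subtype_val.comp continuous_fst)).mem_nhds x.2)
    obtain ⟨δ, hδ, h⟩ := exists_forall_warpedDist_lt_imp_mem (g := g) hs hs0
      (hA _ x.1.1.2 x.2) hV'
    refine mem_of_superset (Metric.eball_mem_nhds _ hδ) fun z hz => ?_
    obtain ⟨y, rfl⟩ := surjective_toMetric z
    have hy := h y (by rw [← edist_toMetric, edist_comm]; exact hz)
    exact hVS (a := ⟨y, hy.2⟩) hy.1

variable [MeasurableSpace (∀ q, N q)] [BorelSpace (∀ q, N q)]
  [SecondCountableTopology (∀ q, N q)]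

/-- The normalized `d`-dimensional Hausdorff measure of the Riemannian distance in the interior
`{r > 0}`, in polar coordinates. -/
noncomputable def polarMeasure (lam : EReal) (g : ∀ q, SmoothMetric (m q) (N q))
    (s : Fin p → ℝ → ℝ) (d : ℕ) : Measure (ℝ × ∀ q, N q) :=
  ((μHE[d] : Measure (WarpedMetricSpace lam g s)).comap (interiorMap lam g s)).map
    (polarCoords ∘ Subtype.val)

theorem polarMeasure_apply (hs : ∀ q, ContinuousOn (s q) (radii lam))
    (hs0 : ∀ q, ∀ r ∈ radii lam, 0 ≤ s q r)
    (hA : ∀ r ∈ radii lam, 0 < r → 0 < areaFactor m s r) (d : ℕ) (S : Set (ℝ × ∀ q, N q)) :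
    polarMeasure lam g s d S = (μHE[d] : Measure (WarpedMetricSpace lam g s))
      (toMetric g s '' {x | 0 < (x.1 : ℝ) ∧ polarCoords x ∈ S}) := by
  have h : MeasurableEmbedding
      (polarCoords ∘ Subtype.val : {x : WarpedProduct lam N // 0 < (x.1 : ℝ)} → _) :=
    measurableEmbedding_polarCoords.comp
      (MeasurableEmbedding.subtype_coe measurableSet_setOf_radius_pos)
  rw [polarMeasure, h.map_apply,
    (isOpenEmbedding_interiorMap hs hs0 hA).measurableEmbedding.comap_apply]
  congr 1
  ext z
  constructor
  · rintro ⟨x, hx, rfl⟩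
    exact ⟨x.1, ⟨x.2, hx⟩, rfl⟩
  · rintro ⟨x, hx, rfl⟩
    exact ⟨⟨x, hx.1⟩, hx.2, rfl⟩

end

section

variable {p : ℕ} {m : Fin p → ℕ} {N : Fin p → Type*}
  [∀ q, TopologicalSpace (N q)] [∀ q, ChartedSpace (EuclideanSpace ℝ (Fin (m q))) (N q)]

theorem isOpenEmbedding_baseChart (θ₀ : ∀ q, N q)
    (J : ∀ q, EuclideanSpace ℝ (Fin (m q)) ≃L[ℝ] EuclideanSpace ℝ (Fin (m q))) :
    IsOpenEmbedding fun θ : chartDomain m θ₀ => baseChart θ₀ J θ := by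
  let e := OpenPartialHomeomorph.pi fun q => chartAt (EuclideanSpace ℝ (Fin (m q))) (θ₀ q)
  let L : (∀ q, EuclideanSpace ℝ (Fin (m q))) ≃L[ℝ] ModelBase m :=
    (ContinuousLinearEquiv.piCongrRight J).trans
      (PiLp.continuousLinearEquiv 2 ℝ fun q => EuclideanSpace ℝ (Fin (m q))).symm
  have hset : chartDomain m θ₀ = e.source := by
    ext θ
    simp [chartDomain, e]
  exact (L.toHomeomorph.isOpenEmbedding.comp e.isOpenEmbedding_restrict).comp
    (Homeomorph.setCongr hset).isOpenEmbedding

/-- The volume of the image under a product chart, by Fubini's theorem. -/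
theorem volume_image_warpChart [MeasurableSpace (∀ q, N q)] [BorelSpace (∀ q, N q)]
    (θ₀ : ∀ q, N q)
    (J : ∀ q, EuclideanSpace ℝ (Fin (m q)) ≃L[ℝ] EuclideanSpace ℝ (Fin (m q)))
    {c : Fin p → ℝ} (hc : ∀ q, 0 < c q) {S : Set (ℝ × ∀ q, N q)} (hS : MeasurableSet S)
    (hSd : ∀ x ∈ S, x.2 ∈ chartDomain m θ₀) :
    volume ((fun x : ℝ × ∀ q, N q =>
      (WithLp.toLp 2 (x.1, stretchBase c (baseChart θ₀ J x.2)) : ModelSpace m)) '' S) =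
      ∫⁻ r, ENNReal.ofReal (∏ q, c q ^ m q) * volume (baseChart θ₀ J '' (Prod.mk r ⁻¹' S)) := by
  let F : ℝ × chartDomain m θ₀ → ℝ × ModelBase m :=
    Prod.map id fun θ => stretchBase c (baseChart θ₀ J θ)
  have hinj : Function.Injective (stretchBase c : ModelBase m →ₗ[ℝ] ModelBase m) := by
    intro v w h
    ext q i
    have := congrArg (fun u : ModelBase m => u q i) h
    simp only [stretchBase_apply, PiLp.smul_apply, smul_eq_mul] at this
    exact mul_left_cancel₀ (hc q).ne' this
  have hF : MeasurableEmbedding F := MeasurableEmbedding.id.prodMap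
    (((stretchBase c).isClosedEmbedding_of_injective
      (LinearMap.ker_eq_bot.2 hinj)).measurableEmbedding.comp
      (isOpenEmbedding_baseChart θ₀ J).measurableEmbedding)
  have hS' : MeasurableSet {x : ℝ × chartDomain m θ₀ | (x.1, (x.2 : ∀ q, N q)) ∈ S} :=
    (measurable_fst.prodMk (measurable_subtype_coe.comp measurable_snd)) hS
  have hT := hF.measurableSet_image' hS'
  have h1 : (fun x : ℝ × ∀ q, N q =>
      (WithLp.toLp 2 (x.1, stretchBase c (baseChart θ₀ J x.2)) : ModelSpace m)) '' S =
      WithLp.ofLp ⁻¹' (F '' {x | (x.1, (x.2 : ∀ q, N q)) ∈ S}) := by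
    ext w
    constructor
    · rintro ⟨x, hx, rfl⟩
      exact ⟨(x.1, ⟨x.2, hSd x hx⟩), hx, rfl⟩
    · rintro ⟨x, hx, hw⟩
      refine ⟨(x.1, x.2), hx, ?_⟩
      have : w = WithLp.toLp 2 (F x) := by rw [hw]
      rw [this]
      rfl
  rw [h1, (WithLp.volume_preserving_ofLp ℝ (ModelBase m)).measure_preimage hT.nullMeasurableSet,
    Measure.volume_eq_prod, Measure.prod_apply hT]
  refine lintegral_congr fun r => ?_
  have h2 : Prod.mk r ⁻¹' (F '' {x | (x.1, (x.2 : ∀ q, N q)) ∈ S}) =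
      stretchBase c '' (baseChart θ₀ J '' (Prod.mk r ⁻¹' S)) := by
    ext w
    constructor
    · rintro ⟨⟨r', θ⟩, hx, hw⟩
      obtain ⟨rfl, rfl⟩ := Prod.ext_iff.1 hw
      exact ⟨_, ⟨θ, hx, rfl⟩, rfl⟩
    · rintro ⟨_, ⟨θ, hθ, rfl⟩, rfl⟩
      exact ⟨(r, ⟨θ, hSd _ hθ⟩), hθ, rfl⟩
  rw [h2, volume_image_stretchBase, abs_of_pos (Finset.prod_pos fun q _ => pow_pos (hc q) _)]

end

section

variable {lam : EReal} {p : ℕ} {m : Fin p → ℕ} {N : Fin p → Type*}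
  [∀ q, TopologicalSpace (N q)] [∀ q, ChartedSpace (EuclideanSpace ℝ (Fin (m q))) (N q)]
  [∀ q, IsManifold (𝓡 (m q)) ∞ (N q)]
  {g : ∀ q, SmoothMetric (m q) (N q)} {s : Fin p → ℝ → ℝ}

/-- The slice `{r = 0}` has no volume. -/
theorem riemVolume_slice_zero [SecondCountableTopology (∀ q, N q)]
    (hs : ∀ q, ContinuousOn (s q) (radii lam)) (hs0 : ∀ q, ∀ r ∈ radii lam, 0 ≤ s q r) :
    riemVolume g s (slice lam N 0) = 0 := by
  have hloc : ∀ x₀ : WarpedProduct lam N, ∃ U ∈ 𝓝 x₀, riemVolume g s (slice lam N 0 ∩ U) = 0 := by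
    intro x₀
    obtain ⟨J, hJ⟩ := exists_chartFrames g (mem_chartDomain_self x₀.2)
    let k : Fin p → ℝ := fun q => s q x₀.1 + 1
    obtain ⟨U, hU, h⟩ := exists_nhds_warpedDist_le_edist_warpChart (lam := lam)
      (mem_chartDomain_self x₀.2) hJ hs hs0 (k := k)
      fun q => ⟨by have := hs0 q _ x₀.1.2; positivity, Or.inr (lt_add_one _)⟩
    refine ⟨U, hU, ?_⟩
    have h1 := euclideanHausdorffMeasure_image_le ((∑ q, m q) + 1) 1
      (f := warpChart x₀.2 J k) (h := toMetric g s) (S := slice lam N 0 ∩ U) fun x hx y hy => by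
        rw [ENNReal.coe_one, one_mul]
        exact (h x hx.2).2 y hy.2
    rw [ENNReal.coe_one, one_pow, one_mul, euclideanHausdorffMeasure_modelSpace] at h1
    refine le_antisymm (h1.trans ?_) zero_le
    have h2 : warpChart x₀.2 J k '' (slice lam N 0 ∩ U) ⊆
        WithLp.ofLp ⁻¹' (({0} : Set ℝ) ×ˢ (univ : Set (ModelBase m))) := by
      rintro _ ⟨x, hx, rfl⟩
      exact ⟨hx.1, mem_univ _⟩
    refine (measure_mono h2).trans (le_of_eq ?_)
    rw [(WithLp.volume_preserving_ofLp ℝ (ModelBase m)).measure_preimage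
      ((measurableSet_singleton _).prod MeasurableSet.univ).nullMeasurableSet,
      Measure.volume_eq_prod, Measure.prod_prod, Real.volume_singleton, zero_mul]
  choose U hU h using hloc
  obtain ⟨t, htc, ht⟩ := TopologicalSpace.countable_cover_nhds hU
  have h1 : slice lam N 0 = ⋃ x ∈ t, slice lam N 0 ∩ U x := by
    rw [← inter_iUnion₂, ht, inter_univ]
  rw [riemVolume, h1, image_iUnion₂, measure_biUnion_null_iff htc]
  exact fun x _ => h x

variable [MeasurableSpace (∀ q, N q)]

/-- The Riemannian measure of the base, encoded as the area in the slice `{r = 1}` of the product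
of the base with a half-line. -/
noncomputable def baseMeasure (g : ∀ q, SmoothMetric (m q) (N q)) : Measure (∀ q, N q) :=
  (polarMeasure ⊤ g (fun _ _ => 1) (∑ q, m q)).comap (Prod.mk 1)

variable [BorelSpace (∀ q, N q)] [SecondCountableTopology (∀ q, N q)]
  [∀ q, T2Space (N q)] [∀ q, CompactSpace (N q)]

theorem areaFactor_one (r : ℝ) : areaFactor m (fun _ _ => 1) r = 1 := by simp [areaFactor]

theorem baseMeasure_apply (T : Set (∀ q, N q)) :
    baseMeasure g T = riemArea (lam := ⊤) g (fun _ _ => 1) {x | (x.1 : ℝ) = 1 ∧ x.2 ∈ T} := by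
  rw [baseMeasure, (measurableEmbedding_prodMk_left (1 : ℝ)).comap_apply,
    polarMeasure_apply (fun _ => continuousOn_const) (fun _ _ _ => zero_le_one)
      (fun r _ _ => by rw [areaFactor_one]; exact one_pos), riemArea]
  congr 2
  ext x
  constructor
  · rintro ⟨_, θ, hθ, h⟩
    obtain ⟨h1, h2⟩ := Prod.ext_iff.1 h
    exact ⟨h1.symm, by rw [← polarCoords_snd x, ← h2]; exact hθ⟩
  · rintro ⟨h1, h2⟩
    exact ⟨by rw [h1]; exact one_pos, x.2, h2, Prod.ext h1.symm rfl⟩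

/-- The Riemannian measure of the base is locally comparable to the Lebesgue measure in a chart
adapted to the metric at a point, with factors arbitrarily close to one. -/
theorem exists_nhds_baseMeasure_baseChart {θ₀ θ₁ : ∀ q, N q} (hθ : θ₁ ∈ chartDomain m θ₀)
    {J : ∀ q, EuclideanSpace ℝ (Fin (m q)) ≃L[ℝ] EuclideanSpace ℝ (Fin (m q))}
    (hJ : ∀ q, IsChartFrame (g q) (θ₀ q) (θ₁ q) (J q)) {κ : ℝ≥0} (hκ : 1 < κ) :
    ∃ U ∈ 𝓝 θ₁, U ⊆ chartDomain m θ₀ ∧ ∀ T ⊆ U,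
      baseMeasure g T ≤ κ * volume (baseChart θ₀ J '' T) ∧
      volume (baseChart θ₀ J '' T) ≤ κ * baseMeasure g T := by
  let x₀ : WarpedProduct ⊤ N := (⟨1, zero_le_one, EReal.coe_lt_top 1⟩, θ₁)
  have hA : 0 < areaFactor m (fun _ _ => 1) x₀.1 := by rw [areaFactor_one]; exact one_pos
  obtain ⟨U₁, hU₁, hU₁d, h₁⟩ := exists_nhds_volume_baseChart_le_riemArea (x₀ := x₀) hθ hJ
    (fun _ => continuousOn_const) (fun _ _ _ => zero_le_one) hA hκ
  obtain ⟨U₂, hU₂, -, h₂⟩ := exists_nhds_riemArea_le_volume_baseChart (x₀ := x₀) hθ hJ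
    (fun _ => continuousOn_const) (fun _ _ _ => zero_le_one) hA hκ
  obtain ⟨u, hu, v, hv, hsub⟩ := exists_nhds_prod_subset (inter_mem hU₁ hU₂)
  have hmem : ∀ θ ∈ v, ((x₀.1, θ) : WarpedProduct ⊤ N) ∈ U₁ ∩ U₂ := fun θ hθ =>
    hsub (x₀.1, θ) (mem_of_mem_nhds hu) hθ
  refine ⟨v, hv, fun θ hθ => hU₁d _ (hmem θ hθ).1, fun T hT => ?_⟩
  have hT' : {x : WarpedProduct ⊤ N | (x.1 : ℝ) = 1 ∧ x.2 ∈ T} ⊆ U₁ ∩ U₂ := by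
    rintro x ⟨h1, h2⟩
    refine hsub x ?_ (hT h2)
    rw [h1]
    exact mem_of_mem_nhds hu
  have himg : Prod.snd '' {x : WarpedProduct ⊤ N | (x.1 : ℝ) = 1 ∧ x.2 ∈ T} = T := by
    ext θ
    constructor
    · rintro ⟨x, hx, rfl⟩
      exact hx.2
    · exact fun h => ⟨(x₀.1, θ), ⟨rfl, h⟩, rfl⟩
  have h1 := h₁ _ (hT'.trans inter_subset_left)
  have h2 := h₂ _ (hT'.trans inter_subset_right) fun x hx => hx.1
  rw [areaFactor_one, ENNReal.ofReal_one, one_mul, himg] at h1 h2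
  rw [baseMeasure_apply]
  exact ⟨h2, h1⟩

theorem isFiniteMeasure_baseMeasure (g : ∀ q, SmoothMetric (m q) (N q)) :
    IsFiniteMeasure (baseMeasure g) := by
  have : IsLocallyFiniteMeasure (baseMeasure g) := by
    refine ⟨fun θ₀ => ?_⟩
    obtain ⟨J, hJ⟩ := exists_chartFrames g (mem_chartDomain_self (m := m) θ₀)
    obtain ⟨U, hU, -, h⟩ := exists_nhds_baseMeasure_baseChart (mem_chartDomain_self θ₀) hJ
      (κ := 2) one_lt_two
    have hcont : ContinuousAt (baseChart θ₀ J) θ₀ := (continuousOn_baseChart θ₀ J).continuousAt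
      ((isOpen_chartDomain θ₀).mem_nhds (mem_chartDomain_self θ₀))
    refine ⟨U ∩ baseChart θ₀ J ⁻¹' Metric.ball (baseChart θ₀ J θ₀) 1,
      inter_mem hU (hcont (Metric.ball_mem_nhds _ one_pos)), ?_⟩
    refine ((h _ inter_subset_left).1.trans (mul_le_mul_right
      (measure_mono (image_subset_iff.2 inter_subset_right)) _)).trans_lt ?_
    exact ENNReal.mul_lt_top ENNReal.coe_lt_top measure_ball_lt_top
  infer_instance

theorem baseMeasure_pos_of_mem_nhds (g : ∀ q, SmoothMetric (m q) (N q)) {θ₀ : ∀ q, N q}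
    {T : Set (∀ q, N q)} (hT : T ∈ 𝓝 θ₀) : 0 < baseMeasure g T := by
  obtain ⟨J, hJ⟩ := exists_chartFrames g (mem_chartDomain_self (m := m) θ₀)
  obtain ⟨U, hU, hUd, h⟩ := exists_nhds_baseMeasure_baseChart (mem_chartDomain_self θ₀) hJ
    (κ := 2) one_lt_two
  have h1 : 0 < volume (baseChart θ₀ J '' (T ∩ U)) := by
    refine Measure.measure_pos_of_mem_nhds volume (x := baseChart θ₀ J θ₀) ?_
    have h2 := (isOpenEmbedding_baseChart θ₀ J).image_mem_nhds
      (x := ⟨θ₀, mem_chartDomain_self θ₀⟩) (s := Subtype.val ⁻¹' (T ∩ U))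
    refine mem_of_superset (h2.2 ?_) ?_
    · exact continuousAt_subtype_val.preimage_mem_nhds (inter_mem hT hU)
    · rintro _ ⟨θ, hθ, rfl⟩
      exact ⟨θ, hθ, rfl⟩
  refine pos_iff_ne_zero.2 fun h0 => h1.ne' ?_
  have h3 := (h (T ∩ U) inter_subset_right).2
  rw [measure_mono_null inter_subset_left h0, mul_zero] at h3
  exact le_antisymm h3 zero_le

end

/-! ### Volume and area in polar coordinates -/

section

variable {lam : EReal} {p : ℕ} {m : Fin p → ℕ} {s : Fin p → ℝ → ℝ}

theorem isOpen_setOf_mem_radii_pos (lam : EReal) : IsOpen {r | r ∈ radii lam ∧ 0 < r} := by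
  have h : {r | r ∈ radii lam ∧ 0 < r} = {r : ℝ | (r : EReal) < lam} ∩ Ioi 0 := by
    ext r
    exact ⟨fun h => ⟨h.1.2, h.2⟩, fun h => ⟨⟨h.2.le, h.1⟩, h.2⟩⟩
  rw [h]
  exact (isOpen_lt continuous_coe_real_ereal continuous_const).inter isOpen_Ioi

theorem continuousOn_areaFactor (hs : ∀ q, ContinuousOn (s q) (radii lam)) :
    ContinuousOn (areaFactor m s) (radii lam) :=
  continuousOn_finsetProd _ fun q _ => (hs q).pow _

theorem measurable_indicator_radii {b : ℝ → ℝ} (hb : ContinuousOn b (radii lam)) :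
    Measurable ((radii lam).indicator fun r => ENNReal.ofReal (b r)) := by
  classical
  rw [← piecewise_eq_indicator]
  exact (ENNReal.continuous_ofReal.comp_continuousOn hb).measurable_piecewise continuousOn_const
    (ordConnected_radii lam).measurableSet

/-- The function `A` on `(0, lam)`, extended by zero. -/
noncomputable def radialDensity (lam : EReal) (m : Fin p → ℕ) (s : Fin p → ℝ → ℝ) : ℝ → ℝ≥0∞ :=
  {r | r ∈ radii lam ∧ 0 < r}.indicator fun r => ENNReal.ofReal (areaFactor m s r)

theorem radialDensity_of_pos {r : ℝ} (hr : r ∈ radii lam) (h0 : 0 < r) :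
    radialDensity lam m s r = ENNReal.ofReal (areaFactor m s r) :=
  indicator_of_mem (s := {r | r ∈ radii lam ∧ 0 < r}) ⟨hr, h0⟩ _

theorem radialDensity_of_nonpos {r : ℝ} (h0 : r ≤ 0) : radialDensity lam m s r = 0 :=
  indicator_of_notMem (s := {r | r ∈ radii lam ∧ 0 < r}) (fun h => absurd h.2 (not_lt.2 h0)) _

theorem measurable_radialDensity (hs : ∀ q, ContinuousOn (s q) (radii lam)) :
    Measurable (radialDensity lam m s) := by
  have hm := (isOpen_setOf_mem_radii_pos lam).measurableSet
  have h : ContinuousOn (fun r => ENNReal.ofReal (areaFactor m s r))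
      {r | r ∈ radii lam ∧ 0 < r} :=
    ENNReal.continuous_ofReal.comp_continuousOn
      ((continuousOn_areaFactor hs).mono fun r hr => hr.1)
  classical
  rw [radialDensity, ← piecewise_eq_indicator]
  exact h.measurable_piecewise continuousOn_const hm

theorem eventually_radialDensity (hs : ∀ q, ContinuousOn (s q) (radii lam)) {r₀ : ℝ}
    (hr₀ : r₀ ∈ radii lam) (h0 : 0 < r₀) (hA : 0 < areaFactor m s r₀) {κ : ℝ≥0} (hκ : 1 < κ) :
    ∀ᶠ r in 𝓝 r₀, radialDensity lam m s r ≤ κ * ENNReal.ofReal (areaFactor m s r₀) ∧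
      ENNReal.ofReal (areaFactor m s r₀) ≤ κ * radialDensity lam m s r := by
  have hκ' : (1 : ℝ) < κ := hκ
  have hκ0 : (0 : ℝ) < κ := zero_lt_one.trans hκ'
  have hnhds := (isOpen_setOf_mem_radii_pos lam).mem_nhds (x := r₀) ⟨hr₀, h0⟩
  have hcont : ContinuousAt (areaFactor m s) r₀ :=
    (continuousOn_areaFactor hs).continuousAt (mem_of_superset hnhds fun r hr => hr.1)
  have h1 : areaFactor m s r₀ < κ * areaFactor m s r₀ := lt_mul_of_one_lt_left hA hκ'
  have h2 : (κ : ℝ)⁻¹ * areaFactor m s r₀ < areaFactor m s r₀ :=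
    mul_lt_of_lt_one_left hA (inv_lt_one_of_one_lt₀ hκ')
  filter_upwards [hnhds, hcont.eventually (gt_mem_nhds h1), hcont.eventually (lt_mem_nhds h2)]
    with r hr h3 h4
  rw [radialDensity_of_pos hr.1 hr.2, ← ENNReal.ofReal_coe_nnreal, ← ENNReal.ofReal_mul hκ0.le,
    ← ENNReal.ofReal_mul hκ0.le]
  refine ⟨ENNReal.ofReal_le_ofReal h3.le, ENNReal.ofReal_le_ofReal ?_⟩
  rw [inv_mul_lt_iff₀ hκ0] at h4
  exact h4.le

end

section

variable {lam : EReal} {p : ℕ} {m : Fin p → ℕ} {N : Fin p → Type*}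
  [∀ q, TopologicalSpace (N q)] [∀ q, ChartedSpace (EuclideanSpace ℝ (Fin (m q))) (N q)]
  [∀ q, IsManifold (𝓡 (m q)) ∞ (N q)]
  {g : ∀ q, SmoothMetric (m q) (N q)} {s : Fin p → ℝ → ℝ}
  [MeasurableSpace (∀ q, N q)] [BorelSpace (∀ q, N q)] [SecondCountableTopology (∀ q, N q)]
  [∀ q, T2Space (N q)] [∀ q, CompactSpace (N q)]

theorem polarMeasure_compl_eq_zero (hs : ∀ q, ContinuousOn (s q) (radii lam))
    (hs0 : ∀ q, ∀ r ∈ radii lam, 0 ≤ s q r)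
    (hA : ∀ r ∈ radii lam, 0 < r → 0 < areaFactor m s r) (d : ℕ) :
    polarMeasure lam g s d {x | x.1 ∈ radii lam ∧ 0 < x.1}ᶜ = 0 := by
  rw [polarMeasure_apply hs hs0 hA]
  have h : {x : WarpedProduct lam N | 0 < (x.1 : ℝ) ∧
      polarCoords x ∈ {x : ℝ × ∀ q, N q | x.1 ∈ radii lam ∧ 0 < x.1}ᶜ} = ∅ :=
    eq_empty_of_forall_notMem fun x hx => hx.2 ⟨x.1.2, hx.1⟩
  rw [h, image_empty, measure_empty]

/-- The area in a slice is `A(r)` times the Riemannian measure of the base. -/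
theorem comap_polarMeasure_eq_smul_baseMeasure (hs : ∀ q, ContinuousOn (s q) (radii lam))
    (hs0 : ∀ q, ∀ r ∈ radii lam, 0 ≤ s q r)
    (hA : ∀ r ∈ radii lam, 0 < r → 0 < areaFactor m s r) {c : ℝ} (hc : c ∈ radii lam)
    (hc0 : 0 < c) :
    (polarMeasure lam g s (∑ q, m q)).comap (Prod.mk c) =
      ENNReal.ofReal (areaFactor m s c) • baseMeasure g := by
  have hcomap : ∀ T : Set (∀ q, N q), (polarMeasure lam g s (∑ q, m q)).comap (Prod.mk c) T =
      riemArea g s {x : WarpedProduct lam N | (x.1 : ℝ) = c ∧ x.2 ∈ T} := by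
    intro T
    rw [(measurableEmbedding_prodMk_left c).comap_apply, polarMeasure_apply hs hs0 hA, riemArea]
    congr 2
    ext x
    constructor
    · rintro ⟨_, θ, hθ, h⟩
      obtain ⟨h1, h2⟩ := Prod.ext_iff.1 h
      exact ⟨h1.symm, by rw [← polarCoords_snd x, ← h2]; exact hθ⟩
    · rintro ⟨h1, h2⟩
      exact ⟨by rw [h1]; exact hc0, x.2, h2, Prod.ext h1.symm rfl⟩
  have key : ∀ κ : ℝ≥0, 1 < κ → ∀ θ₀ : ∀ q, N q, ∃ U ∈ 𝓝 θ₀, ∀ T ⊆ U,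
      riemArea g s {x : WarpedProduct lam N | (x.1 : ℝ) = c ∧ x.2 ∈ T} ≤
        κ * (ENNReal.ofReal (areaFactor m s c) * baseMeasure g T) ∧
      ENNReal.ofReal (areaFactor m s c) * baseMeasure g T ≤
        κ * riemArea g s {x : WarpedProduct lam N | (x.1 : ℝ) = c ∧ x.2 ∈ T} := by
    intro κ hκ θ₀
    obtain ⟨κ', hκ', hle⟩ := NNReal.exists_one_lt_pow_le hκ 2
    have hle' : (κ' : ℝ≥0∞) * κ' ≤ κ := by rw [← sq]; exact_mod_cast hle
    obtain ⟨J, hJ⟩ := exists_chartFrames g (mem_chartDomain_self (m := m) θ₀)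
    let x₀ : WarpedProduct lam N := (⟨c, hc⟩, θ₀)
    obtain ⟨U₁, hU₁, -, h₁⟩ := exists_nhds_volume_baseChart_le_riemArea (x₀ := x₀)
      (mem_chartDomain_self θ₀) hJ hs hs0 (hA c hc hc0) hκ'
    obtain ⟨U₂, hU₂, -, h₂⟩ := exists_nhds_riemArea_le_volume_baseChart (x₀ := x₀)
      (mem_chartDomain_self θ₀) hJ hs hs0 (hA c hc hc0) hκ'
    obtain ⟨U₃, hU₃, -, h₃⟩ :=
      exists_nhds_baseMeasure_baseChart (mem_chartDomain_self (m := m) θ₀) hJ hκ'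
    obtain ⟨u, hu, v, hv, hsub⟩ := exists_nhds_prod_subset (inter_mem hU₁ hU₂)
    refine ⟨U₃ ∩ v, inter_mem hU₃ hv, fun T hT => ?_⟩
    have hT' : {x : WarpedProduct lam N | (x.1 : ℝ) = c ∧ x.2 ∈ T} ⊆ U₁ ∩ U₂ := by
      rintro x ⟨h1, h2⟩
      refine hsub x ?_ (hT h2).2
      rw [h1]
      exact mem_of_mem_nhds hu
    have himg : Prod.snd '' {x : WarpedProduct lam N | (x.1 : ℝ) = c ∧ x.2 ∈ T} = T := by
      ext θ
      constructor
      · rintro ⟨x, hx, rfl⟩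
        exact hx.2
      · exact fun h => ⟨(x₀.1, θ), ⟨rfl, h⟩, rfl⟩
    have h1 := h₁ _ (hT'.trans inter_subset_left)
    have h2 := h₂ _ (hT'.trans inter_subset_right) fun x hx => hx.1
    rw [himg] at h1 h2
    have h3 := h₃ T (hT.trans inter_subset_left)
    constructor
    · calc _ ≤ _ := h2
        _ ≤ κ' * (ENNReal.ofReal (areaFactor m s c) * (κ' * baseMeasure g T)) := by
          gcongr
          exact h3.2
        _ = κ' * κ' * (ENNReal.ofReal (areaFactor m s c) * baseMeasure g T) := by ring
        _ ≤ _ := mul_le_mul_left hle' _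
    · calc _ ≤ ENNReal.ofReal (areaFactor m s c) * (κ' * volume (baseChart θ₀ J '' T)) :=
            mul_le_mul_right h3.1 _
        _ = κ' * (ENNReal.ofReal (areaFactor m s c) * volume (baseChart θ₀ J '' T)) := by ring
        _ ≤ κ' * (κ' * riemArea g s {x : WarpedProduct lam N | (x.1 : ℝ) = c ∧ x.2 ∈ T}) := by
          gcongr
        _ = κ' * κ' * riemArea g s {x : WarpedProduct lam N | (x.1 : ℝ) = c ∧ x.2 ∈ T} := by ring
        _ ≤ _ := mul_le_mul_left hle' _
  refine le_antisymm ?_ ?_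
  · refine measure_le_of_locally (O := univ) (by simp) fun κ hκ θ₀ _ => ?_
    obtain ⟨U, hU, h⟩ := key κ hκ θ₀
    refine ⟨U, hU, fun T hT _ => ?_⟩
    rw [hcomap, Measure.smul_apply, smul_eq_mul]
    exact (h T hT).1
  · refine measure_le_of_locally (O := univ) (by simp) fun κ hκ θ₀ _ => ?_
    obtain ⟨U, hU, h⟩ := key κ hκ θ₀
    refine ⟨U, hU, fun T hT _ => ?_⟩
    rw [hcomap, Measure.smul_apply, smul_eq_mul]
    exact (h T hT).2

/-- In polar coordinates the volume is `A(r) dr` times the Riemannian measure of the base. -/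
theorem polarMeasure_eq_prod (hs : ∀ q, ContinuousOn (s q) (radii lam))
    (hs0 : ∀ q, ∀ r ∈ radii lam, 0 ≤ s q r)
    (hA : ∀ r ∈ radii lam, 0 < r → 0 < areaFactor m s r) :
    polarMeasure lam g s ((∑ q, m q) + 1) =
      (volume.withDensity (radialDensity lam m s)).prod (baseMeasure g) := by
  have := isFiniteMeasure_baseMeasure g
  have hD := measurable_radialDensity (m := m) hs
  have hprod : ∀ S : Set (ℝ × ∀ q, N q), MeasurableSet S →
      (volume.withDensity (radialDensity lam m s)).prod (baseMeasure g) S =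
        ∫⁻ r, radialDensity lam m s r * baseMeasure g (Prod.mk r ⁻¹' S) := by
    intro S hS
    rw [Measure.prod_apply hS,
      lintegral_withDensity_eq_lintegral_mul _ hD (measurable_measure_prodMk_left hS)]
    rfl
  have hO : MeasurableSet {x : ℝ × ∀ q, N q | x.1 ∈ radii lam ∧ 0 < x.1}ᶜ :=
    ((isOpen_setOf_mem_radii_pos lam).measurableSet.preimage measurable_fst).compl
  have hprod0 : (volume.withDensity (radialDensity lam m s)).prod (baseMeasure g)
      {x | x.1 ∈ radii lam ∧ 0 < x.1}ᶜ = 0 := by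
    rw [hprod _ hO, lintegral_eq_zero_iff' ?_]
    · refine Eventually.of_forall fun r => ?_
      by_cases hr : r ∈ radii lam ∧ 0 < r
      · have h1 : Prod.mk r ⁻¹' {x : ℝ × ∀ q, N q | x.1 ∈ radii lam ∧ 0 < x.1}ᶜ = ∅ :=
          eq_empty_of_forall_notMem fun θ hθ => hθ hr
        change _ * baseMeasure g _ = 0
        rw [h1, measure_empty, mul_zero]
      · have h1 : radialDensity lam m s r = 0 :=
          indicator_of_notMem (s := {r | r ∈ radii lam ∧ 0 < r}) hr _
        simp [h1]
    · exact (hD.mul (measurable_measure_prodMk_left hO)).aemeasurable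
  have key : ∀ κ : ℝ≥0, 1 < κ → ∀ y ∈ {x : ℝ × ∀ q, N q | x.1 ∈ radii lam ∧ 0 < x.1},
      ∃ U ∈ 𝓝 y, ∀ S ⊆ U, MeasurableSet S →
      polarMeasure lam g s ((∑ q, m q) + 1) S ≤
        κ * (volume.withDensity (radialDensity lam m s)).prod (baseMeasure g) S ∧
      (volume.withDensity (radialDensity lam m s)).prod (baseMeasure g) S ≤
        κ * polarMeasure lam g s ((∑ q, m q) + 1) S := by
    rintro κ hκ ⟨r₀, θ₀⟩ ⟨hr₀, h0⟩
    obtain ⟨κ', hκ', hle⟩ := NNReal.exists_one_lt_pow_le hκ 3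
    have hle' : (κ' : ℝ≥0∞) * (κ' * κ') ≤ κ := by
      have : (κ' : ℝ≥0∞) ^ 3 ≤ κ := by exact_mod_cast hle
      rwa [pow_succ', sq] at this
    obtain ⟨J, hJ⟩ := exists_chartFrames g (mem_chartDomain_self (m := m) θ₀)
    let x₀ : WarpedProduct lam N := (⟨r₀, hr₀⟩, θ₀)
    have hA₀ := hA r₀ hr₀ h0
    have hc0 : ∀ q, 0 < warpFactor m s r₀ q := warpFactor_pos (fun q => hs0 q _ hr₀) hA₀
    obtain ⟨U₁, hU₁, hU₁d, h₁⟩ := exists_nhds_hausdorffMeasure_warpChart (x₀ := x₀)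
      (mem_chartDomain_self θ₀) hJ hs hs0 hA₀ ((∑ q, m q) + 1) hκ'
    obtain ⟨U₂, hU₂, hU₂d, h₂⟩ :=
      exists_nhds_baseMeasure_baseChart (mem_chartDomain_self (m := m) θ₀) hJ hκ'
    obtain ⟨u, hu, v, hv, hsub⟩ := exists_nhds_prod_subset hU₁
    have hev := eventually_radialDensity hs hr₀ h0 hA₀ hκ'
    have hu' := inter_mem hu (inter_mem hev ((isOpen_setOf_mem_radii_pos lam).mem_nhds ⟨hr₀, h0⟩))
    refine ⟨_, prod_mem_nhds hu' (inter_mem hv hU₂), fun S hS hSm => ?_⟩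
    have himg : warpChart θ₀ J (warpFactor m s r₀) ''
        {x : WarpedProduct lam N | 0 < (x.1 : ℝ) ∧ polarCoords x ∈ S} =
        (fun x : ℝ × ∀ q, N q => (WithLp.toLp 2 (x.1, stretchBase (warpFactor m s r₀)
          (baseChart θ₀ J x.2)) : ModelSpace m)) '' S := by
      ext w
      constructor
      · rintro ⟨x, hx, rfl⟩
        exact ⟨_, hx.2, rfl⟩
      · rintro ⟨x, hx, rfl⟩
        have hx' := (hS hx).1.2.2
        exact ⟨(⟨x.1, hx'.1⟩, x.2), ⟨hx'.2, hx⟩, rfl⟩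
    have h3 := h₁ {x : WarpedProduct lam N | 0 < (x.1 : ℝ) ∧ polarCoords x ∈ S} fun x hx =>
      hsub x (hS hx.2).1.1 (hS hx.2).2.1
    rw [euclideanHausdorffMeasure_modelSpace, himg, volume_image_warpChart θ₀ J hc0 hSm
      fun x hx => hU₂d (hS hx).2.2, prod_warpFactor_pow, ← polarMeasure_apply hs hs0 hA] at h3
    have hsec : ∀ r, Prod.mk r ⁻¹' S ⊆ U₂ := fun r θ hθ => (hS hθ).2.2
    -- the densities of the two measures are comparable on each vertical section
    have hle1 : ∫⁻ r, ENNReal.ofReal (areaFactor m s r₀) *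
          volume (baseChart θ₀ J '' (Prod.mk r ⁻¹' S)) ≤
        κ' * κ' * ∫⁻ r, radialDensity lam m s r * baseMeasure g (Prod.mk r ⁻¹' S) := by
      rw [← lintegral_const_mul' _ _ (by finiteness)]
      refine lintegral_mono fun r => ?_
      rcases (Prod.mk r ⁻¹' S).eq_empty_or_nonempty with he | ⟨θ, hθ⟩
      · simp [he]
      · have h4 := (hS hθ).1.2.1.2
        have h5 := (h₂ _ (hsec r)).2
        calc _ ≤ κ' * radialDensity lam m s r * (κ' * baseMeasure g (Prod.mk r ⁻¹' S)) :=
              mul_le_mul' h4 h5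
          _ = _ := by ring
    have hle2 : ∫⁻ r, radialDensity lam m s r * baseMeasure g (Prod.mk r ⁻¹' S) ≤
        κ' * κ' * ∫⁻ r, ENNReal.ofReal (areaFactor m s r₀) *
          volume (baseChart θ₀ J '' (Prod.mk r ⁻¹' S)) := by
      rw [← lintegral_const_mul' _ _ (by finiteness)]
      refine lintegral_mono fun r => ?_
      rcases (Prod.mk r ⁻¹' S).eq_empty_or_nonempty with he | ⟨θ, hθ⟩
      · simp [he]
      · have h4 := (hS hθ).1.2.1.1
        have h5 := (h₂ _ (hsec r)).1
        calc _ ≤ κ' * ENNReal.ofReal (areaFactor m s r₀) *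
              (κ' * volume (baseChart θ₀ J '' (Prod.mk r ⁻¹' S))) := mul_le_mul' h4 h5
          _ = _ := by ring
    rw [hprod S hSm]
    constructor
    · calc _ ≤ _ := h3.1
        _ ≤ κ' * (κ' * κ' * ∫⁻ r, radialDensity lam m s r * baseMeasure g (Prod.mk r ⁻¹' S)) := by
          gcongr
        _ = κ' * (κ' * κ') * ∫⁻ r, radialDensity lam m s r * baseMeasure g (Prod.mk r ⁻¹' S) := by
          ring
        _ ≤ _ := mul_le_mul_left hle' _
    · calc _ ≤ _ := hle2
        _ ≤ κ' * κ' * (κ' * polarMeasure lam g s ((∑ q, m q) + 1) S) := by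
          gcongr
          exact h3.2
        _ = κ' * (κ' * κ') * polarMeasure lam g s ((∑ q, m q) + 1) S := by ring
        _ ≤ _ := mul_le_mul_left hle' _
  refine le_antisymm ?_ ?_
  · refine measure_le_of_locally (polarMeasure_compl_eq_zero hs hs0 hA _) fun κ hκ y hy => ?_
    obtain ⟨U, hU, h⟩ := key κ hκ y hy
    exact ⟨U, hU, fun S hS hSm => (h S hS hSm).1⟩
  · refine measure_le_of_locally hprod0 fun κ hκ y hy => ?_
    obtain ⟨U, hU, h⟩ := key κ hκ y hy
    exact ⟨U, hU, fun S hS hSm => (h S hS hSm).2⟩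

/-- The area of a radial graph is at least the integral of `A` over the base: the radial projection
decreases areas. -/
theorem map_withDensity_le_polarMeasure (hs : ∀ q, ContinuousOn (s q) (radii lam))
    (hs0 : ∀ q, ∀ r ∈ radii lam, 0 ≤ s q r)
    (hA : ∀ r ∈ radii lam, 0 < r → 0 < areaFactor m s r) {ρ : (∀ q, N q) → ℝ}
    (hρ : Measurable ρ) :
    ((baseMeasure g).withDensity fun θ => radialDensity lam m s (ρ θ)).map (fun θ => (ρ θ, θ)) ≤
      polarMeasure lam g s (∑ q, m q) := by
  have hD := measurable_radialDensity (m := m) hs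
  have hG : Measurable fun θ => (ρ θ, θ) := hρ.prodMk measurable_id
  have hτ : ∀ S : Set (ℝ × ∀ q, N q), MeasurableSet S →
      ((baseMeasure g).withDensity fun θ => radialDensity lam m s (ρ θ)).map (fun θ => (ρ θ, θ)) S =
        ∫⁻ θ in (fun θ => (ρ θ, θ)) ⁻¹' S, radialDensity lam m s (ρ θ) ∂(baseMeasure g) := by
    intro S hS
    rw [Measure.map_apply hG hS, withDensity_apply _ (hG hS)]
  have hO : MeasurableSet {x : ℝ × ∀ q, N q | x.1 ∈ radii lam ∧ 0 < x.1}ᶜ :=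
    ((isOpen_setOf_mem_radii_pos lam).measurableSet.preimage measurable_fst).compl
  refine measure_le_of_locally (O := {x | x.1 ∈ radii lam ∧ 0 < x.1}) ?_ ?_
  · rw [hτ _ hO]
    refine setLIntegral_eq_zero (hG hO) fun θ hθ => ?_
    exact indicator_of_notMem (s := {r | r ∈ radii lam ∧ 0 < r}) hθ _
  · rintro κ hκ ⟨r₀, θ₀⟩ ⟨hr₀, h0⟩
    obtain ⟨κ', hκ', hle⟩ := NNReal.exists_one_lt_pow_le hκ 3
    have hle' : (κ' : ℝ≥0∞) * κ' * κ' ≤ κ := by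
      have : (κ' : ℝ≥0∞) ^ 3 ≤ κ := by exact_mod_cast hle
      rwa [pow_succ, sq] at this
    obtain ⟨J, hJ⟩ := exists_chartFrames g (mem_chartDomain_self (m := m) θ₀)
    let x₀ : WarpedProduct lam N := (⟨r₀, hr₀⟩, θ₀)
    have hA₀ := hA r₀ hr₀ h0
    obtain ⟨U₁, hU₁, hU₁d, h₁⟩ := exists_nhds_volume_baseChart_le_riemArea (x₀ := x₀)
      (mem_chartDomain_self θ₀) hJ hs hs0 hA₀ hκ'
    obtain ⟨U₂, hU₂, hU₂d, h₂⟩ :=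
      exists_nhds_baseMeasure_baseChart (mem_chartDomain_self (m := m) θ₀) hJ hκ'
    obtain ⟨u, hu, v, hv, hsub⟩ := exists_nhds_prod_subset hU₁
    have hev := eventually_radialDensity hs hr₀ h0 hA₀ hκ'
    have hu' := inter_mem hu (inter_mem hev ((isOpen_setOf_mem_radii_pos lam).mem_nhds ⟨hr₀, h0⟩))
    refine ⟨_, prod_mem_nhds hu' (inter_mem hv hU₂), fun S hS hSm => ?_⟩
    have h3 := h₁ {x : WarpedProduct lam N | 0 < (x.1 : ℝ) ∧ polarCoords x ∈ S} fun x hx =>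
      hsub x (hS hx.2).1.1 (hS hx.2).2.1
    rw [riemArea, ← polarMeasure_apply hs hs0 hA] at h3
    have hsubset : (fun θ => (ρ θ, θ)) ⁻¹' S ⊆
        Prod.snd '' {x : WarpedProduct lam N | 0 < (x.1 : ℝ) ∧ polarCoords x ∈ S} := by
      intro θ hθ
      have hx' := (hS hθ).1.2.2
      exact ⟨(⟨ρ θ, hx'.1⟩, θ), ⟨hx'.2, hθ⟩, rfl⟩
    rw [hτ S hSm]
    calc _ ≤ ∫⁻ _ in (fun θ => (ρ θ, θ)) ⁻¹' S, κ' * ENNReal.ofReal (areaFactor m s r₀)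
            ∂(baseMeasure g) := setLIntegral_mono' (hG hSm) fun θ hθ => (hS hθ).1.2.1.1
      _ = κ' * ENNReal.ofReal (areaFactor m s r₀) *
            baseMeasure g ((fun θ => (ρ θ, θ)) ⁻¹' S) := setLIntegral_const _ _
      _ ≤ κ' * ENNReal.ofReal (areaFactor m s r₀) * (κ' * volume (baseChart θ₀ J ''
            (Prod.snd '' {x : WarpedProduct lam N | 0 < (x.1 : ℝ) ∧ polarCoords x ∈ S}))) := by
          gcongr
          exact (h₂ _ fun θ hθ => (hS hθ).2.2).1.trans
            (mul_le_mul_right (measure_mono (image_mono hsubset)) _)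
      _ = κ' * κ' * (ENNReal.ofReal (areaFactor m s r₀) * volume (baseChart θ₀ J ''
            (Prod.snd '' {x : WarpedProduct lam N | 0 < (x.1 : ℝ) ∧ polarCoords x ∈ S}))) := by
          ring
      _ ≤ κ' * κ' * (κ' * polarMeasure lam g s (∑ q, m q) S) := by
          gcongr
      _ = κ' * κ' * κ' * polarMeasure lam g s (∑ q, m q) S := by ring
      _ ≤ _ := mul_le_mul_left hle' _

end

/-! ### Balls and slices -/

section

variable {lam : EReal} {p : ℕ} {m : Fin p → ℕ} {s : Fin p → ℝ → ℝ}

theorem Icc_subset_radii {r : ℝ} (hr : r ∈ radii lam) : Icc 0 r ⊆ radii lam := fun _ ht =>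
  ⟨ht.1, (EReal.coe_le_coe_iff.2 ht.2).trans_lt hr.2⟩

theorem zero_mem_radii {r : ℝ} (hr : r ∈ radii lam) : (0 : ℝ) ∈ radii lam :=
  Icc_subset_radii hr ⟨le_rfl, hr.1⟩

theorem exists_gt_mem_radii {r : ℝ} (hr : r ∈ radii lam) : ∃ r' ∈ radii lam, r < r' := by
  obtain ⟨r', h1, h2⟩ := EReal.lt_iff_exists_real_btwn.1 hr.2
  have h3 := EReal.coe_lt_coe_iff.1 h1
  exact ⟨r', ⟨hr.1.trans h3.le, h2⟩, h3⟩

/-- The volume of the ball of radius `r` per unit of volume of the base. -/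
noncomputable def radialVolume (m : Fin p → ℕ) (s : Fin p → ℝ → ℝ) (r : ℝ) : ℝ :=
  ∫ t in (0 : ℝ)..r, areaFactor m s t

theorem intervalIntegrable_areaFactor (hs : ∀ q, ContinuousOn (s q) (radii lam)) {r r' : ℝ}
    (hr : r ∈ radii lam) (hr' : r' ∈ radii lam) :
    IntervalIntegrable (areaFactor m s) volume r r' :=
  ((continuousOn_areaFactor hs).mono
    ((ordConnected_radii lam).uIcc_subset hr hr')).intervalIntegrable

theorem radialVolume_zero : radialVolume m s 0 = 0 := intervalIntegral.integral_same

theorem strictMonoOn_radialVolume (hs : ∀ q, ContinuousOn (s q) (radii lam))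
    (hA : ∀ r ∈ radii lam, 0 < r → 0 < areaFactor m s r) :
    StrictMonoOn (radialVolume m s) (radii lam) := by
  intro r hr r' hr' hlt
  have h0 := zero_mem_radii hr
  rw [← sub_pos, radialVolume, radialVolume, intervalIntegral.integral_interval_sub_left
    (intervalIntegrable_areaFactor hs h0 hr') (intervalIntegrable_areaFactor hs h0 hr)]
  refine intervalIntegral.intervalIntegral_pos_of_pos_on
    (intervalIntegrable_areaFactor hs hr hr') (fun t ht => ?_) hlt
  exact hA t ((ordConnected_radii lam).out hr hr' ⟨ht.1.le, ht.2.le⟩) (hr.1.trans_lt ht.1)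

theorem radialVolume_nonneg (hs : ∀ q, ContinuousOn (s q) (radii lam))
    (hA : ∀ r ∈ radii lam, 0 < r → 0 < areaFactor m s r) {r : ℝ} (hr : r ∈ radii lam) :
    0 ≤ radialVolume m s r := by
  rw [← radialVolume_zero (m := m) (s := s)]
  exact (strictMonoOn_radialVolume hs hA).monotoneOn (zero_mem_radii hr) hr hr.1

theorem continuousOn_radialVolume (hs : ∀ q, ContinuousOn (s q) (radii lam)) {r : ℝ}
    (hr : r ∈ radii lam) : ContinuousOn (radialVolume m s) (Icc 0 r) := by
  rw [← uIcc_of_le hr.1]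
  exact intervalIntegral.continuousOn_primitive_interval'
    (intervalIntegrable_areaFactor hs (zero_mem_radii hr) hr) left_mem_uIcc

theorem withDensity_radialDensity_Iio (hs : ∀ q, ContinuousOn (s q) (radii lam))
    (hA : ∀ r ∈ radii lam, 0 < r → 0 < areaFactor m s r) {r : ℝ} (hr : r ∈ radii lam) :
    (volume.withDensity (radialDensity lam m s)) (Iio r) =
      ENNReal.ofReal (radialVolume m s r) := by
  rw [withDensity_apply _ measurableSet_Iio, radialDensity,
    setLIntegral_indicator (isOpen_setOf_mem_radii_pos lam).measurableSet]
  have h1 : {r | r ∈ radii lam ∧ 0 < r} ∩ Iio r = Ioo 0 r := by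
    ext t
    exact ⟨fun h => ⟨h.1.2, h.2⟩, fun h =>
      ⟨⟨Icc_subset_radii hr ⟨h.1.le, h.2.le⟩, h.1⟩, h.2⟩⟩
  rw [h1, setLIntegral_congr Ioo_ae_eq_Ioc, radialVolume, intervalIntegral.integral_of_le hr.1,
    ofReal_integral_eq_lintegral_ofReal
      (intervalIntegrable_areaFactor hs (zero_mem_radii hr) hr).1]
  refine (ae_restrict_iff' measurableSet_Ioc).2 (Eventually.of_forall fun t ht => ?_)
  exact (hA t (Icc_subset_radii hr ⟨ht.1.le, ht.2⟩) ht.1).le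

end

section

variable {lam : EReal} {p : ℕ} {N : Fin p → Type*} [∀ q, TopologicalSpace (N q)]

theorem isOpen_radialBall (r : ℝ) : IsOpen (radialBall lam N r) :=
  isOpen_lt (continuous_subtype_val.comp continuous_fst) continuous_const

theorem closure_radialBall {r : ℝ} (hr : 0 < r) :
    closure (radialBall lam N r) = {x | (x.1 : ℝ) ≤ r} := by
  refine Subset.antisymm (closure_minimal (fun x (hx : (x.1 : ℝ) < r) => hx.le)
    (isClosed_le (continuous_subtype_val.comp continuous_fst) continuous_const)) fun x hx => ?_
  rcases lt_or_eq_of_le (show (x.1 : ℝ) ≤ r from hx) with h | h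
  · exact subset_closure h
  refine mem_closure_iff_nhds.2 fun U hU => ?_
  obtain ⟨u, hu, v, hv, hsub⟩ := exists_nhds_prod_subset hU
  have h1 : u ∩ Ioo 0 r ∈ 𝓝[<] r := inter_mem (mem_nhdsWithin_of_mem_nhds (by rwa [← h]))
    (Ioo_mem_nhdsLT hr)
  obtain ⟨t, ht, ht'⟩ := Filter.nonempty_of_mem h1
  refine ⟨(⟨t, Icc_subset_radii x.1.2 ⟨ht'.1.le, by rw [h]; exact ht'.2.le⟩⟩, x.2), ?_, ht'.2⟩
  exact hsub _ ht (mem_of_mem_nhds hv)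

theorem frontier_radialBall {r : ℝ} (hr : 0 < r) :
    frontier (radialBall lam N r) = slice lam N r := by
  rw [(isOpen_radialBall r).frontier_eq, closure_radialBall hr]
  ext x
  exact ⟨fun h => le_antisymm h.1 (not_lt.1 h.2), fun h => ⟨h.le, h.not_lt⟩⟩

end

section

variable {lam : EReal} {p : ℕ} {m : Fin p → ℕ} {N : Fin p → Type*}
  [∀ q, TopologicalSpace (N q)] [∀ q, ChartedSpace (EuclideanSpace ℝ (Fin (m q))) (N q)]
  [∀ q, IsManifold (𝓡 (m q)) ∞ (N q)]
  {g : ∀ q, SmoothMetric (m q) (N q)} {s : Fin p → ℝ → ℝ}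

/-- The integral of a sum of a constant and a function. -/
theorem areaIntegral_eq_add {a : ℝ → ℝ} {a₀ : ℝ} (ha₀ : 0 ≤ a₀) (ha : ∀ r ∈ radii lam, a₀ ≤ a r)
    (S : Set (WarpedProduct lam N)) :
    areaIntegral g s a S =
      ENNReal.ofReal a₀ * riemArea g s S + areaIntegral g s (fun r => a r - a₀) S := by
  rw [areaIntegral, areaIntegral, riemArea, ← setLIntegral_const,
    ← lintegral_add_left measurable_const]
  refine lintegral_congr fun z => ?_
  obtain ⟨x, rfl⟩ := surjective_toMetric z
  rw [radius_toMetric, ← ENNReal.ofReal_add ha₀ (sub_nonneg.2 (ha _ x.1.2)), add_sub_cancel]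

variable [MeasurableSpace (∀ q, N q)] [BorelSpace (∀ q, N q)]
  [SecondCountableTopology (∀ q, N q)] [∀ q, T2Space (N q)] [∀ q, CompactSpace (N q)]

theorem riemVolume_eq_polarMeasure (hs : ∀ q, ContinuousOn (s q) (radii lam))
    (hs0 : ∀ q, ∀ r ∈ radii lam, 0 ≤ s q r)
    (hA : ∀ r ∈ radii lam, 0 < r → 0 < areaFactor m s r) (S : Set (WarpedProduct lam N)) :
    riemVolume g s S = polarMeasure lam g s ((∑ q, m q) + 1) (polarCoords '' S) := by
  rw [polarMeasure_apply hs hs0 hA]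
  refine le_antisymm ?_ (measure_mono (image_mono fun x hx => ?_))
  · have h : S ⊆ {x | 0 < (x.1 : ℝ) ∧ polarCoords x ∈ polarCoords '' S} ∪ slice lam N 0 := by
      intro x hx
      rcases x.1.2.1.lt_or_eq with h | h
      · exact Or.inl ⟨h, x, hx, rfl⟩
      · exact Or.inr h.symm
    refine (measure_mono (image_mono h)).trans ?_
    rw [image_union]
    refine (measure_union_le _ _).trans ?_
    have h0 := riemVolume_slice_zero (g := g) hs hs0
    rw [riemVolume] at h0
    rw [h0, add_zero]
  · obtain ⟨y, hy, hxy⟩ := hx.2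
    rwa [← injective_polarCoords hxy]

/-- The integral over a hypersurface of a radial function that vanishes at `r = 0`, in polar
coordinates. The part of the hypersurface in the slice `{r = 0}`, whose area is not seen by polar
coordinates, does not contribute. -/
theorem areaIntegral_eq_setLIntegral_polarMeasure (hs : ∀ q, ContinuousOn (s q) (radii lam))
    (hs0 : ∀ q, ∀ r ∈ radii lam, 0 ≤ s q r)
    (hA : ∀ r ∈ radii lam, 0 < r → 0 < areaFactor m s r) {f : ℝ → ℝ} (hf : f 0 = 0)
    {S : Set (WarpedProduct lam N)} :
    areaIntegral g s f S =
      ∫⁻ x in polarCoords '' S, ENNReal.ofReal (f x.1) ∂(polarMeasure lam g s (∑ q, m q)) := by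
  have he := (isOpenEmbedding_interiorMap (g := g) hs hs0 hA).measurableEmbedding
  have hp : MeasurableEmbedding
      (polarCoords ∘ Subtype.val : {x : WarpedProduct lam N // 0 < (x.1 : ℝ)} → _) :=
    measurableEmbedding_polarCoords.comp
      (MeasurableEmbedding.subtype_coe measurableSet_setOf_radius_pos)
  have hY : MeasurableSet {z : WarpedMetricSpace lam g s | 0 < radius g s z} :=
    (isOpen_lt continuous_const continuous_radius).measurableSet
  -- only the part in the interior contributes
  rw [areaIntegral, ← lintegral_inter_add_sdiff _ _ hY]
  have h0 : ∫⁻ z in toMetric g s '' S \ {z | 0 < radius g s z}, ENNReal.ofReal (f (radius g s z))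
      ∂(μHE[∑ q, m q] : Measure (WarpedMetricSpace lam g s)) = 0 := by
    refine le_antisymm ((lintegral_mono' (Measure.restrict_mono (fun z hz => hz.2) le_rfl)
      le_rfl).trans (le_of_eq ?_)) zero_le
    refine setLIntegral_eq_zero hY.compl fun z hz => ?_
    obtain ⟨x, rfl⟩ := surjective_toMetric z
    have h1 : (x.1 : ℝ) = 0 := le_antisymm (not_lt.1 hz) x.1.2.1
    rw [radius_toMetric, h1, hf]
    exact ENNReal.ofReal_zero
  rw [h0, add_zero, polarMeasure, hp.restrict_map, hp.lintegral_map]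
  have h2 : polarCoords ∘ Subtype.val ⁻¹' (polarCoords '' S) =
      (interiorMap lam g s) ⁻¹' (toMetric g s '' S) := by
    ext x
    constructor
    · rintro ⟨y, hy, hxy⟩
      rw [injective_polarCoords hxy] at hy
      exact ⟨x.1, hy, rfl⟩
    · rintro ⟨y, hy, hxy⟩
      have h3 : 0 < (y.1 : ℝ) := by
        rw [← radius_toMetric g s y, hxy]
        exact x.2
      have h4 : (⟨y, h3⟩ : {x : WarpedProduct lam N // 0 < (x.1 : ℝ)}) = x := he.injective hxy
      exact ⟨y, hy, by rw [← h4]; rfl⟩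
  rw [h2, ← range_interiorMap, ← Measure.restrict_restrict' he.measurableSet_range,
    ← he.map_comap, he.restrict_map, he.lintegral_map]
  rfl

theorem riemVolume_radialBall (hs : ∀ q, ContinuousOn (s q) (radii lam))
    (hs0 : ∀ q, ∀ r ∈ radii lam, 0 ≤ s q r)
    (hA : ∀ r ∈ radii lam, 0 < r → 0 < areaFactor m s r) {r : ℝ} (hr : r ∈ radii lam) :
    riemVolume g s (radialBall lam N r) =
      ENNReal.ofReal (radialVolume m s r) * baseMeasure g univ := by
  have := isFiniteMeasure_baseMeasure g
  have h1 : polarCoords '' radialBall lam N r = (Iio r ∩ radii lam) ×ˢ univ := by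
    ext x
    constructor
    · rintro ⟨y, hy, rfl⟩
      exact ⟨⟨hy, y.1.2⟩, mem_univ _⟩
    · rintro ⟨hx, -⟩
      exact ⟨(⟨x.1, hx.2⟩, x.2), hx.1, rfl⟩
  rw [riemVolume_eq_polarMeasure hs hs0 hA, polarMeasure_eq_prod hs hs0 hA, h1, Measure.prod_prod,
    ← withDensity_radialDensity_Iio hs hA hr]
  congr 1
  refine le_antisymm (measure_mono inter_subset_left) ?_
  rw [← measure_inter_add_sdiff (Iio r) (ordConnected_radii lam).measurableSet]
  refine (add_le_add le_rfl (le_of_eq ?_)).trans (add_zero _).le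
  rw [withDensity_apply _ (measurableSet_Iio.diff (ordConnected_radii lam).measurableSet)]
  refine setLIntegral_eq_zero (measurableSet_Iio.diff (ordConnected_radii lam).measurableSet)
    fun t ht => ?_
  exact indicator_of_notMem (s := {r | r ∈ radii lam ∧ 0 < r}) (fun h => ht.2 h.1) _

theorem ballVolume_eq (hs : ∀ q, ContinuousOn (s q) (radii lam))
    (hs0 : ∀ q, ∀ r ∈ radii lam, 0 ≤ s q r)
    (hA : ∀ r ∈ radii lam, 0 < r → 0 < areaFactor m s r) {r : ℝ} (hr : r ∈ radii lam) :
    ballVolume lam g s r = radialVolume m s r * (baseMeasure g).real univ := by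
  rw [ballVolume, riemVolume_radialBall hs hs0 hA hr, ENNReal.toReal_mul,
    ENNReal.toReal_ofReal (radialVolume_nonneg hs hA hr)]
  rfl

theorem areaIntegral_slice (hs : ∀ q, ContinuousOn (s q) (radii lam))
    (hs0 : ∀ q, ∀ r ∈ radii lam, 0 ≤ s q r)
    (hA : ∀ r ∈ radii lam, 0 < r → 0 < areaFactor m s r) {f : ℝ → ℝ} (hf : f 0 = 0)
    {r : ℝ} (hr : r ∈ radii lam) (h0 : 0 < r) :
    areaIntegral g s f (slice lam N r) =
      ENNReal.ofReal (f r) * (ENNReal.ofReal (areaFactor m s r) * baseMeasure g univ) := by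
  have h1 : polarCoords '' slice lam N r = Prod.mk r '' univ := by
    ext x
    constructor
    · rintro ⟨y, hy, rfl⟩
      exact ⟨y.2, mem_univ _, Prod.ext (Eq.symm hy) rfl⟩
    · rintro ⟨θ, -, rfl⟩
      exact ⟨(⟨r, hr⟩, θ), rfl, rfl⟩
  have hE := measurableEmbedding_prodMk_left (β := ∀ q, N q) r
  rw [areaIntegral_eq_setLIntegral_polarMeasure hs hs0 hA hf, h1,
    setLIntegral_congr_fun (g := fun _ => ENNReal.ofReal (f r))
      (hE.measurableSet_image' MeasurableSet.univ), setLIntegral_const,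
    ← hE.comap_apply, comap_polarMeasure_eq_smul_baseMeasure hs hs0 hA hr h0]
  · rfl
  · rintro _ ⟨θ, -, rfl⟩
    rfl

theorem riemArea_slice (hs : ∀ q, ContinuousOn (s q) (radii lam))
    (hs0 : ∀ q, ∀ r ∈ radii lam, 0 ≤ s q r)
    (hA : ∀ r ∈ radii lam, 0 < r → 0 < areaFactor m s r) {r : ℝ} (hr : r ∈ radii lam)
    (h0 : 0 < r) :
    riemArea g s (slice lam N r) = ENNReal.ofReal (areaFactor m s r) * baseMeasure g univ := by
  have h1 := congrArg (fun μ : Measure (∀ q, N q) => μ univ)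
    (comap_polarMeasure_eq_smul_baseMeasure (g := g) hs hs0 hA hr h0)
  simp only [(measurableEmbedding_prodMk_left (β := ∀ q, N q) r).comap_apply] at h1
  rw [polarMeasure_apply hs hs0 hA] at h1
  rw [riemArea]
  refine Eq.trans ?_ h1
  congr 2
  ext x
  constructor
  · intro hx
    exact ⟨by rw [show (x.1 : ℝ) = r from hx]; exact h0, x.2, mem_univ _, Prod.ext (Eq.symm hx) rfl⟩
  · rintro ⟨-, θ, -, h⟩
    exact (Prod.ext_iff.1 h).1.symm

end

/-! ### The outer radial graph -/

section

variable {lam : EReal} {p : ℕ} {N : Fin p → Type*}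

/-- The supremum of the radii of the points of `Ω` above the point `θ` of the base, and `0` if there
are none. -/
noncomputable def radialSup (Ω : Set (WarpedProduct lam N)) (θ : ∀ q, N q) : ℝ :=
  sSup (insert 0 {r | ∃ x ∈ Ω, (x.1 : ℝ) = r ∧ x.2 = θ})

variable [∀ q, TopologicalSpace (N q)] {Ω : Set (WarpedProduct lam N)}

theorem exists_radius_bound (hΩ : Ω.Nonempty) (hΩc : IsCompact (closure Ω)) :
    ∃ r ∈ radii lam, ∀ x ∈ Ω, (x.1 : ℝ) ≤ r := by
  obtain ⟨x₀, -, h⟩ := hΩc.exists_isMaxOn hΩ.closure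
    (continuous_subtype_val.comp continuous_fst : Continuous fun x : WarpedProduct lam N =>
      (x.1 : ℝ)).continuousOn
  exact ⟨x₀.1, x₀.1.2, fun x hx => h (subset_closure hx)⟩

theorem radialSup_mem_radii (hΩ : Ω.Nonempty) (hΩc : IsCompact (closure Ω)) (θ : ∀ q, N q) :
    radialSup Ω θ ∈ radii lam := by
  obtain ⟨r, hr, h⟩ := exists_radius_bound hΩ hΩc
  have hle : ∀ t ∈ insert 0 {r | ∃ x ∈ Ω, (x.1 : ℝ) = r ∧ x.2 = θ}, t ≤ r := by
    rintro t (rfl | ⟨x, hx, rfl, -⟩)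
    · exact hr.1
    · exact h x hx
  exact Icc_subset_radii hr ⟨le_csSup ⟨r, hle⟩ (mem_insert _ _),
    csSup_le (insert_nonempty _ _) hle⟩

theorem lt_radialSup_iff (hΩ : Ω.Nonempty) (hΩc : IsCompact (closure Ω)) {θ : ∀ q, N q} {c : ℝ}
    (hc : 0 ≤ c) : c < radialSup Ω θ ↔ ∃ x ∈ Ω, c < (x.1 : ℝ) ∧ x.2 = θ := by
  obtain ⟨r, hr, h⟩ := exists_radius_bound hΩ hΩc
  have hle : ∀ t ∈ insert 0 {r | ∃ x ∈ Ω, (x.1 : ℝ) = r ∧ x.2 = θ}, t ≤ r := by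
    rintro t (rfl | ⟨x, hx, rfl, -⟩)
    · exact hr.1
    · exact h x hx
  rw [radialSup, lt_csSup_iff ⟨r, hle⟩ (insert_nonempty _ _)]
  constructor
  · rintro ⟨t, rfl | ⟨x, hx, rfl, hθ⟩, ht⟩
    · exact absurd ht (not_lt.2 hc)
    · exact ⟨x, hx, ht, hθ⟩
  · rintro ⟨x, hx, hlt, hθ⟩
    exact ⟨x.1, Or.inr ⟨x, hx, rfl, hθ⟩, hlt⟩

theorem measurable_radialSup [MeasurableSpace (∀ q, N q)] [BorelSpace (∀ q, N q)]
    (hΩ : Ω.Nonempty) (hΩo : IsOpen Ω) (hΩc : IsCompact (closure Ω)) :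
    Measurable (radialSup Ω) := by
  refine measurable_of_Ioi fun c => IsOpen.measurableSet ?_
  rcases lt_or_ge c 0 with hc | hc
  · have h : radialSup Ω ⁻¹' Ioi c = univ :=
      eq_univ_of_forall fun θ => hc.trans_le (radialSup_mem_radii hΩ hΩc θ).1
    rw [h]
    exact isOpen_univ
  · have h : radialSup Ω ⁻¹' Ioi c = Prod.snd '' (Ω ∩ {x | c < (x.1 : ℝ)}) := by
      ext θ
      rw [mem_preimage, mem_Ioi, lt_radialSup_iff hΩ hΩc hc]
      exact ⟨fun ⟨x, h1, h2, h3⟩ => ⟨x, ⟨h1, h2⟩, h3⟩, fun ⟨x, ⟨h1, h2⟩, h3⟩ => ⟨x, h1, h2, h3⟩⟩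
    rw [h]
    exact isOpenMap_snd _ (hΩo.inter
      (isOpen_lt continuous_const (continuous_subtype_val.comp continuous_fst)))

/-- A point of an open set of the warped product can be moved outwards. -/
theorem exists_gt_mem_of_isOpen (hΩo : IsOpen Ω) {x : WarpedProduct lam N} (hx : x ∈ Ω) :
    ∃ y ∈ Ω, x.1 < y.1 ∧ y.2 = x.2 := by
  obtain ⟨r', hr', hlt⟩ := exists_gt_mem_radii x.1.2
  obtain ⟨u, hu, v, hv, hsub⟩ := exists_nhds_prod_subset (hΩo.mem_nhds hx)
  obtain ⟨t, ht, ht'⟩ := Filter.nonempty_of_mem (inter_mem (mem_nhdsWithin_of_mem_nhds hu)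
    (Ioo_mem_nhdsGT hlt))
  refine ⟨(⟨t, Icc_subset_radii hr' ⟨x.1.2.1.trans ht'.1.le, ht'.2.le⟩⟩, x.2), ?_, ht'.1, rfl⟩
  exact hsub _ ht (mem_of_mem_nhds hv)

theorem lt_radialSup_of_mem (hΩo : IsOpen Ω) (hΩc : IsCompact (closure Ω))
    {x : WarpedProduct lam N} (hx : x ∈ Ω) : (x.1 : ℝ) < radialSup Ω x.2 := by
  obtain ⟨y, hy, hlt, hxy⟩ := exists_gt_mem_of_isOpen hΩo hx
  exact (lt_radialSup_iff ⟨x, hx⟩ hΩc x.1.2.1).2 ⟨y, hy, hlt, hxy⟩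

theorem radialSup_mem_frontier (hΩ : Ω.Nonempty) (hΩo : IsOpen Ω) (hΩc : IsCompact (closure Ω))
    {θ : ∀ q, N q} (hθ : 0 < radialSup Ω θ) :
    ((⟨radialSup Ω θ, radialSup_mem_radii hΩ hΩc θ⟩, θ) : WarpedProduct lam N) ∈ frontier Ω := by
  set x : WarpedProduct lam N := (⟨radialSup Ω θ, radialSup_mem_radii hΩ hΩc θ⟩, θ) with hxdef
  rw [hΩo.frontier_eq]
  refine ⟨mem_closure_iff_nhds.2 fun U hU => ?_, fun h => (lt_radialSup_of_mem hΩo hΩc h).ne rfl⟩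
  obtain ⟨u, hu, v, hv, hsub⟩ := exists_nhds_prod_subset hU
  obtain ⟨ε, hε, hball⟩ := Metric.mem_nhds_iff.1 hu
  have hmax : max 0 (radialSup Ω θ - ε) < radialSup Ω θ := max_lt hθ (sub_lt_self _ hε)
  obtain ⟨y, hy, hlt, hyθ⟩ := (lt_radialSup_iff hΩ hΩc (le_max_left _ _)).1 hmax
  have hle : (y.1 : ℝ) < radialSup Ω θ := by
    rw [← hyθ]
    exact lt_radialSup_of_mem hΩo hΩc hy
  refine ⟨y, hsub y (hball ?_) ?_, hy⟩
  · rw [Metric.mem_ball, Real.dist_eq, abs_sub_comm, abs_of_pos (sub_pos.2 hle)]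
    have := (le_max_right _ _).trans_lt hlt
    change radialSup Ω θ - _ < _
    linarith
  · rw [hyθ]
    exact mem_of_mem_nhds hv

end

section

variable {lam : EReal} {p : ℕ} {m : Fin p → ℕ} {N : Fin p → Type*}
  [∀ q, TopologicalSpace (N q)] [∀ q, ChartedSpace (EuclideanSpace ℝ (Fin (m q))) (N q)]
  [∀ q, IsManifold (𝓡 (m q)) ∞ (N q)]
  {g : ∀ q, SmoothMetric (m q) (N q)} {s : Fin p → ℝ → ℝ}
  [MeasurableSpace (∀ q, N q)] [BorelSpace (∀ q, N q)] {Ω : Set (WarpedProduct lam N)}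

/-- The measure `A(ρ(θ)) dθ` carried by the radial graph of `ρ = radialSup Ω`. -/
noncomputable def graphMeasure (g : ∀ q, SmoothMetric (m q) (N q)) (s : Fin p → ℝ → ℝ)
    (Ω : Set (WarpedProduct lam N)) : Measure (ℝ × ∀ q, N q) :=
  ((baseMeasure g).withDensity fun θ => radialDensity lam m s (radialSup Ω θ)).map
    fun θ => (radialSup Ω θ, θ)

theorem lintegral_graphMeasure (hs : ∀ q, ContinuousOn (s q) (radii lam)) (hΩ : Ω.Nonempty)
    (hΩo : IsOpen Ω) (hΩc : IsCompact (closure Ω)) {f : ℝ → ℝ≥0∞} (hf : Measurable f) :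
    ∫⁻ x, f x.1 ∂(graphMeasure g s Ω) =
      ∫⁻ θ, f (radialSup Ω θ) * radialDensity lam m s (radialSup Ω θ) ∂(baseMeasure g) := by
  have hρ := measurable_radialSup hΩ hΩo hΩc
  have hG : Measurable fun θ => (radialSup Ω θ, θ) := hρ.prodMk measurable_id
  have hf' : Measurable fun x : ℝ × ∀ q, N q => f x.1 := hf.comp measurable_fst
  have hfρ : Measurable fun θ => f (radialSup Ω θ) := hf.comp hρ
  have hDρ : Measurable fun θ => radialDensity lam m s (radialSup Ω θ) :=
    (measurable_radialDensity hs).comp hρ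
  rw [graphMeasure, lintegral_map hf' hG, lintegral_withDensity_eq_lintegral_mul _ hDρ hfρ]
  exact lintegral_congr fun θ => mul_comm _ _

variable [SecondCountableTopology (∀ q, N q)] [∀ q, T2Space (N q)] [∀ q, CompactSpace (N q)]

theorem riemVolume_pos (hs : ∀ q, ContinuousOn (s q) (radii lam))
    (hs0 : ∀ q, ∀ r ∈ radii lam, 0 ≤ s q r)
    (hA : ∀ r ∈ radii lam, 0 < r → 0 < areaFactor m s r) (hΩ : Ω.Nonempty) (hΩo : IsOpen Ω) :
    0 < riemVolume g s Ω := by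
  have := isFiniteMeasure_baseMeasure g
  obtain ⟨x, hx⟩ := hΩ
  obtain ⟨y, hy, hlt, -⟩ := exists_gt_mem_of_isOpen hΩo hx
  have hy0 : (0 : ℝ) < y.1 := x.1.2.1.trans_lt hlt
  obtain ⟨u, hu, v, hv, hsub⟩ := exists_nhds_prod_subset (hΩo.mem_nhds hy)
  have hu' := inter_mem (interior_mem_nhds.2 hu)
    ((isOpen_setOf_mem_radii_pos lam).mem_nhds ⟨y.1.2, hy0⟩)
  have huo : IsOpen (interior u ∩ {r | r ∈ radii lam ∧ 0 < r}) :=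
    isOpen_interior.inter (isOpen_setOf_mem_radii_pos lam)
  rw [riemVolume_eq_polarMeasure hs hs0 hA, polarMeasure_eq_prod hs hs0 hA]
  have hsub' : (interior u ∩ {r | r ∈ radii lam ∧ 0 < r}) ×ˢ v ⊆ polarCoords '' Ω := fun z hz =>
    ⟨(⟨z.1, hz.1.2.1⟩, z.2), hsub _ (interior_subset hz.1.1) hz.2, rfl⟩
  refine lt_of_lt_of_le ?_ (measure_mono hsub')
  rw [Measure.prod_prod]
  refine ENNReal.mul_pos ?_ (baseMeasure_pos_of_mem_nhds g hv).ne'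
  rw [withDensity_apply _ huo.measurableSet]
  refine ((setLIntegral_pos_iff (measurable_radialDensity hs)).2 ?_).ne'
  have hsupp : interior u ∩ {r | r ∈ radii lam ∧ 0 < r} ⊆
      Function.support (radialDensity lam m s) := fun r hr => by
    rw [Function.mem_support, radialDensity_of_pos hr.2.1 hr.2.2]
    exact (ENNReal.ofReal_pos.2 (hA r hr.2.1 hr.2.2)).ne'
  rw [inter_eq_right.2 hsupp]
  exact Measure.measure_pos_of_mem_nhds volume hu'

/-- The region under the outer radial graph contains `Ω`. -/
theorem riemVolume_le_lintegral_radialVolume (hs : ∀ q, ContinuousOn (s q) (radii lam))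
    (hs0 : ∀ q, ∀ r ∈ radii lam, 0 ≤ s q r)
    (hA : ∀ r ∈ radii lam, 0 < r → 0 < areaFactor m s r) (hΩ : Ω.Nonempty) (hΩo : IsOpen Ω)
    (hΩc : IsCompact (closure Ω)) :
    riemVolume g s Ω ≤
      ∫⁻ θ, ENNReal.ofReal (radialVolume m s (radialSup Ω θ)) ∂(baseMeasure g) := by
  have := isFiniteMeasure_baseMeasure g
  rw [riemVolume_eq_polarMeasure hs hs0 hA, polarMeasure_eq_prod hs hs0 hA,
    Measure.prod_apply_symm (measurableEmbedding_polarCoords.measurableSet_image'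
      hΩo.measurableSet)]
  refine lintegral_mono fun θ => ?_
  rw [← withDensity_radialDensity_Iio hs hA (radialSup_mem_radii hΩ hΩc θ)]
  refine measure_mono ?_
  rintro r ⟨x, hx, hxr⟩
  obtain ⟨rfl, rfl⟩ := Prod.ext_iff.1 hxr
  exact lt_radialSup_of_mem hΩo hΩc hx

/-- Jensen's inequality for the region under a radial graph: if, as a function of the volume, the
weighted area `b A` lies above a non-decreasing affine function which it touches at `R`, then the
weighted area of the outer radial graph is at least that of the boundary of the ball of radius
`R`. -/
theorem le_lintegral_radialSup (hs : ∀ q, ContinuousOn (s q) (radii lam))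
    (hs0 : ∀ q, ∀ r ∈ radii lam, 0 ≤ s q r)
    (hA : ∀ r ∈ radii lam, 0 < r → 0 < areaFactor m s r) (hΩ : Ω.Nonempty) (hΩo : IsOpen Ω)
    (hΩc : IsCompact (closure Ω)) {R : ℝ} (hR : R ∈ radii lam) (hR0 : 0 < R)
    (hvol : riemVolume g s (radialBall lam N R) = riemVolume g s Ω) {b : ℝ → ℝ}
    (hb0 : b 0 = 0) (hb : ∀ r ∈ radii lam, 0 ≤ b r) {k : ℝ} (hk0 : 0 ≤ k)
    (hk : ∀ r ∈ radii lam, b R * areaFactor m s R + k * (radialVolume m s r - radialVolume m s R) ≤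
      b r * areaFactor m s r) :
    ENNReal.ofReal (b R) * (ENNReal.ofReal (areaFactor m s R) * baseMeasure g univ) ≤
      ∫⁻ θ, ENNReal.ofReal (b (radialSup Ω θ)) * radialDensity lam m s (radialSup Ω θ)
        ∂(baseMeasure g) := by
  have := isFiniteMeasure_baseMeasure g
  set W := radialVolume m s with hW
  have hWR := radialVolume_nonneg hs hA hR
  have hAR := (hA R hR hR0).le
  have hpt : ∀ θ : ∀ q, N q, ENNReal.ofReal (b R * areaFactor m s R) +
      ENNReal.ofReal k * ENNReal.ofReal (W (radialSup Ω θ)) ≤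
      ENNReal.ofReal (b (radialSup Ω θ)) * radialDensity lam m s (radialSup Ω θ) +
        ENNReal.ofReal k * ENNReal.ofReal (W R) := by
    intro θ
    have hρ := radialSup_mem_radii hΩ hΩc θ
    have hWρ := radialVolume_nonneg hs hA hρ
    have h1 : ENNReal.ofReal (b (radialSup Ω θ)) * radialDensity lam m s (radialSup Ω θ) =
        ENNReal.ofReal (b (radialSup Ω θ) * areaFactor m s (radialSup Ω θ)) := by
      rcases hρ.1.lt_or_eq with h | h
      · rw [radialDensity_of_pos hρ h, ENNReal.ofReal_mul (hb _ hρ)]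
      · rw [← h, hb0, zero_mul, ENNReal.ofReal_zero, zero_mul]
    have h2 : 0 ≤ b (radialSup Ω θ) * areaFactor m s (radialSup Ω θ) := by
      rcases hρ.1.lt_or_eq with h | h
      · exact mul_nonneg (hb _ hρ) (hA _ hρ h).le
      · rw [← h, hb0, zero_mul]
    rw [h1, ← ENNReal.ofReal_mul hk0, ← ENNReal.ofReal_mul hk0, ← ENNReal.ofReal_add
      (mul_nonneg (hb R hR) hAR) (mul_nonneg hk0 hWρ), ← ENNReal.ofReal_add h2
      (mul_nonneg hk0 hWR)]
    refine ENNReal.ofReal_le_ofReal ?_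
    linarith [hk _ hρ]
  have hint := lintegral_mono (μ := baseMeasure g) hpt
  rw [lintegral_add_left measurable_const, lintegral_add_right _ measurable_const,
    lintegral_const, lintegral_const, lintegral_const_mul' _ _ ENNReal.ofReal_ne_top] at hint
  have hV : ENNReal.ofReal (W R) * baseMeasure g univ ≤
      ∫⁻ θ, ENNReal.ofReal (W (radialSup Ω θ)) ∂(baseMeasure g) := by
    rw [← riemVolume_radialBall hs hs0 hA hR, hvol]
    exact riemVolume_le_lintegral_radialVolume hs hs0 hA hΩ hΩo hΩc
  have hfin : ENNReal.ofReal k * ENNReal.ofReal (W R) * baseMeasure g univ ≠ ⊤ := by finiteness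
  refine (ENNReal.add_le_add_iff_right hfin).1 (le_trans ?_ hint)
  rw [← mul_assoc, ← ENNReal.ofReal_mul (hb R hR), mul_assoc (ENNReal.ofReal k)]
  gcongr

/-- The outer radial graph is a part of the boundary, and its radial projection to the base
decreases areas. -/
theorem graphMeasure_le (hs : ∀ q, ContinuousOn (s q) (radii lam))
    (hs0 : ∀ q, ∀ r ∈ radii lam, 0 ≤ s q r)
    (hA : ∀ r ∈ radii lam, 0 < r → 0 < areaFactor m s r) (hΩ : Ω.Nonempty) (hΩo : IsOpen Ω)
    (hΩc : IsCompact (closure Ω)) :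
    graphMeasure g s Ω ≤
      (polarMeasure lam g s (∑ q, m q)).restrict (polarCoords '' frontier Ω) := by
  have hρ := measurable_radialSup hΩ hΩo hΩc
  have hG : Measurable fun θ => (radialSup Ω θ, θ) := hρ.prodMk measurable_id
  have hm : MeasurableSet (polarCoords '' frontier Ω) :=
    measurableEmbedding_polarCoords.measurableSet_image' isClosed_frontier.measurableSet
  have h0 : graphMeasure g s Ω (polarCoords '' frontier Ω)ᶜ = 0 := by
    rw [graphMeasure, Measure.map_apply hG hm.compl, withDensity_apply _ (hG hm.compl)]
    refine setLIntegral_eq_zero (hG hm.compl) fun θ hθ => ?_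
    refine radialDensity_of_nonpos (not_lt.1 fun h => hθ ?_)
    exact ⟨_, radialSup_mem_frontier hΩ hΩo hΩc h, rfl⟩
  rw [← Measure.restrict_eq_self_of_ae_mem (s := polarCoords '' frontier Ω)
    (μ := graphMeasure g s Ω) h0]
  exact Measure.restrict_mono_measure
    (map_withDensity_le_polarMeasure hs hs0 hA hρ) _

end

/-! ### The inequality for weights vanishing at the origin -/

section

variable {lam : EReal} {p : ℕ} {m : Fin p → ℕ} {N : Fin p → Type*}
  [∀ q, TopologicalSpace (N q)] [∀ q, ChartedSpace (EuclideanSpace ℝ (Fin (m q))) (N q)]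
  [∀ q, IsManifold (𝓡 (m q)) ∞ (N q)]
  {g : ∀ q, SmoothMetric (m q) (N q)} {s : Fin p → ℝ → ℝ}
  [MeasurableSpace (∀ q, N q)] [BorelSpace (∀ q, N q)]
  [SecondCountableTopology (∀ q, N q)] [∀ q, T2Space (N q)] [∀ q, CompactSpace (N q)]

theorem nonneg_of_monotoneOn_mul_areaFactor
    (hA : ∀ r ∈ radii lam, 0 < r → 0 < areaFactor m s r) {b : ℝ → ℝ} (hb0 : b 0 = 0)
    (hmono : MonotoneOn (fun r => b r * areaFactor m s r) (radii lam)) {r : ℝ}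
    (hr : r ∈ radii lam) : 0 ≤ b r := by
  rcases hr.1.lt_or_eq with h | h
  · have h1 := hmono (zero_mem_radii hr) hr hr.1
    simp only [hb0, zero_mul] at h1
    exact nonneg_of_mul_nonneg_left h1 (hA r hr h)
  · rw [← h, hb0]

/-- The convex function `b A` of the volume lies above a non-decreasing affine function which it
touches at the volume of the ball of radius `R`. -/
theorem exists_slope_le_mul_areaFactor [Nonempty (∀ q, N q)]
    (hs : ∀ q, ContinuousOn (s q) (radii lam)) (hs0 : ∀ q, ∀ r ∈ radii lam, 0 ≤ s q r)
    (hA : ∀ r ∈ radii lam, 0 < r → 0 < areaFactor m s r) {b : ℝ → ℝ} (hb0 : b 0 = 0)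
    (hmono : MonotoneOn (fun r => b r * areaFactor m s r) (radii lam))
    (hconv : ConvexOn ℝ (ballVolume lam g s '' radii lam) fun u =>
      b (ballVolumeInv lam g s u) * areaFactor m s (ballVolumeInv lam g s u))
    {R : ℝ} (hR : R ∈ radii lam) (hR0 : 0 < R) :
    ∃ k, 0 ≤ k ∧ ∀ r ∈ radii lam, b R * areaFactor m s R +
      k * (radialVolume m s r - radialVolume m s R) ≤ b r * areaFactor m s r := by
  have := isFiniteMeasure_baseMeasure g
  have hM : 0 < (baseMeasure g).real univ :=
    ENNReal.toReal_pos (baseMeasure_pos_of_mem_nhds g (θ₀ := Classical.arbitrary _)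
      univ_mem).ne' (measure_ne_top _ _)
  have hV : ∀ r ∈ radii lam, ballVolume lam g s r =
      radialVolume m s r * (baseMeasure g).real univ := fun r hr => ballVolume_eq hs hs0 hA hr
  have hVmono : StrictMonoOn (ballVolume lam g s) (radii lam) := fun r hr r' hr' h => by
    rw [hV r hr, hV r' hr']
    exact mul_lt_mul_of_pos_right (strictMonoOn_radialVolume hs hA hr hr' h) hM
  have hinv : ∀ r ∈ radii lam, ballVolumeInv lam g s (ballVolume lam g s r) = r := fun r hr =>
    hVmono.injOn.leftInvOn_invFunOn hr
  -- the volume of the ball is an interior point of the interval of volumes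
  obtain ⟨R', hR', hlt⟩ := exists_gt_mem_radii hR
  have h0 := zero_mem_radii hR
  have hint : ballVolume lam g s R ∈ interior (ballVolume lam g s '' radii lam) := by
    refine mem_interior_iff_mem_nhds.2 (mem_of_superset
      (Icc_mem_nhds (hVmono h0 hR hR0) (hVmono hR hR' hlt)) ?_)
    have hcont : ContinuousOn (ballVolume lam g s) (Icc 0 R') :=
      ((continuousOn_radialVolume hs hR').mul continuousOn_const).congr
        fun r hr => hV r (Icc_subset_radii hR' hr)
    exact (intermediate_value_Icc hR'.1 hcont).trans (image_mono (Icc_subset_radii hR'))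
  obtain ⟨k, hk⟩ := hconv.exists_supporting_line hint
  have hk' : ∀ r ∈ radii lam, b R * areaFactor m s R + k * (baseMeasure g).real univ *
      (radialVolume m s r - radialVolume m s R) ≤ b r * areaFactor m s r := by
    intro r hr
    have h1 := hk _ (mem_image_of_mem _ hr)
    simp only [hinv r hr, hinv R hR] at h1
    rw [hV r hr, hV R hR] at h1
    linarith
  refine ⟨_, ?_, hk'⟩
  have h1 := hk' 0 h0
  rw [hb0, zero_mul, radialVolume_zero, zero_sub] at h1
  have h2 := hmono h0 hR hR0.le
  simp only [hb0, zero_mul] at h2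
  have h3 : 0 < radialVolume m s R := by
    rw [← radialVolume_zero (m := m) (s := s)]
    exact strictMonoOn_radialVolume hs hA h0 hR hR0
  by_contra! hneg
  have := mul_neg_of_neg_of_pos hneg h3
  linarith

variable {Ω : Set (WarpedProduct lam N)}

theorem radius_pos_of_riemVolume_eq (hs : ∀ q, ContinuousOn (s q) (radii lam))
    (hs0 : ∀ q, ∀ r ∈ radii lam, 0 ≤ s q r)
    (hA : ∀ r ∈ radii lam, 0 < r → 0 < areaFactor m s r) (hΩ : Ω.Nonempty) (hΩo : IsOpen Ω)
    {R : ℝ} (hvol : riemVolume g s (radialBall lam N R) = riemVolume g s Ω) : 0 < R := by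
  by_contra! hR
  have h : radialBall lam N R = ∅ :=
    eq_empty_of_forall_notMem fun x hx => absurd x.1.2.1 (not_le.2 (lt_of_lt_of_le hx hR))
  have := riemVolume_pos (g := g) hs hs0 hA hΩ hΩo
  rw [← hvol, h, riemVolume, image_empty, measure_empty] at this
  exact this.false

/-- For a weight `b` vanishing at `r = 0`, the integral of `b` over the boundary of the ball is at
most its integral for the measure carried by the outer radial graph. -/
theorem areaIntegral_slice_le_lintegral_graphMeasure (hs : ∀ q, ContinuousOn (s q) (radii lam))
    (hs0 : ∀ q, ∀ r ∈ radii lam, 0 ≤ s q r)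
    (hA : ∀ r ∈ radii lam, 0 < r → 0 < areaFactor m s r) {b : ℝ → ℝ} (hb0 : b 0 = 0)
    (hbc : ContinuousOn b (radii lam))
    (hmono : MonotoneOn (fun r => b r * areaFactor m s r) (radii lam))
    (hconv : ConvexOn ℝ (ballVolume lam g s '' radii lam) fun u =>
      b (ballVolumeInv lam g s u) * areaFactor m s (ballVolumeInv lam g s u))
    (hΩ : Ω.Nonempty) (hΩo : IsOpen Ω) (hΩc : IsCompact (closure Ω))
    {R : ℝ} (hR : R ∈ radii lam)
    (hvol : riemVolume g s (radialBall lam N R) = riemVolume g s Ω) :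
    areaIntegral g s b (slice lam N R) ≤
      ∫⁻ x, (radii lam).indicator (fun r => ENNReal.ofReal (b r)) x.1 ∂(graphMeasure g s Ω) := by
  have hR0 := radius_pos_of_riemVolume_eq hs hs0 hA hΩ hΩo hvol
  obtain ⟨x₀, -⟩ := id hΩ
  have : Nonempty (∀ q, N q) := ⟨x₀.2⟩
  have hm := measurable_indicator_radii hbc
  obtain ⟨k, hk0, hk⟩ := exists_slope_le_mul_areaFactor hs hs0 hA hb0 hmono hconv hR hR0
  rw [areaIntegral_slice hs hs0 hA hb0 hR hR0, lintegral_graphMeasure hs hΩ hΩo hΩc hm]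
  refine (le_lintegral_radialSup hs hs0 hA hΩ hΩo hΩc hR hR0 hvol hb0
    (fun r hr => nonneg_of_monotoneOn_mul_areaFactor hA hb0 hmono hr) hk0 hk).trans (le_of_eq ?_)
  refine lintegral_congr fun θ => ?_
  rw [indicator_of_mem (radialSup_mem_radii hΩ hΩc θ)]

theorem areaIntegral_frontier_eq_lintegral (hs : ∀ q, ContinuousOn (s q) (radii lam))
    (hs0 : ∀ q, ∀ r ∈ radii lam, 0 ≤ s q r)
    (hA : ∀ r ∈ radii lam, 0 < r → 0 < areaFactor m s r) {b : ℝ → ℝ} (hb0 : b 0 = 0) :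
    areaIntegral g s b (frontier Ω) =
      ∫⁻ x, (radii lam).indicator (fun r => ENNReal.ofReal (b r)) x.1
        ∂((polarMeasure lam g s (∑ q, m q)).restrict (polarCoords '' frontier Ω)) := by
  rw [areaIntegral_eq_setLIntegral_polarMeasure hs hs0 hA hb0]
  refine setLIntegral_congr_fun
    (measurableEmbedding_polarCoords.measurableSet_image' isClosed_frontier.measurableSet) ?_
  rintro _ ⟨x, -, rfl⟩
  simp only [polarCoords_fst]
  rw [indicator_of_mem x.1.2]

/-- The weighted isoperimetric inequality for a weight `b` vanishing at `r = 0`. It does not use the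
classical isoperimetric inequality. -/
theorem areaIntegral_slice_le_areaIntegral_frontier
    (hs : ∀ q, ContinuousOn (s q) (radii lam)) (hs0 : ∀ q, ∀ r ∈ radii lam, 0 ≤ s q r)
    (hA : ∀ r ∈ radii lam, 0 < r → 0 < areaFactor m s r) {b : ℝ → ℝ} (hb0 : b 0 = 0)
    (hbc : ContinuousOn b (radii lam))
    (hmono : MonotoneOn (fun r => b r * areaFactor m s r) (radii lam))
    (hconv : ConvexOn ℝ (ballVolume lam g s '' radii lam) fun u =>
      b (ballVolumeInv lam g s u) * areaFactor m s (ballVolumeInv lam g s u))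
    (hΩ : Ω.Nonempty) (hΩo : IsOpen Ω) (hΩc : IsCompact (closure Ω))
    {R : ℝ} (hR : R ∈ radii lam)
    (hvol : riemVolume g s (radialBall lam N R) = riemVolume g s Ω) :
    areaIntegral g s b (slice lam N R) ≤ areaIntegral g s b (frontier Ω) := by
  rw [areaIntegral_frontier_eq_lintegral hs hs0 hA hb0]
  exact (areaIntegral_slice_le_lintegral_graphMeasure hs hs0 hA hb0 hbc hmono hconv hΩ hΩo hΩc hR
    hvol).trans (lintegral_mono' (graphMeasure_le hs hs0 hA hΩ hΩo hΩc) le_rfl)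

/-- In the case of equality, the area of the boundary is carried by the outer radial graph and is
the measure `A(ρ(θ)) dθ` there. -/
theorem graphMeasure_eq_of_areaIntegral_le
    (hs : ∀ q, ContinuousOn (s q) (radii lam)) (hs0 : ∀ q, ∀ r ∈ radii lam, 0 ≤ s q r)
    (hA : ∀ r ∈ radii lam, 0 < r → 0 < areaFactor m s r) {b : ℝ → ℝ} (hb0 : b 0 = 0)
    (hbc : ContinuousOn b (radii lam))
    (hmono : MonotoneOn (fun r => b r * areaFactor m s r) (radii lam))
    (hconv : ConvexOn ℝ (ballVolume lam g s '' radii lam) fun u =>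
      b (ballVolumeInv lam g s u) * areaFactor m s (ballVolumeInv lam g s u))
    (hpos : ∀ r ∈ radii lam, 0 < r → 0 < b r * areaFactor m s r)
    (hΩ : Ω.Nonempty) (hΩo : IsOpen Ω) (hΩc : IsCompact (closure Ω))
    {R : ℝ} (hR : R ∈ radii lam)
    (hvol : riemVolume g s (radialBall lam N R) = riemVolume g s Ω)
    (hle : areaIntegral g s b (frontier Ω) ≤ areaIntegral g s b (slice lam N R)) :
    graphMeasure g s Ω =
      (polarMeasure lam g s (∑ q, m q)).restrict (polarCoords '' frontier Ω) := by
  have := isFiniteMeasure_baseMeasure g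
  have hR0 := radius_pos_of_riemVolume_eq hs hs0 hA hΩ hΩo hvol
  have hm := measurable_indicator_radii hbc
  have hfin : areaIntegral g s b (slice lam N R) ≠ ⊤ := by
    rw [areaIntegral_slice hs hs0 hA hb0 hR hR0]
    finiteness
  refine measure_eq_of_le_of_lintegral_eq (graphMeasure_le hs hs0 hA hΩ hΩo hΩc)
    (hm.comp measurable_fst) ?_ (fun x => ?_) ?_ ?_
  · have h1 : ∀ᵐ x ∂(polarMeasure lam g s (∑ q, m q)), x.1 ∈ radii lam ∧ 0 < x.1 :=
      polarMeasure_compl_eq_zero hs hs0 hA _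
    filter_upwards [ae_mono Measure.restrict_le_self h1] with x hx
    rw [Function.comp_apply, indicator_of_mem (s := radii lam) hx.1]
    exact (ENNReal.ofReal_pos.2
      ((pos_iff_pos_of_mul_pos (hpos _ hx.1 hx.2)).2 (hA _ hx.1 hx.2))).ne'
  · rw [Function.comp_apply, indicator_apply]
    split_ifs <;> simp
  · simp only [Function.comp_apply]
    rw [← areaIntegral_frontier_eq_lintegral hs hs0 hA hb0]
    exact ne_top_of_le_ne_top hfin hle
  · simp only [Function.comp_apply]
    rw [← areaIntegral_frontier_eq_lintegral hs hs0 hA hb0]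
    exact hle.trans (areaIntegral_slice_le_lintegral_graphMeasure hs hs0 hA hb0 hbc hmono hconv
      hΩ hΩo hΩc hR hvol)

end

/-! ### Surfaces with the same area as their projection -/

section

variable {E W Z : Type*}
  [NormedAddCommGroup E] [InnerProductSpace ℝ E] [FiniteDimensional ℝ E] [MeasurableSpace E]
  [BorelSpace E]
  [NormedAddCommGroup W] [InnerProductSpace ℝ W] [MeasurableSpace W]
  [BorelSpace W]
  [NormedAddCommGroup Z] [InnerProductSpace ℝ Z] [FiniteDimensional ℝ Z] [MeasurableSpace Z]
  [BorelSpace Z]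

/-- If a linear contraction `P` strictly shortens some tangent vector of a parametrized surface of
the same dimension as the target of `P`, then it strictly decreases areas near the given point. -/
theorem exists_mul_volume_image_lt_hausdorffMeasure (A : E →L[ℝ] W) (hA : Function.Injective A)
    (P : W →L[ℝ] Z) (hP : ∀ w, ‖P w‖ ≤ ‖w‖) {v : E} (hv : ‖P (A v)‖ < ‖A v‖)
    (hdim : Module.finrank ℝ Z = Module.finrank ℝ E) :
    ∃ κ : ℝ≥0, 1 < κ ∧ ∃ δ : ℝ≥0, 0 < δ ∧ ∀ (F : E → W) (u : Set E),
      ApproximatesLinearOn F A u δ → volume u ≠ 0 → volume u ≠ ⊤ →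
        κ * volume (P '' (F '' u)) < (μHE[Module.finrank ℝ E] : Measure W) (F '' u) := by
  -- isometric coordinates on `Z`, and orthogonal projection to the tangent space
  let i₁ : Z ≃ₗᵢ[ℝ] E := (stdOrthonormalBasis ℝ Z).equiv (stdOrthonormalBasis ℝ E) (finCongr hdim)
  let T : Submodule ℝ W := LinearMap.range (A : E →ₗ[ℝ] W)
  have hT : Module.finrank ℝ T = Module.finrank ℝ E := LinearMap.finrank_range_of_inj hA
  let i₂ : T ≃ₗᵢ[ℝ] E := (stdOrthonormalBasis ℝ T).equiv (stdOrthonormalBasis ℝ E) (finCongr hT)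
  let Q : W →L[ℝ] E := (i₂ : T →L[ℝ] E).comp T.orthogonalProjectionOnto
  have hQ : ∀ w, ‖Q w‖ ≤ ‖w‖ := fun w => by
    change ‖i₂ (T.orthogonalProjectionOnto w)‖ ≤ ‖w‖
    rw [i₂.norm_map]
    exact T.norm_orthogonalProjectionOnto_apply_le w
  have hQA : ∀ x, ‖Q (A x)‖ = ‖A x‖ := fun x => by
    change ‖i₂ (T.orthogonalProjectionOnto (A x))‖ = ‖A x‖
    rw [i₂.norm_map]
    exact congrArg norm (T.orthogonalProjectionOnto_mem_subspace_eq_self ⟨A x, x, rfl⟩)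
  let P' : W →L[ℝ] E := (i₁ : Z →L[ℝ] E).comp P
  have hP'n : ∀ w, ‖P' w‖ = ‖P w‖ := fun w => i₁.norm_map (P w)
  have hP' : ∀ w, ‖P' w‖ ≤ ‖w‖ := fun w => (hP'n w).le.trans (hP w)
  let p₁ : E →L[ℝ] E := P'.comp A
  let p₂ : E →L[ℝ] E := Q.comp A
  have hinj : Function.Injective (p₂ : E →ₗ[ℝ] E) := by
    refine (injective_iff_map_eq_zero _).2 fun x hx => ?_
    have h1 : ‖A x‖ = 0 := by rw [← hQA x]; exact norm_eq_zero.2 hx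
    exact hA ((norm_eq_zero.1 h1).trans (map_zero A).symm)
  let e : E ≃L[ℝ] E := (LinearEquiv.ofInjectiveEndo (p₂ : E →ₗ[ℝ] E) hinj).toContinuousLinearEquiv
  have he : ∀ x, e x = p₂ x := fun x => rfl
  let C : E →L[ℝ] E := p₁.comp (e.symm : E →L[ℝ] E)
  have hC : ∀ x, ‖C x‖ ≤ ‖x‖ := fun x => by
    obtain ⟨y, rfl⟩ := e.surjective x
    change ‖p₁ (e.symm (e y))‖ ≤ _
    rw [e.symm_apply_apply, he]
    exact (hP'n (A y)).le.trans ((hP _).trans (hQA y).ge)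
  have hCv : ‖C (e v)‖ < ‖e v‖ := by
    change ‖p₁ (e.symm (e v))‖ < _
    rw [e.symm_apply_apply, he]
    exact (hP'n (A v)).trans_lt (hv.trans_eq (hQA v).symm)
  have hdet : |p₁.det| < |p₂.det| := by
    have h1 : p₁ = C.comp p₂ := by
      ext1 x
      change p₁ x = p₁ (e.symm (p₂ x))
      rw [← he, e.symm_apply_apply]
    have h2 : p₁.det = C.det * p₂.det := by
      rw [h1]
      exact LinearMap.det_comp _ _
    have h3 : p₂.det ≠ 0 := by
      have := (LinearEquiv.ofInjectiveEndo (p₂ : E →ₗ[ℝ] E) hinj).isUnit_det'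
      exact this.ne_zero
    rw [h2, abs_mul]
    exact mul_lt_of_lt_one_left (abs_pos.2 h3) (abs_det_lt_one_of_contraction C hC hCv)
  have hdet' : ENNReal.ofReal |p₁.det| < ENNReal.ofReal |p₂.det| :=
    (ENNReal.ofReal_lt_ofReal_iff ((abs_nonneg _).trans_lt hdet)).2 hdet
  obtain ⟨d₁, h1, h1'⟩ := ENNReal.lt_iff_exists_nnreal_btwn.1 hdet'
  obtain ⟨d, h2, h2'⟩ := ENNReal.lt_iff_exists_nnreal_btwn.1 h1'
  obtain ⟨d₂, h3, h3'⟩ := ENNReal.lt_iff_exists_nnreal_btwn.1 h2'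
  have hd₁ : 0 < d₁ := by exact_mod_cast lt_of_le_of_lt zero_le h1
  have h2 : d₁ < d := by exact_mod_cast h2
  have hκ : 1 < d / d₁ := by rwa [lt_div_iff₀ hd₁, one_mul]
  obtain ⟨δ, ⟨hδ1, hδ2⟩, hδ⟩ := (((addHaar_image_le_mul_of_det_lt (volume : Measure E) p₁ h1).and
    (mul_le_addHaar_image_of_lt_det (volume : Measure E) p₂ h3')).and self_mem_nhdsWithin).exists
  refine ⟨d / d₁, hκ, δ, hδ, fun F u hF hu0 hutop => ?_⟩
  have happ : ∀ B : W →L[ℝ] E, (∀ w, ‖B w‖ ≤ ‖w‖) →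
      ApproximatesLinearOn (B ∘ F) (B.comp A) u δ := by
    intro B hB
    refine fun x hx y hy => ?_
    have h4 := hF x hx y hy
    calc ‖B (F x) - B (F y) - B (A (x - y))‖ = ‖B (F x - F y - A (x - y))‖ := by
          rw [map_sub B, map_sub B]
      _ ≤ _ := (hB _).trans h4
  have h5 := hδ1 u _ (happ P' hP')
  have h6 := hδ2 u _ (happ Q hQ)
  have h7 : volume (P '' (F '' u)) ≤ volume ((P' ∘ F) '' u) := by
    have h8 := euclideanHausdorffMeasure_image_le (Module.finrank ℝ E) 1 (f := P' ∘ F)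
      (h := fun x => P (F x)) (S := u) fun x _ y _ => by
        rw [ENNReal.coe_one, one_mul, Function.comp_apply, Function.comp_apply]
        exact (i₁.isometry.edist_eq (P (F x)) (P (F y))).ge
    rw [ENNReal.coe_one, one_pow, one_mul, InnerProductSpace.euclideanHausdorffMeasure_eq_volume,
      ← hdim, InnerProductSpace.euclideanHausdorffMeasure_eq_volume] at h8
    rwa [image_image]
  have h9 : volume ((Q ∘ F) '' u) ≤ (μHE[Module.finrank ℝ E] : Measure W) (F '' u) := by
    have h8 := euclideanHausdorffMeasure_image_le (Module.finrank ℝ E) 1 (f := F)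
      (h := Q ∘ F) (S := u) fun x _ y _ => by
        rw [ENNReal.coe_one, one_mul, edist_eq_enorm_sub, edist_eq_enorm_sub, Function.comp_apply,
          Function.comp_apply, ← map_sub, ← ofReal_norm, ← ofReal_norm]
        exact ENNReal.ofReal_le_ofReal (hQ _)
    rwa [ENNReal.coe_one, one_pow, one_mul,
      InnerProductSpace.euclideanHausdorffMeasure_eq_volume] at h8
  calc ((d / d₁ : ℝ≥0) : ℝ≥0∞) * volume (P '' (F '' u))
      ≤ ((d / d₁ : ℝ≥0) : ℝ≥0∞) * (d₁ * volume u) := mul_le_mul_right (h7.trans h5) _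
    _ = d * volume u := by
        rw [← mul_assoc, ← ENNReal.coe_mul, div_mul_cancel₀ _ hd₁.ne']
    _ < d₂ * volume u := ENNReal.mul_lt_mul_left hu0 hutop h3
    _ ≤ _ := h6.trans h9

end

section

variable {E W : Type*}
  [NormedAddCommGroup E] [InnerProductSpace ℝ E] [FiniteDimensional ℝ E] [MeasurableSpace E]
  [BorelSpace E] [NormedAddCommGroup W] [NormedSpace ℝ W] [FiniteDimensional ℝ W]

/-- A set of positive measure on which the derivatives are close to a given linear map has a part
of positive measure on which the function is close to that linear map. -/
theorem exists_approximatesLinearOn_of_norm_sub_le {F : E → W} {F' : E → E →L[ℝ] W} {s : Set E}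
    (hs : MeasurableSet s) (hs0 : volume s ≠ 0) (hF : ∀ y ∈ s, HasFDerivAt F (F' y) y)
    {A : E →L[ℝ] W} {δ : ℝ≥0} (hδ : 0 < δ) (hA : ∀ y ∈ s, ‖F' y - A‖ ≤ δ) :
    ∃ u ⊆ s, MeasurableSet u ∧ volume u ≠ 0 ∧ volume u ≠ ⊤ ∧
      ApproximatesLinearOn F A u (δ + δ) := by
  obtain ⟨t, B, -, htm, hst, ht, hB⟩ := exists_partition_approximatesLinearOn_of_hasFDerivWithinAt
    F s F' (fun y hy => (hF y hy).hasFDerivWithinAt) (fun _ => δ) fun _ => hδ.ne'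
  have h1 : ∃ n, volume (s ∩ t n) ≠ 0 := by
    by_contra! h
    refine hs0 (measure_mono_null (fun y hy => ?_) (measure_iUnion_null h))
    rw [← inter_iUnion]
    exact ⟨hy, hst hy⟩
  obtain ⟨n, hn⟩ := h1
  have hne : s.Nonempty := nonempty_iff_ne_empty.2 fun h => hs0 (by rw [h, measure_empty])
  obtain ⟨u, hu, hum, hu0⟩ : ∃ u ⊆ s ∩ t n, MeasurableSet u ∧ volume u ≠ 0 ∧ volume u ≠ ⊤ := by
    obtain ⟨u, hum, hu, h2, h3⟩ :=
      Measure.exists_subset_measure_lt_top (hs.inter (htm n)) (pos_iff_ne_zero.2 hn)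
    exact ⟨u, hu, hum, h2.ne', h3.ne⟩
  refine ⟨u, hu.trans inter_subset_left, hum, hu0.1, hu0.2, fun x hx y hy => ?_⟩
  obtain ⟨z, hz, hzB⟩ := hB hne n
  calc ‖F x - F y - A (x - y)‖ = ‖(F x - F y - B n (x - y)) + (B n - A) (x - y)‖ := by
        congr 1
        rw [sub_apply]
        abel
    _ ≤ δ * ‖x - y‖ + δ * ‖x - y‖ := by
        refine (norm_add_le _ _).trans (add_le_add (ht n x (hu hx) y (hu hy)) ?_)
        refine ((B n - A).le_opNorm _).trans (mul_le_mul_of_nonneg_right ?_ (norm_nonneg _))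
        rw [hzB]
        exact hA z hz
    _ = _ := by
        push_cast
        ring

/-- If a Lipschitz parametrized surface has, near each of its points, essentially the same area as
its projection along a direction, then its height in that direction has vanishing derivative almost
everywhere. -/
theorem ae_hasFDerivAt_zero_of_forall_exists_frame {Z : Type*} [NormedAddCommGroup Z]
    [InnerProductSpace ℝ Z] [FiniteDimensional ℝ Z] [MeasurableSpace Z] [BorelSpace Z]
    {Y : Type*} [NormedAddCommGroup Y] [InnerProductSpace ℝ Y] [FiniteDimensional ℝ Y]
    [MeasurableSpace Y] [BorelSpace Y] (P : Y →L[ℝ] Z) (hP : ∀ w, ‖P w‖ ≤ ‖w‖)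
    (hdim : Module.finrank ℝ Z = Module.finrank ℝ E)
    {Φ : E → W} {K : ℝ≥0} (hΦ : LipschitzWith K Φ) {π : W →L[ℝ] E} (hπ : ∀ y, π (Φ y) = y)
    (l : W →L[ℝ] ℝ) {O : Set E} (hO : IsOpen O)
    (h : ∀ y₀ ∈ O, ∃ L : W →L[ℝ] Y, Function.Injective L ∧
      (∀ v, l v ≠ 0 → ‖P (L v)‖ < ‖L v‖) ∧ ∀ κ : ℝ≥0, 1 < κ → ∃ U ∈ 𝓝 y₀, ∀ u ⊆ U, MeasurableSet u →
        (μHE[Module.finrank ℝ E] : Measure Y) ((fun y => L (Φ y)) '' u) ≤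
          κ * volume (P '' ((fun y => L (Φ y)) '' u))) :
    ∀ᵐ y : E, y ∈ O → HasFDerivAt (fun y => l (Φ y)) (0 : E →L[ℝ] ℝ) y := by
  let bad : Set E := {y | y ∈ O ∧ DifferentiableAt ℝ Φ y ∧ l.comp (fderiv ℝ Φ y) ≠ 0}
  borelize W
  have : ProperSpace (E →L[ℝ] W) := FiniteDimensional.proper_real _
  have : ProperSpace (E →L[ℝ] ℝ) := FiniteDimensional.proper_real _
  have : SecondCountableTopology (E →L[ℝ] W) := inferInstance
  have : CompleteSpace W := FiniteDimensional.complete ℝ W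
  have hD : Measurable (fderiv ℝ Φ) := measurable_fderiv ℝ Φ
  have hbadm : MeasurableSet bad := by
    refine hO.measurableSet.inter ((measurableSet_of_differentiableAt ℝ Φ).inter ?_)
    have h1 : Continuous fun B : E →L[ℝ] W => l.comp B := by fun_prop
    exact (isOpen_compl_singleton.preimage h1).measurableSet.preimage hD
  suffices hbad0 : volume bad = 0 by
    filter_upwards [hΦ.ae_differentiableAt (μ := (volume : Measure E)),
      measure_eq_zero_iff_ae_notMem.1 hbad0] with y hy hyb hyO
    have h1 : l.comp (fderiv ℝ Φ y) = 0 := by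
      by_contra h2
      exact hyb ⟨hyO, hy, h2⟩
    rw [← h1]
    exact l.hasFDerivAt.comp y hy.hasFDerivAt
  by_contra hbad0
  -- a point all of whose neighbourhoods contain many points with a similar derivative
  let G : E → E × (E →L[ℝ] W) := fun y => (y, fderiv ℝ Φ y)
  have hG : Measurable G := measurable_id.prodMk hD
  have hGbad : ((volume.restrict bad).map G) (G '' bad) ≠ 0 := by
    refine fun h0 => hbad0 ?_
    have h1 := Measure.le_map_apply_image hG.aemeasurable (μ := volume.restrict bad) bad
    rw [h0, Measure.restrict_apply_self] at h1
    exact le_antisymm h1 zero_le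
  obtain ⟨_, ⟨y₀, hy₀, rfl⟩, hpos⟩ := exists_mem_forall_mem_nhdsWithin_pos_measure hGbad
  obtain ⟨hyO, hdiff, hne⟩ := hy₀
  obtain ⟨L, hLinj, hL, hκU⟩ := h y₀ hyO
  set A : E →L[ℝ] Y := L.comp (fderiv ℝ Φ y₀) with hA
  have hAinj : Function.Injective A := by
    have h1 : π.comp (fderiv ℝ Φ y₀) = ContinuousLinearMap.id ℝ E := by
      have h2 : HasFDerivAt (fun y => π (Φ y)) (π.comp (fderiv ℝ Φ y₀)) y₀ :=
        π.hasFDerivAt.comp y₀ hdiff.hasFDerivAt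
      simp only [hπ] at h2
      exact h2.unique (hasFDerivAt_id y₀)
    refine hLinj.comp (Function.LeftInverse.injective (g := π) fun y => ?_)
    exact congrArg (fun B : E →L[ℝ] E => B y) h1
  obtain ⟨v, hv⟩ : ∃ v, l (fderiv ℝ Φ y₀ v) ≠ 0 := by
    by_contra! h1
    exact hne (ContinuousLinearMap.ext h1)
  have hPv : ‖P (A v)‖ < ‖A v‖ := hL _ hv
  obtain ⟨κ, hκ, δ, hδ, hgap⟩ :=
    exists_mul_volume_image_lt_hausdorffMeasure A hAinj P hP hPv hdim
  obtain ⟨U, hU, hUu⟩ := hκU κ hκ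
  let t : Set (E × (E →L[ℝ] W)) :=
    {q | q.1 ∈ interior U ∧ ‖L.comp q.2 - A‖ < ((δ / 2 : ℝ≥0) : ℝ)}
  have ht : IsOpen t := by
    have h1 : Continuous fun q : E × (E →L[ℝ] W) => ‖L.comp q.2 - A‖ :=
      (((ContinuousLinearMap.compL ℝ E W Y L).continuous.comp
        continuous_snd).sub continuous_const).norm
    exact (isOpen_interior.preimage continuous_fst).inter (isOpen_lt h1 continuous_const)
  have hmem : G y₀ ∈ t := by
    refine ⟨mem_interior_iff_mem_nhds.2 hU, ?_⟩
    change ‖L.comp (fderiv ℝ Φ y₀) - A‖ < _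
    rw [← hA, sub_self, norm_zero]
    exact NNReal.coe_pos.2 (half_pos hδ)
  have h1 := hpos t (mem_nhdsWithin_of_mem_nhds (ht.mem_nhds hmem))
  rw [Measure.map_apply hG ht.measurableSet,
    Measure.restrict_apply (hG ht.measurableSet)] at h1
  obtain ⟨u, hus, hum, hu0, hutop, happ⟩ := exists_approximatesLinearOn_of_norm_sub_le
    (F := fun y => L (Φ y)) (F' := fun y => L.comp (fderiv ℝ Φ y))
    ((hG ht.measurableSet).inter hbadm) h1.ne'
    (fun y hy => L.hasFDerivAt.comp y hy.2.2.1.hasFDerivAt) (half_pos hδ) fun y hy => hy.1.2.le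
  rw [add_halves] at happ
  have h2 := hgap _ u happ hu0 hutop
  exact (lt_of_lt_of_le h2 (hUu u (fun y hy => interior_subset (hus hy).1.1) hum)).false

end

/-! ### Lipschitz boundary points -/

theorem ContinuousOn.measurableSet_inter_preimage {α β : Type*} [TopologicalSpace α]
    [MeasurableSpace α] [OpensMeasurableSpace α] [TopologicalSpace β] [MeasurableSpace β]
    [BorelSpace β] {f : α → β} {t : Set α} (hf : ContinuousOn f t) (ht : MeasurableSet t)
    {u : Set β} (hu : MeasurableSet u) : MeasurableSet (t ∩ f ⁻¹' u) := by
  have h1 : Measurable (t.domRestrict f) :=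
    (continuousOn_iff_continuous_domRestrict.1 hf).measurable
  have h2 := ht.subtype_image (h1 hu)
  convert h2 using 1
  ext x
  constructor
  · rintro ⟨hx, hxu⟩
    exact ⟨⟨x, hx⟩, hxu, rfl⟩
  · rintro ⟨y, hy, rfl⟩
    exact ⟨y.2, hy⟩

theorem frontier_setOf_lt_eq {E : Type*} [TopologicalSpace E] {f : E → ℝ} (hf : Continuous f) :
    frontier {z : E × ℝ | f z.1 < z.2} = {z | z.2 = f z.1} := by
  refine Subset.antisymm ((frontier_lt_subset_eq (hf.comp continuous_fst)
    continuous_snd).trans fun z hz => Eq.symm hz) fun z hz => ?_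
  have ho : IsOpen {z : E × ℝ | f z.1 < z.2} :=
    isOpen_lt (hf.comp continuous_fst) continuous_snd
  rw [ho.frontier_eq]
  refine ⟨?_, fun h => (lt_of_lt_of_eq h hz).false⟩
  have h1 : Tendsto (fun t : ℝ => (z.1, t)) (𝓝[>] z.2) (𝓝 z) :=
    ((Continuous.prodMk_right z.1).tendsto z.2).mono_left nhdsWithin_le_nhds
  refine mem_closure_of_tendsto h1 ?_
  filter_upwards [self_mem_nhdsWithin] with t ht
  exact (Eq.symm hz).trans_lt ht

section

variable {lam : EReal} {p : ℕ} {m : Fin p → ℕ} {N : Fin p → Type*}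
  [∀ q, TopologicalSpace (N q)] [∀ q, ChartedSpace (EuclideanSpace ℝ (Fin (m q))) (N q)]

/-- The inclusion of the interior of `[0, lam)` into the real line. The inverse takes the arbitrary
value `r₀` outside of `[0, lam)`. -/
noncomputable def radialOpenPartialHomeomorph (r₀ : radii lam) :
    OpenPartialHomeomorph (radii lam) ℝ := by
  classical
  exact
  { toFun := Subtype.val
    invFun := fun t => if h : t ∈ radii lam then ⟨t, h⟩ else r₀
    source := {t | 0 < (t : ℝ)}
    target := {t | t ∈ radii lam ∧ 0 < t}
    map_source' := fun t ht => ⟨t.2, ht⟩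
    map_target' := fun t ht => by
      rw [dif_pos ht.1]
      exact ht.2
    left_inv' := fun t _ => by rw [dif_pos t.2]
    right_inv' := fun t ht => by rw [dif_pos ht.1]
    open_source := isOpen_lt continuous_const continuous_subtype_val
    open_target := isOpen_setOf_mem_radii_pos lam
    continuousOn_toFun := continuous_subtype_val.continuousOn
    continuousOn_invFun := by
      rw [Topology.IsInducing.subtypeVal.continuousOn_iff]
      refine continuousOn_id.congr fun t ht => ?_
      simp only [Function.comp_apply, dif_pos ht.1, id] }

/-- A Lipschitz boundary point in the interior has a chart in which the boundary is a Lipschitz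
graph. -/
theorem LipschitzBoundaryAt.exists_chart {Ω : Set (WarpedProduct lam N)} {x₀ : WarpedProduct lam N}
    (h : LipschitzBoundaryAt m Ω x₀) (h0 : 0 < (x₀.1 : ℝ)) :
    ∃ (T : (ℝ × ∀ q, EuclideanSpace ℝ (Fin (m q))) ≃L[ℝ]
        (EuclideanSpace ℝ (Fin (∑ q, m q)) × ℝ))
      (f : EuclideanSpace ℝ (Fin (∑ q, m q)) → ℝ) (K : ℝ≥0)
      (e : OpenPartialHomeomorph (WarpedProduct lam N) (EuclideanSpace ℝ (Fin (∑ q, m q)) × ℝ)),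
      LipschitzWith K f ∧ x₀ ∈ e.source ∧ ∀ x ∈ e.source, 0 < (x.1 : ℝ) ∧
        x.2 ∈ chartDomain m x₀.2 ∧
        e x = T (x.1, fun q => chartAt (EuclideanSpace ℝ (Fin (m q))) (x₀.2 q) (x.2 q)) ∧
        (x ∈ frontier Ω ↔ (e x).2 = f (e x).1) := by
  obtain ⟨T, f, K, W, hf, hW, hx₀, hΩ⟩ := h
  let e₀ := ((radialOpenPartialHomeomorph x₀.1).prod (OpenPartialHomeomorph.pi fun q =>
    chartAt (EuclideanSpace ℝ (Fin (m q))) (x₀.2 q))).transHomeomorph T.toHomeomorph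
  let e := e₀.restrOpen W hW
  have hsource : ∀ x, x ∈ e.source ↔ (0 < (x.1 : ℝ) ∧ x.2 ∈ chartDomain m x₀.2) ∧ x ∈ W := by
    intro x
    simp [e, e₀, radialOpenPartialHomeomorph, chartDomain]
  have he : ∀ x, e x =
      T (x.1, fun q => chartAt (EuclideanSpace ℝ (Fin (m q))) (x₀.2 q) (x.2 q)) := fun x => rfl
  have himage : e.IsImage Ω {z | f z.1 < z.2} := by
    intro x hx
    rw [mem_ofPred_eq, he]
    exact ((hΩ x ((hsource x).1 hx).2).2).symm
  refine ⟨T, f, K, e, hf, (hsource x₀).2 ⟨⟨h0, mem_chartDomain_self _⟩, hx₀⟩, fun x hx => ?_⟩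
  refine ⟨((hsource x).1 hx).1.1, ((hsource x).1 hx).1.2, he x, ?_⟩
  have h1 := himage.frontier hx
  rw [frontier_setOf_lt_eq hf.continuous] at h1
  exact h1.symm

/-- The linear map from the coordinates of a product chart to the model space that turns the chart
into `warpChart θ₀ J c`. -/
noncomputable def frameMap
    (J : ∀ q, EuclideanSpace ℝ (Fin (m q)) ≃L[ℝ] EuclideanSpace ℝ (Fin (m q))) (c : Fin p → ℝ) :
    (ℝ × ∀ q, EuclideanSpace ℝ (Fin (m q))) →ₗ[ℝ] ModelSpace m where
  toFun v := WithLp.toLp 2 (v.1, WithLp.toLp 2 fun q => c q • J q (v.2 q))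
  map_add' v w := by
    simp only [Prod.fst_add, Prod.snd_add, Pi.add_apply, map_add, smul_add]
    rfl
  map_smul' a v := by
    simp only [Prod.smul_fst, Prod.smul_snd, Pi.smul_apply, map_smul, smul_comm _ a]
    rfl

theorem injective_frameMap
    (J : ∀ q, EuclideanSpace ℝ (Fin (m q)) ≃L[ℝ] EuclideanSpace ℝ (Fin (m q))) {c : Fin p → ℝ}
    (hc : ∀ q, c q ≠ 0) : Function.Injective (frameMap J c) := by
  refine (injective_iff_map_eq_zero _).2 fun v hv => Prod.ext ?_ (funext fun q => ?_)
  · exact congrArg (fun w : ModelSpace m => w.fst) hv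
  · have h1 : c q • J q (v.2 q) = 0 := congrArg (fun w : ModelSpace m => w.snd q) hv
    rw [smul_eq_zero_iff_right (hc q)] at h1
    exact (J q).map_eq_zero_iff.1 h1

variable [∀ q, IsManifold (𝓡 (m q)) ∞ (N q)]
  {g : ∀ q, SmoothMetric (m q) (N q)} {s : Fin p → ℝ → ℝ}
  [MeasurableSpace (∀ q, N q)] [BorelSpace (∀ q, N q)]
  [SecondCountableTopology (∀ q, N q)] [∀ q, T2Space (N q)] [∀ q, CompactSpace (N q)]
  {Ω : Set (WarpedProduct lam N)}

/-- If the area of the boundary is carried by the outer radial graph with density `A(ρ(θ)) dθ`, then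
near each interior point the boundary has essentially the same area as its radial projection. -/
theorem exists_nhds_hausdorffMeasure_le_volume_snd (hs : ∀ q, ContinuousOn (s q) (radii lam))
    (hs0 : ∀ q, ∀ r ∈ radii lam, 0 ≤ s q r)
    (hA : ∀ r ∈ radii lam, 0 < r → 0 < areaFactor m s r)
    (hΩ : Ω.Nonempty) (hΩo : IsOpen Ω) (hΩc : IsCompact (closure Ω))
    (hη : graphMeasure g s Ω =
      (polarMeasure lam g s (∑ q, m q)).restrict (polarCoords '' frontier Ω))
    {θ₀ : ∀ q, N q} {x₀ : WarpedProduct lam N} (h0 : 0 < (x₀.1 : ℝ))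
    (hx₀ : x₀.2 ∈ chartDomain m θ₀)
    {J : ∀ q, EuclideanSpace ℝ (Fin (m q)) ≃L[ℝ] EuclideanSpace ℝ (Fin (m q))}
    (hJ : ∀ q, IsChartFrame (g q) (θ₀ q) (x₀.2 q) (J q)) {κ : ℝ≥0} (hκ : 1 < κ) :
    ∃ U ∈ 𝓝 x₀, ∀ S ⊆ U ∩ frontier Ω, MeasurableSet S →
      (μHE[∑ q, m q] : Measure (ModelSpace m)) (warpChart θ₀ J (warpFactor m s x₀.1) '' S) ≤
        κ * volume ((fun x => (warpChart θ₀ J (warpFactor m s x₀.1) x).snd) '' S) := by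
  obtain ⟨κ', hκ', hle⟩ := NNReal.exists_one_lt_pow_le hκ 3
  have hle' : (κ' : ℝ≥0∞) * κ' * κ' ≤ κ := by
    have : (κ' : ℝ≥0∞) ^ 3 ≤ κ := by exact_mod_cast hle
    rwa [pow_succ, sq] at this
  have hA₀ := hA _ x₀.1.2 h0
  have hρ := measurable_radialSup hΩ hΩo hΩc
  have hG : Measurable fun θ => (radialSup Ω θ, θ) := hρ.prodMk measurable_id
  obtain ⟨U₁, hU₁, hU₁d, h₁⟩ :=
    exists_nhds_hausdorffMeasure_warpChart hx₀ hJ hs hs0 hA₀ (∑ q, m q) hκ'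
  obtain ⟨U₂, hU₂, hU₂d, h₂⟩ := exists_nhds_baseMeasure_baseChart hx₀ hJ hκ'
  have hev := eventually_radialDensity hs x₀.1.2 h0 hA₀ hκ'
  have hfst : Tendsto (fun x : WarpedProduct lam N => (x.1 : ℝ)) (𝓝 x₀) (𝓝 (x₀.1 : ℝ)) :=
    (continuous_subtype_val.comp continuous_fst).tendsto x₀
  refine ⟨_, inter_mem hU₁ (inter_mem (hfst.eventually hev) (inter_mem
    (hfst.eventually (lt_mem_nhds h0)) (continuous_snd.continuousAt.preimage_mem_nhds hU₂))),
    fun S hS hSm => ?_⟩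
  have hSp : MeasurableSet (polarCoords '' S) :=
    measurableEmbedding_polarCoords.measurableSet_image' hSm
  have harea : (μHE[∑ q, m q] : Measure (WarpedMetricSpace lam g s)) (toMetric g s '' S) =
      graphMeasure g s Ω (polarCoords '' S) := by
    rw [hη, Measure.restrict_apply hSp, inter_eq_left.2 (image_mono fun x hx => (hS hx).2),
      polarMeasure_apply hs hs0 hA]
    congr 2
    ext x
    constructor
    · exact fun hx => ⟨(hS hx).1.2.2.1, x, hx, rfl⟩
    · rintro ⟨-, y, hy, hxy⟩
      rwa [← injective_polarCoords hxy]
  have himg : (fun x => (warpChart θ₀ J (warpFactor m s x₀.1) x).snd) '' S =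
      stretchBase (warpFactor m s x₀.1) '' (baseChart θ₀ J '' (Prod.snd '' S)) := by
    rw [image_image, image_image]
    rfl
  have hpre : (fun θ => (radialSup Ω θ, θ)) ⁻¹' (polarCoords '' S) ⊆ Prod.snd '' S := by
    rintro θ ⟨x, hx, hxθ⟩
    exact ⟨x, hx, (Prod.ext_iff.1 hxθ).2⟩
  have hgraph : graphMeasure g s Ω (polarCoords '' S) ≤
      κ' * ENNReal.ofReal (areaFactor m s x₀.1) *
        (κ' * volume (baseChart θ₀ J '' (Prod.snd '' S))) := by
    rw [graphMeasure, Measure.map_apply hG hSp, withDensity_apply _ (hG hSp)]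
    calc _ ≤ ∫⁻ _ in (fun θ => (radialSup Ω θ, θ)) ⁻¹' (polarCoords '' S),
            κ' * ENNReal.ofReal (areaFactor m s x₀.1) ∂(baseMeasure g) := by
          refine setLIntegral_mono' (hG hSp) ?_
          rintro θ ⟨x, hx, hxθ⟩
          have h5 : (x.1 : ℝ) = radialSup Ω θ := (Prod.ext_iff.1 hxθ).1
          have h6 := (hS hx).1.2.1.1
          rwa [h5] at h6
      _ = κ' * ENNReal.ofReal (areaFactor m s x₀.1) *
            baseMeasure g ((fun θ => (radialSup Ω θ, θ)) ⁻¹' (polarCoords '' S)) :=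
          setLIntegral_const _ _
      _ ≤ _ := by
          refine mul_le_mul_right ((measure_mono hpre).trans (h₂ _ ?_).1) _
          rintro _ ⟨x, hx, rfl⟩
          exact (hS hx).1.2.2.2
  rw [himg, volume_image_stretchBase, prod_warpFactor_pow, abs_of_pos hA₀]
  calc _ ≤ κ' * graphMeasure g s Ω (polarCoords '' S) := by
        rw [← harea]
        exact (h₁ S fun x hx => (hS hx).1.1).2
    _ ≤ κ' * (κ' * ENNReal.ofReal (areaFactor m s x₀.1) *
        (κ' * volume (baseChart θ₀ J '' (Prod.snd '' S)))) := mul_le_mul_right hgraph _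
    _ = κ' * κ' * κ' * (ENNReal.ofReal (areaFactor m s x₀.1) *
        volume (baseChart θ₀ J '' (Prod.snd '' S))) := by ring
    _ ≤ _ := mul_le_mul_left hle' _

end

/-! ### Boundaries with the area of their radial projection -/

section

variable {lam : EReal} {p : ℕ} {m : Fin p → ℕ} {N : Fin p → Type*}
  [∀ q, TopologicalSpace (N q)] [∀ q, ChartedSpace (EuclideanSpace ℝ (Fin (m q))) (N q)]
  [∀ q, IsManifold (𝓡 (m q)) ∞ (N q)]
  {g : ∀ q, SmoothMetric (m q) (N q)} {s : Fin p → ℝ → ℝ}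
  [MeasurableSpace (∀ q, N q)] [BorelSpace (∀ q, N q)]
  [SecondCountableTopology (∀ q, N q)] [∀ q, T2Space (N q)] [∀ q, CompactSpace (N q)]
  {Ω : Set (WarpedProduct lam N)}

/-- If the area of the boundary is carried by the outer radial graph with density `A(ρ(θ)) dθ`, then
near a Lipschitz point the radius is constant along the boundary, so that the boundary contains a
piece of a coordinate slice. The reason is infinitesimal: the area of a graph equals that of its
projection only where the tangent plane is orthogonal to the radial direction. -/
theorem LipschitzBoundaryAt.exists_nhds_slice_subset_frontier
    (hs : ∀ q, ContinuousOn (s q) (radii lam)) (hs0 : ∀ q, ∀ r ∈ radii lam, 0 ≤ s q r)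
    (hA : ∀ r ∈ radii lam, 0 < r → 0 < areaFactor m s r)
    (hΩ : Ω.Nonempty) (hΩo : IsOpen Ω) (hΩc : IsCompact (closure Ω))
    (hη : graphMeasure g s Ω =
      (polarMeasure lam g s (∑ q, m q)).restrict (polarCoords '' frontier Ω))
    {x₀ : WarpedProduct lam N} (h0 : 0 < (x₀.1 : ℝ)) (hx₀ : x₀ ∈ frontier Ω)
    (h : LipschitzBoundaryAt m Ω x₀) :
    ∃ U ∈ 𝓝 x₀, ∀ x ∈ U, (x.1 : ℝ) = x₀.1 → x ∈ frontier Ω := by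
  obtain ⟨T, f, K, e, hf, hx₀e, he⟩ := h.exists_chart h0
  let E := EuclideanSpace ℝ (Fin (∑ q, m q))
  let W := ℝ × ∀ q, EuclideanSpace ℝ (Fin (m q))
  let Φ : E → W := fun y => T.symm (y, f y)
  have hΦ : LipschitzWith (‖(T.symm : E × ℝ →L[ℝ] W)‖₊ * max 1 K) Φ :=
    (T.symm : E × ℝ →L[ℝ] W).lipschitz.comp (LipschitzWith.id.prodMk hf)
  let π : W →L[ℝ] E := (ContinuousLinearMap.fst ℝ E ℝ).comp (T : W →L[ℝ] E × ℝ)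
  have hπ : ∀ y, π (Φ y) = y := fun y => by simp [π, Φ]
  let l : W →L[ℝ] ℝ := ContinuousLinearMap.fst ℝ ℝ _
  have hgraph : Continuous fun y : E => (y, f y) := continuous_id.prodMk hf.continuous
  let O : Set E := {y | (y, f y) ∈ e.target}
  have hO : IsOpen O := e.open_target.preimage hgraph
  have hΦe : ∀ x ∈ e.source, x ∈ frontier Ω → Φ (e x).1 =
      ((x.1 : ℝ), fun q => chartAt (EuclideanSpace ℝ (Fin (m q))) (x₀.2 q) (x.2 q)) := by
    intro x hx hxΩ
    have h1 : ((e x).1, f (e x).1) = e x := Prod.ext rfl ((he x hx).2.2.2.1 hxΩ).symm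
    have h2 := (he x hx).2.2.1
    simp only [Φ]
    rw [h1, h2, T.symm_apply_apply]
  have hinv : ∀ y ∈ O, e.symm (y, f y) ∈ e.source ∧ e (e.symm (y, f y)) = (y, f y) ∧
      e.symm (y, f y) ∈ frontier Ω := by
    intro y hy
    have h1 := e.map_target hy
    have h2 := e.right_inv hy
    refine ⟨h1, h2, (he _ h1).2.2.2.2 ?_⟩
    rw [h2]
  have hdim : Module.finrank ℝ (ModelBase m) = Module.finrank ℝ E := by
    rw [finrank_euclideanSpace_fin,
      (WithLp.linearEquiv 2 ℝ (∀ q, EuclideanSpace ℝ (Fin (m q)))).finrank_eq,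
      Module.finrank_pi_fintype]
    simp only [finrank_euclideanSpace_fin]
  have hae := ae_hasFDerivAt_zero_of_forall_exists_frame
    (WithLp.sndL 2 ℝ ℝ (ModelBase m)) (fun w => WithLp.norm_snd_le _ w)
    hdim hΦ hπ l hO fun y₁ hy₁ => by
    obtain ⟨hx₁, hex₁, hx₁Ω⟩ := hinv y₁ hy₁
    set x₁ := e.symm (y₁, f y₁) with hx₁_def
    obtain ⟨hx₁0, hx₁c, -⟩ := he x₁ hx₁
    obtain ⟨J, hJ⟩ := exists_chartFrames g hx₁c
    have hc : ∀ q, warpFactor m s x₁.1 q ≠ 0 := fun q =>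
      (warpFactor_pos (fun q => hs0 q _ x₁.1.2) (hA _ x₁.1.2 hx₁0) q).ne'
    refine ⟨(frameMap J (warpFactor m s x₁.1)).toContinuousLinearMap,
      injective_frameMap J hc, fun v hv => ?_, fun κ hκ => ?_⟩
    · set w := (frameMap J (warpFactor m s x₁.1)).toContinuousLinearMap v with hw
      have h1 : w.fst = l v := rfl
      have h2 := WithLp.prod_norm_sq_eq_of_L2 w
      have h3 : 0 < ‖w.fst‖ := by rw [h1]; exact norm_pos_iff.2 hv
      change ‖w.snd‖ < ‖w‖
      nlinarith [norm_nonneg w, norm_nonneg w.snd]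
    · obtain ⟨U, hU, hle⟩ := exists_nhds_hausdorffMeasure_le_volume_snd hs hs0 hA hΩ hΩo hΩc hη
        hx₁0 hx₁c hJ hκ
      have hcont : ContinuousAt (fun y => e.symm (y, f y)) y₁ :=
        ContinuousAt.comp (f := fun y => (y, f y)) (e.continuousAt_symm hy₁) hgraph.continuousAt
      obtain ⟨U', hU'U, hU'o, hU'⟩ := mem_nhds_iff.1 hU
      refine ⟨_, inter_mem (hO.mem_nhds hy₁) (hcont.preimage_mem_nhds (hU'o.mem_nhds hU')),
        fun u hu hum => ?_⟩
      -- The part of the boundary lying over `u`.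
      let S : Set (WarpedProduct lam N) :=
        (e.source ∩ (fun x => (e x).1) ⁻¹' u) ∩ (frontier Ω ∩ U')
      have hS : MeasurableSet S :=
        (ContinuousOn.measurableSet_inter_preimage (continuous_fst.comp_continuousOn
          e.continuousOn) e.open_source.measurableSet hum).inter
          (isClosed_frontier.measurableSet.inter hU'o.measurableSet)
      have himg : (fun y => (frameMap J (warpFactor m s x₁.1)).toContinuousLinearMap (Φ y)) '' u =
          warpChart x₀.2 J (warpFactor m s x₁.1) '' S := by
        have h1 : ∀ x ∈ e.source, x ∈ frontier Ω →
            (frameMap J (warpFactor m s x₁.1)).toContinuousLinearMap (Φ (e x).1) =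
              warpChart x₀.2 J (warpFactor m s x₁.1) x := by
          intro x hx hxΩ
          rw [hΦe x hx hxΩ]
          rfl
        refine Subset.antisymm ?_ ?_
        · rintro _ ⟨y, hy, rfl⟩
          obtain ⟨h2, h3, h4⟩ := hinv y (hu hy).1
          have h5 : (e (e.symm (y, f y))).1 = y := by rw [h3]
          refine ⟨e.symm (y, f y), ⟨⟨h2, ?_⟩, h4, (hu hy).2⟩, ?_⟩
          · rwa [mem_preimage, h5]
          · rw [← h1 _ h2 h4, h5]
        · rintro _ ⟨x, hx, rfl⟩
          exact ⟨_, hx.1.2, h1 x hx.1.1 hx.2.1⟩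
      have h6 := hle S (fun x hx => ⟨hU'U hx.2.2, hx.2.1⟩) hS
      rw [himg, image_image, finrank_euclideanSpace_fin]
      exact h6
  have hy₀ : (e x₀).1 ∈ O := by
    have h1 : ((e x₀).1, f (e x₀).1) = e x₀ := Prod.ext rfl ((he x₀ hx₀e).2.2.2.1 hx₀).symm
    change ((e x₀).1, f (e x₀).1) ∈ e.target
    rw [h1]
    exact e.map_source hx₀e
  obtain ⟨ε, hε, hball⟩ := Metric.isOpen_iff.1 hO _ hy₀
  have hl : LipschitzWith _ fun y => l (Φ y) := l.lipschitz.comp hΦ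
  have hconst : ∀ y ∈ Metric.ball (e x₀).1 ε, l (Φ y) = x₀.1 := by
    intro y hy
    rw [hl.eq_of_ae_hasFDerivAt_zero volume (hae.mono fun y hy h => hy (hball h)) y hy,
      hΦe x₀ hx₀e hx₀]
    rfl
  -- The radius as a linear function in the graph coordinates.
  let l' : E × ℝ →L[ℝ] ℝ := l.comp (T.symm : E × ℝ →L[ℝ] W)
  have hβ : l' (0, 1) ≠ 0 := by
    intro hβ
    have hl' : ∀ y : E, ∀ t : ℝ, l' (y, t) = l' (y, 0) := by
      intro y t
      have h1 : (y, t) = (y, (0 : ℝ)) + t • ((0 : E), (1 : ℝ)) := by simp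
      rw [h1, map_add, map_smul, hβ, smul_zero, add_zero]
    have h1 : Tendsto (fun t : ℝ => (1 + t) • (e x₀).1) (𝓝 0) (𝓝 (e x₀).1) := by
      have : Continuous fun t : ℝ => (1 + t) • (e x₀).1 := by fun_prop
      simpa using this.tendsto 0
    have h2 := h1.eventually (Metric.ball_mem_nhds _ hε)
    obtain ⟨t, ht, ht0⟩ := ((h2.filter_mono nhdsWithin_le_nhds).and
      (self_mem_nhdsWithin (s := {(0 : ℝ)}ᶜ))).exists
    have h3 : l' ((1 + t) • (e x₀).1, f ((1 + t) • (e x₀).1)) = x₀.1 := hconst _ ht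
    have h4 : l' ((e x₀).1, f (e x₀).1) = x₀.1 := hconst _ (Metric.mem_ball_self hε)
    have h5 : ((1 + t) • (e x₀).1, (0 : ℝ)) = (1 + t) • ((e x₀).1, (0 : ℝ)) := by simp
    rw [hl'] at h3 h4
    rw [h5, map_smul, h4, smul_eq_mul, add_mul, one_mul, add_eq_left] at h3
    exact (mul_ne_zero ht0 h0.ne') h3
  have hcont : ContinuousAt (fun x => (e x).1) x₀ :=
    continuous_fst.continuousAt.comp (e.continuousAt hx₀e)
  refine ⟨_, inter_mem (e.open_source.mem_nhds hx₀e)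
    (hcont.preimage_mem_nhds (Metric.ball_mem_nhds _ hε)), fun x hx hxr => ?_⟩
  refine (he x hx.1).2.2.2.2 ?_
  have h1 : l' (e x) = x₀.1 := by
    rw [(he x hx.1).2.2.1]
    simp only [l', ContinuousLinearMap.comp_apply, ContinuousLinearEquiv.coe_coe,
      T.symm_apply_apply]
    exact hxr
  have h2 : l' ((e x).1, f (e x).1) = x₀.1 := hconst _ hx.2
  have h3 : e x = ((e x).1, f (e x).1) + ((e x).2 - f (e x).1) • ((0 : E), (1 : ℝ)) := by
    refine Prod.ext ?_ ?_ <;> simp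
  rw [h3, map_add, h2, map_smul, add_eq_left, smul_eq_mul, mul_eq_zero,
    or_iff_left hβ, sub_eq_zero] at h1
  exact h1

end

/-! ### Sets bounded by a coordinate slice -/

section

variable {lam : EReal} {p : ℕ} {N : Fin p → Type*} [∀ q, TopologicalSpace (N q)]
  [PreconnectedSpace (∀ q, N q)] {Ω : Set (WarpedProduct lam N)}

theorem isPreconnected_setOf_radius_mem {J : Set ℝ} (hJ : J.OrdConnected) :
    IsPreconnected {x : WarpedProduct lam N | (x.1 : ℝ) ∈ J} := by
  have h1 : IsPreconnected ((↑) ⁻¹' J : Set (radii lam)) := by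
    rw [← Topology.IsInducing.subtypeVal.isPreconnected_image, Subtype.image_preimage_coe]
    exact ((ordConnected_radii lam).inter hJ).isPreconnected
  convert h1.prod (isPreconnected_univ (α := ∀ q, N q)) using 1
  ext x
  exact ⟨fun h => ⟨h, mem_univ _⟩, fun h => h.1⟩

theorem setOf_radius_mem_subset (hΩo : IsOpen Ω) {J : Set ℝ} (hJ : J.OrdConnected)
    (hfr : ∀ x ∈ frontier Ω, (x.1 : ℝ) ∉ J) {x : WarpedProduct lam N} (hx : x ∈ Ω)
    (hxJ : (x.1 : ℝ) ∈ J) : {y : WarpedProduct lam N | (y.1 : ℝ) ∈ J} ⊆ Ω := by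
  refine (isPreconnected_setOf_radius_mem hJ).subset_left_of_subset_union hΩo
    isClosed_closure.isOpen_compl (disjoint_compl_right.mono_left subset_closure) (fun y hy => ?_)
    ⟨x, hxJ, hx⟩
  by_contra! h
  rw [mem_union, mem_compl_iff, not_or, not_not] at h
  exact hfr y (by rw [hΩo.frontier_eq]; exact ⟨h.2, h.1⟩) hy

/-- A boundary which, near each of its points, contains the coordinate slice through that point,
contains the whole slice. -/
theorem slice_subset_frontier {x₀ : WarpedProduct lam N} (hx₀ : x₀ ∈ frontier Ω)
    (h : ∀ x ∈ frontier Ω, (x.1 : ℝ) = x₀.1 →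
      ∃ U ∈ 𝓝 x, ∀ y ∈ U, (y.1 : ℝ) = x.1 → y ∈ frontier Ω) :
    slice lam N x₀.1 ⊆ frontier Ω := by
  have hcont : Continuous fun θ : ∀ q, N q => ((x₀.1, θ) : WarpedProduct lam N) :=
    Continuous.prodMk_right _
  have hclopen : IsClopen {θ : ∀ q, N q | ((x₀.1, θ) : WarpedProduct lam N) ∈ frontier Ω} := by
    refine ⟨isClosed_frontier.preimage hcont, isOpen_iff_mem_nhds.2 fun θ hθ => ?_⟩
    obtain ⟨U, hU, hUΩ⟩ := h _ hθ rfl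
    filter_upwards [hcont.continuousAt.preimage_mem_nhds hU] with θ' hθ'
    exact hUΩ _ hθ' rfl
  intro x hx
  have h1 : x.2 ∈ {θ : ∀ q, N q | ((x₀.1, θ) : WarpedProduct lam N) ∈ frontier Ω} := by
    rw [hclopen.eq_univ ⟨x₀.2, hx₀⟩]
    trivial
  have h2 : x = (x₀.1, x.2) := Prod.ext (Subtype.ext hx) rfl
  rw [h2]
  exact h1

/-- An open set with compact closure which has no boundary points in the interior outside of one
coordinate slice is a ball. -/
theorem eq_radialBall_of_frontier_subset_slice (hΩ : Ω.Nonempty) (hΩo : IsOpen Ω)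
    (hΩc : IsCompact (closure Ω))
    (h0 : ∀ ε > 0, {x | 0 < (x.1 : ℝ) ∧ (x.1 : ℝ) < ε} ⊆ Ω → slice lam N 0 ⊆ Ω)
    {c : ℝ} (hc : c ∈ radii lam) (hfr : ∀ x ∈ frontier Ω, 0 < (x.1 : ℝ) → (x.1 : ℝ) = c) :
    0 < c ∧ Ω = radialBall lam N c := by
  obtain ⟨r, hr, hΩr⟩ := exists_radius_bound hΩ hΩc
  have hle : ∀ x ∈ Ω, (x.1 : ℝ) ≤ c := by
    intro x hx
    by_contra! hxc
    have hsub := setOf_radius_mem_subset hΩo ordConnected_Ioi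
      (fun y hy hyc => (ne_of_gt hyc) (hfr y hy (hc.1.trans_lt hyc))) hx hxc
    obtain ⟨r', hr', hlt⟩ := exists_gt_mem_radii hr
    have h1 := hΩr (⟨r', hr'⟩, x.2) (hsub (hxc.trans_le ((hΩr x hx).trans hlt.le)))
    exact absurd h1 (not_le.2 hlt)
  have hlt : ∀ x ∈ Ω, (x.1 : ℝ) < c := by
    intro x hx
    obtain ⟨y, hy, hxy, -⟩ := exists_gt_mem_of_isOpen hΩo hx
    exact lt_of_lt_of_le hxy (hle y hy)
  obtain ⟨x, hx⟩ := id hΩ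
  have hc0 : 0 < c := x.1.2.1.trans_lt (hlt x hx)
  obtain ⟨y, hy, hxy, -⟩ := exists_gt_mem_of_isOpen hΩo hx
  have hsub : {y : WarpedProduct lam N | (y.1 : ℝ) ∈ Ioo 0 c} ⊆ Ω :=
    setOf_radius_mem_subset hΩo ordConnected_Ioo
      (fun z hz hzc => hzc.2.ne (hfr z hz hzc.1)) hy ⟨x.1.2.1.trans_lt hxy, hlt y hy⟩
  refine ⟨hc0, Subset.antisymm hlt fun z hz => ?_⟩
  rcases z.1.2.1.lt_or_eq with h | h
  · exact hsub ⟨h, hz⟩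
  · exact h0 c hc0 hsub h.symm

end

section

variable {lam : EReal} {p : ℕ} {m : Fin p → ℕ} {N : Fin p → Type*}
  [∀ q, TopologicalSpace (N q)] [∀ q, ChartedSpace (EuclideanSpace ℝ (Fin (m q))) (N q)]
  [∀ q, IsManifold (𝓡 (m q)) ∞ (N q)]
  {g : ∀ q, SmoothMetric (m q) (N q)} {s : Fin p → ℝ → ℝ}
  [MeasurableSpace (∀ q, N q)] [BorelSpace (∀ q, N q)]
  [SecondCountableTopology (∀ q, N q)] [∀ q, T2Space (N q)] [∀ q, CompactSpace (N q)]
  {Ω : Set (WarpedProduct lam N)}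

/-- If the area of the boundary is carried by the outer radial graph and the boundary contains a
coordinate slice, then almost every point of the graph lies on that slice. -/
theorem ae_radialSup_eq_of_slice_subset_frontier (hs : ∀ q, ContinuousOn (s q) (radii lam))
    (hs0 : ∀ q, ∀ r ∈ radii lam, 0 ≤ s q r)
    (hA : ∀ r ∈ radii lam, 0 < r → 0 < areaFactor m s r)
    (hΩ : Ω.Nonempty) (hΩo : IsOpen Ω) (hΩc : IsCompact (closure Ω))
    (hη : graphMeasure g s Ω =
      (polarMeasure lam g s (∑ q, m q)).restrict (polarCoords '' frontier Ω))
    {r : ℝ} (hr : r ∈ radii lam) (h0 : 0 < r) (hfr : slice lam N r ⊆ frontier Ω) :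
    ∀ᵐ θ ∂(baseMeasure g), radialSup Ω θ = r := by
  have := isFiniteMeasure_baseMeasure g
  have hρ := measurable_radialSup hΩ hΩo hΩc
  have hG : Measurable fun θ => (radialSup Ω θ, θ) := hρ.prodMk measurable_id
  have hm : MeasurableSet {θ | radialSup Ω θ = r} := hρ (measurableSet_singleton r)
  have hS : MeasurableSet (Prod.fst ⁻¹' {r} : Set (ℝ × ∀ q, N q)) :=
    measurable_fst (measurableSet_singleton r)
  rw [ae_iff_measure_eq hm.nullMeasurableSet]
  have h1 : graphMeasure g s Ω (Prod.fst ⁻¹' {r}) =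
      ENNReal.ofReal (areaFactor m s r) * baseMeasure g {θ | radialSup Ω θ = r} := by
    rw [graphMeasure, Measure.map_apply hG hS, withDensity_apply _ (hG hS), ← setLIntegral_const]
    refine setLIntegral_congr_fun hm fun θ hθ => ?_
    rw [show radialSup Ω θ = r from hθ, radialDensity_of_pos hr h0]
  have h2 : graphMeasure g s Ω (Prod.fst ⁻¹' {r}) = riemArea g s (slice lam N r) := by
    rw [hη, Measure.restrict_apply hS, polarMeasure_apply hs hs0 hA, riemArea]
    congr 2
    ext x
    constructor
    · exact fun hx => hx.2.1
    · intro hx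
      refine ⟨?_, hx, x, hfr hx, rfl⟩
      rw [show (x.1 : ℝ) = r from hx]
      exact h0
  rw [h1, riemArea_slice hs hs0 hA hr h0] at h2
  exact (ENNReal.mul_right_inj (ENNReal.ofReal_pos.2 (hA r hr h0)).ne' ENNReal.ofReal_ne_top).1 h2

/-- If the area of the boundary is carried by the outer radial graph with density `A(ρ(θ)) dθ`, then
the boundary lies in one coordinate slice, apart from points with `r = 0`. -/
theorem exists_frontier_subset_slice [PreconnectedSpace (∀ q, N q)]
    (hs : ∀ q, ContinuousOn (s q) (radii lam)) (hs0 : ∀ q, ∀ r ∈ radii lam, 0 ≤ s q r)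
    (hA : ∀ r ∈ radii lam, 0 < r → 0 < areaFactor m s r)
    (hΩ : Ω.Nonempty) (hΩo : IsOpen Ω) (hΩc : IsCompact (closure Ω))
    (hη : graphMeasure g s Ω =
      (polarMeasure lam g s (∑ q, m q)).restrict (polarCoords '' frontier Ω))
    (hlip : ∀ x ∈ frontier Ω, 0 < (x.1 : ℝ) → LipschitzBoundaryAt m Ω x) :
    ∃ c ∈ radii lam, ∀ x ∈ frontier Ω, 0 < (x.1 : ℝ) → (x.1 : ℝ) = c := by
  obtain ⟨x₀, -⟩ := id hΩ
  by_cases h : ∃ x ∈ frontier Ω, 0 < (x.1 : ℝ)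
  · obtain ⟨x, hx, hx0⟩ := h
    have hae : ∀ y ∈ frontier Ω, 0 < (y.1 : ℝ) → ∀ᵐ θ ∂(baseMeasure g), radialSup Ω θ = y.1 := by
      intro y hy hy0
      refine ae_radialSup_eq_of_slice_subset_frontier hs hs0 hA hΩ hΩo hΩc hη y.1.2 hy0
        (slice_subset_frontier hy fun z hz hzy => ?_)
      rw [← hzy] at hy0
      exact (hlip z hz hy0).exists_nhds_slice_subset_frontier hs hs0 hA hΩ hΩo hΩc hη hy0 hz
    have hne : (ae (baseMeasure g)).NeBot := by
      refine ae_neBot.2 fun h0 => ?_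
      have h1 := baseMeasure_pos_of_mem_nhds g (θ₀ := x₀.2) univ_mem
      rw [h0] at h1
      exact h1.false
    refine ⟨x.1, x.1.2, fun y hy hy0 => ?_⟩
    obtain ⟨θ, h1, h2⟩ := ((hae y hy hy0).and (hae x hx hx0)).exists
    rw [← h1, h2]
  · exact ⟨0, zero_mem_radii x₀.1.2, fun x hx hx0 => absurd ⟨x, hx, hx0⟩ h⟩

end

end

theorem mainTheorem1 {p : ℕ} (lam : EReal) (m : Fin p → ℕ) (N : Fin p → Type*)
    [∀ q, TopologicalSpace (N q)] [∀ q, T2Space (N q)] [∀ q, CompactSpace (N q)]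
    [∀ q, ChartedSpace (EuclideanSpace ℝ (Fin (m q))) (N q)]
    [∀ q, IsManifold (𝓡 (m q)) ∞ (N q)]
    (g : ∀ q, SmoothMetric (m q) (N q))
    (s : Fin p → ℝ → ℝ)
    (hs_cont : ∀ q, ContinuousOn (s q) (radii lam))
    (hs_nonneg : ∀ q, ∀ r ∈ radii lam, 0 ≤ s q r)
    (hA_pos : ∀ r ∈ radii lam, 0 < r → 0 < areaFactor m s r)
    (a : ℝ → ℝ)
    (ha_cont : ContinuousOn a (radii lam))
    (ha_nonneg : ∀ r ∈ radii lam, 0 ≤ a r)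
    (h_mono : MonotoneOn (fun r => (a r - a 0) * areaFactor m s r) (radii lam))
    (h_convex : ConvexOn ℝ (ballVolume lam g s '' radii lam)
      (fun u => (a (ballVolumeInv lam g s u) - a 0) *
        areaFactor m s (ballVolumeInv lam g s u)))
    (Ω : Set (WarpedProduct lam N))
    (hΩ_nonempty : Ω.Nonempty) (hΩ_open : IsOpen Ω) (hΩ_bounded : IsCompact (closure Ω))
    (hΩ_lipschitz : ∀ x ∈ frontier Ω, 0 < (x.1 : ℝ) → LipschitzBoundaryAt m Ω x)
    (R : ℝ) (hR : R ∈ radii lam)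
    (hR_volume : riemVolume g s (radialBall lam N R) = riemVolume g s Ω)
    (h_isoperimetric :
      riemArea g s (frontier (radialBall lam N R)) ≤ riemArea g s (frontier Ω)) :
    areaIntegral g s a (frontier (radialBall lam N R)) ≤ areaIntegral g s a (frontier Ω) ∧
    ((∀ q, ConnectedSpace (N q)) →
      (∀ ε > 0, {x | 0 < (x.1 : ℝ) ∧ (x.1 : ℝ) < ε} ⊆ Ω → slice lam N 0 ⊆ Ω) →
      (∀ r ∈ radii lam, 0 < r → 0 < (a r - a 0) * areaFactor m s r) →
      (areaIntegral g s a (frontier Ω) = areaIntegral g s a (frontier (radialBall lam N R)) ↔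
        ∃ c ∈ radii lam, frontier Ω = slice lam N c)) := by
  borelize (∀ q, N q)
  have hsc : ∀ q, SecondCountableTopology (N q) := fun q =>
    ChartedSpace.secondCountable_of_sigmaCompact (EuclideanSpace ℝ (Fin (m q))) (N q)
  have hb0 : a 0 - a 0 = 0 := sub_self _
  have hbc : ContinuousOn (fun r => a r - a 0) (radii lam) := ha_cont.sub continuousOn_const
  have h0 : (0 : ℝ) ∈ radii lam := zero_mem_radii hR
  have hle : ∀ r ∈ radii lam, a 0 ≤ a r := fun r hr =>
    sub_nonneg.1 (nonneg_of_monotoneOn_mul_areaFactor (b := fun r => a r - a 0) hA_pos hb0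
      h_mono hr)
  have hR0 : 0 < R := radius_pos_of_riemVolume_eq hs_cont hs_nonneg hA_pos hΩ_nonempty hΩ_open
    hR_volume
  have hfin := isFiniteMeasure_baseMeasure g
  have hweighted := areaIntegral_slice_le_areaIntegral_frontier (b := fun r => a r - a 0) hs_cont
    hs_nonneg hA_pos hb0 hbc h_mono h_convex hΩ_nonempty hΩ_open hΩ_bounded hR hR_volume
  rw [frontier_radialBall hR0] at h_isoperimetric ⊢
  -- The weight is the sum of the constant `a 0`, for which the classical isoperimetric inequality
  -- is used, and of a weight that vanishes at `r = 0`.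
  have hconst := mul_le_mul_right h_isoperimetric (ENNReal.ofReal (a 0))
  rw [areaIntegral_eq_add (ha_nonneg 0 h0) hle,
    areaIntegral_eq_add (ha_nonneg 0 h0) hle (frontier Ω)]
  refine ⟨add_le_add hconst hweighted, fun hconn hε hpos => ⟨fun heq => ?_, ?_⟩⟩
  · have hconst_ne : ENNReal.ofReal (a 0) * riemArea g s (slice lam N R) ≠ ⊤ := by
      rw [riemArea_slice hs_cont hs_nonneg hA_pos hR hR0]
      finiteness
    -- The terms of the constant weight may be cancelled, the one of the ball being finite.
    have hle' : areaIntegral g s (fun r => a r - a 0) (frontier Ω) ≤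
        areaIntegral g s (fun r => a r - a 0) (slice lam N R) :=
      (ENNReal.add_le_add_iff_left hconst_ne).1 ((add_le_add hconst le_rfl).trans heq.le)
    have hη := graphMeasure_eq_of_areaIntegral_le (b := fun r => a r - a 0) hs_cont hs_nonneg hA_pos
      hb0 hbc h_mono h_convex hpos hΩ_nonempty hΩ_open hΩ_bounded hR hR_volume hle'
    obtain ⟨c, hc, hfr⟩ := exists_frontier_subset_slice hs_cont hs_nonneg hA_pos hΩ_nonempty hΩ_open
      hΩ_bounded hη hΩ_lipschitz
    obtain ⟨hc0, hball⟩ := eq_radialBall_of_frontier_subset_slice hΩ_nonempty hΩ_open hΩ_bounded hε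
      hc hfr
    exact ⟨c, hc, by rw [hball, frontier_radialBall hc0]⟩
  · rintro ⟨c, hc, hfr⟩
    obtain ⟨hc0, hball⟩ := eq_radialBall_of_frontier_subset_slice hΩ_nonempty hΩ_open hΩ_bounded hε
      hc fun x hx _ => by rwa [hfr] at hx
    -- The volume determines the radius of a ball.
    have hM : baseMeasure g univ ≠ 0 := by
      obtain ⟨x₀, -⟩ := hΩ_nonempty
      exact (baseMeasure_pos_of_mem_nhds g (θ₀ := x₀.2) Filter.univ_mem).ne'
    rw [hball, riemVolume_radialBall hs_cont hs_nonneg hA_pos hR,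
      riemVolume_radialBall hs_cont hs_nonneg hA_pos hc,
      ENNReal.mul_left_inj hM (measure_ne_top _ _),
      ENNReal.ofReal_eq_ofReal_iff (radialVolume_nonneg hs_cont hA_pos hR)
        (radialVolume_nonneg hs_cont hA_pos hc),
      (strictMonoOn_radialVolume hs_cont hA_pos).injOn.eq_iff hR hc] at hR_volume
    rw [hfr, hR_volume]
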